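/- Let $n\in\mathbb{N}_0$; all functions and distributions are complex-valued and live on $\mathbb{R}^n$. For $1\le p\le\infty$ let $\mathcal{D}_{L^p}$ be the space of all $f\in C^\infty$ with $\partial^\alpha f\in L^p$ for every multi-index $\alpha$, with the norms $p_m(f)=\sup_{|\alpha|\le m}\|\partial^\alpha f\|_p$, $m\in\mathbb{N}_0$. Let $\dot{\mathcal{B}}\subset\mathcal{D}_{L^\infty}$ be the subspace, with the subspace topology, of the functions all of whose derivatives tend to $0$ at infinity. Let $\mathcal{E}=C^\infty$ with the seminorms $\sup_{x\in K,|\alpha|\le m}|\partial^\alpha f(x)|$, $K\subset\mathbb{R}^n$ compact, $m\in\mathbb{N}_0$. For $1\le q\le\infty$ let $\mathcal{D}'_{L^q}$ be the space of the distributions $T=\sum_{|\alpha|\le m}\partial^\alpha f_\alpha$ with $m\in\mathbb{N}_0$ and $f_\alpha\in L^q$. Such a $T$ acts on the predual of $\mathcal{D}'_{L^q}$ (which is $\mathcal{D}_{L^p}$, $\frac1p+\frac1q=1$, if $q>1$, and $\dot{\mathcal{B}}$ if $q=1$) by $\langle g,T\rangle=\sum_{|\alpha|\le m}(-1)^{|\alpha|}\int\partial^\alpha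 g\,f_\alpha\,dx$, and $\mathcal{D}'_{L^q}$ carries the topology of uniform convergence on the bounded subsets of its predual. Let $\mathcal{E}'$ be the space of the distributions with compact support, i.e. the dual of $\mathcal{E}$, with the topology of uniform convergence on the bounded subsets of $\mathcal{E}$. The following bilinear maps are well-defined and jointly continuous: for all $1\le p\le\infty$ the multiplication $\mathcal{D}_{L^p}\times\mathcal{D}_{L^\infty}\to\mathcal{D}_{L^p}$; the multiplications $\dot{\mathcal{B}}\times\mathcal{D}_{L^\infty}\to\dot{\mathcal{B}}$ and $\mathcal{E}\times\mathcal{E}\to\mathcal{E}$; for all $1\le q\le\infty$ the convolution $\mathcal{D}'_{L^q}\times\mathcal{D}'_{L^1}\to\mathcal{D}'_{L^q}$; and the convolution $\mathcal{E}'\times\mathcal{E}'\to\mathcal{E}'$. Here the convolution $S\ast T$ of two distributions is the distribution with $\big((S\ast T)\ast(\varphi\ast\psi)\big)(0)=\int(S\ast\varphi)(y)\,(T\ast\psi)(-y)\,dy$ for all test functions $\varphi,\psi$, it being part of the assertion that the integrand is integrable. In particular $(\mathcal{D}_{L^\infty},\cdot)$, $(\mathcal{E},\cdot)$, $(\mathcal{E}',\ast)$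 and $(\mathcal{D}'_{L^1},\ast)$ are topological algebras, i.e. associative algebras with jointly continuous operations. -/

import Mathlib

open MeasureTheory TopologicalSpace
open scoped ENNReal Distributions CompactConvergenceCLM Convolution

namespace DistSpaces

noncomputable section

/-! ## Partial derivatives -/

/-- The space `ℝⁿ`. -/
abbrev Rn (n : ℕ) : Type := EuclideanSpace ℝ (Fin n)

/-- The list of coordinates in which `∂^α` differentiates: every `i` occurs `α i` times. -/
def derivWord {n : ℕ} (α : Fin n → ℕ) : List (Fin n) :=
  (List.finRange n).flatMap fun i => List.replicate (α i) i

/-- The partial derivative `∂^α f`, for a multi-index `α`. -/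
def pderiv {n : ℕ} (α : Fin n → ℕ) (f : Rn n → ℂ) (x : Rn n) : ℂ :=
  iteratedFDeriv ℝ (derivWord α).length f x
    fun j => EuclideanSpace.single ((derivWord α).get j) (1 : ℝ)

/-- The finite set of the multi-indices `α` with `|α| ≤ m`. -/
def multiIdx (n m : ℕ) : Finset (Fin n → ℕ) :=
  (Fintype.piFinset fun _ => Finset.range (m + 1)).filter fun α => ∑ i, α i ≤ m

theorem mem_multiIdx {n m : ℕ} {α : Fin n → ℕ} : α ∈ multiIdx n m ↔ ∑ i, α i ≤ m := by
  simp only [multiIdx, Finset.mem_filter, Fintype.mem_piFinset, Finset.mem_range,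
    and_iff_right_iff_imp]
  intro h i
  have := Finset.single_le_sum (f := α) (fun j _ => Nat.zero_le _) (Finset.mem_univ i)
  omega

theorem smooth_le (k : ℕ) : (k : WithTop ℕ∞) ≤ (⊤ : ℕ∞) := by
  exact_mod_cast (le_top : (k : ℕ∞) ≤ ⊤)

theorem pderiv_add {n : ℕ} (α : Fin n → ℕ) {f g : Rn n → ℂ} (hf : ContDiff ℝ (⊤ : ℕ∞) f)
    (hg : ContDiff ℝ (⊤ : ℕ∞) g) : pderiv α (f + g) = pderiv α f + pderiv α g := by
  funext x
  simp only [pderiv, Pi.add_apply]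
  rw [iteratedFDeriv_add_apply (hf.of_le (smooth_le _)).contDiffAt
    (hg.of_le (smooth_le _)).contDiffAt]
  rfl

theorem pderiv_smul {n : ℕ} (α : Fin n → ℕ) (c : ℂ) {f : Rn n → ℂ} (hf : ContDiff ℝ (⊤ : ℕ∞) f) :
    pderiv α (c • f) = c • pderiv α f := by
  funext x
  simp only [pderiv, Pi.smul_apply]
  rw [iteratedFDeriv_const_smul_apply (hf.of_le (smooth_le _)).contDiffAt]
  rfl

theorem pderiv_zero {n : ℕ} (α : Fin n → ℕ) : pderiv α (0 : Rn n → ℂ) = 0 := by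
  have := pderiv_smul α 0 (contDiff_zero_fun : ContDiff ℝ (⊤ : ℕ∞) (0 : Rn n → ℂ))
  simpa using this

theorem continuous_pderiv {n : ℕ} (α : Fin n → ℕ) {f : Rn n → ℂ} (hf : ContDiff ℝ (⊤ : ℕ∞) f) :
    Continuous (pderiv α f) :=
  (ContinuousMultilinearMap.apply ℝ (fun _ : Fin (derivWord α).length => Rn n) ℂ _).continuous.comp
    (hf.continuous_iteratedFDeriv (smooth_le _))

theorem norm_pderiv_le {n : ℕ} (α : Fin n → ℕ) (f : Rn n → ℂ) (x : Rn n) :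
    ‖pderiv α f x‖ ≤ ‖iteratedFDeriv ℝ (derivWord α).length f x‖ := by
  refine (ContinuousMultilinearMap.le_opNorm _ _).trans ?_
  simp

/-! ## The spaces of functions -/

/-- The vector space `𝒟_{L^p}(ℝⁿ)`: the smooth functions all of whose derivatives are in `L^p`. -/
def dLpSubmodule (n : ℕ) (p : ℝ≥0∞) : Submodule ℂ (Rn n → ℂ) where
  carrier := {f | ContDiff ℝ (⊤ : ℕ∞) f ∧ ∀ α, MemLp (pderiv α f) p volume}
  zero_mem' := ⟨contDiff_zero_fun, fun α => by rw [pderiv_zero]; exact MemLp.zero⟩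
  add_mem' := fun {f g} hf hg =>
    ⟨hf.1.add hg.1, fun α => by rw [pderiv_add α hf.1 hg.1]; exact (hf.2 α).add (hg.2 α)⟩
  smul_mem' := fun c f hf =>
    ⟨contDiff_const.smul hf.1, fun α => by
      rw [pderiv_smul α c hf.1]; exact (hf.2 α).const_smul c⟩

/-- The space `𝒟_{L^p}(ℝⁿ)`; its topology is given below. -/
def DL (n : ℕ) (p : ℝ≥0∞) : Type := dLpSubmodule n p

namespace DL

variable {n : ℕ} {p : ℝ≥0∞}

instance : AddCommGroup (DL n p) := inferInstanceAs (AddCommGroup (dLpSubmodule n p))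

instance : Module ℂ (DL n p) := inferInstanceAs (Module ℂ (dLpSubmodule n p))

instance : FunLike (DL n p) (Rn n) ℂ where
  coe f := f.1
  coe_injective _ _ h := Subtype.ext h

theorem contDiff (f : DL n p) : ContDiff ℝ (⊤ : ℕ∞) f := f.2.1

theorem memLp (f : DL n p) (α : Fin n → ℕ) : MemLp (pderiv α f) p volume := f.2.2 α

theorem coe_add (f g : DL n p) : ⇑(f + g) = ⇑f + ⇑g := rfl

theorem coe_smul (c : ℂ) (f : DL n p) : ⇑(c • f) = c • ⇑f := rfl

theorem coe_zero : ⇑(0 : DL n p) = 0 := rfl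

variable [Fact (1 ≤ p)]

/-- The seminorm `f ↦ ‖∂^α f‖_p`. -/
def seminormDeriv (n : ℕ) (p : ℝ≥0∞) [Fact (1 ≤ p)] (α : Fin n → ℕ) : Seminorm ℂ (DL n p) :=
  Seminorm.of (fun f => (eLpNorm (pderiv α f) p volume).toReal)
    (fun f g => by
      rw [coe_add, pderiv_add α f.contDiff g.contDiff,
        ← ENNReal.toReal_add (f.memLp α).eLpNorm_ne_top (g.memLp α).eLpNorm_ne_top]
      exact ENNReal.toReal_mono
        (ENNReal.add_ne_top.2 ⟨(f.memLp α).eLpNorm_ne_top, (g.memLp α).eLpNorm_ne_top⟩)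
        (eLpNorm_add_le (f.memLp α).1 (g.memLp α).1 Fact.out))
    (fun c f => by
      rw [coe_smul, pderiv_smul α c f.contDiff, eLpNorm_const_smul, ENNReal.toReal_mul]
      simp)

/-- The defining seminorms `p_m(f) = sup_{|α| ≤ m} ‖∂^α f‖_p` of `𝒟_{L^p}`. -/
def seminorms (n : ℕ) (p : ℝ≥0∞) [Fact (1 ≤ p)] : SeminormFamily ℂ (DL n p) ℕ :=
  fun m => (multiIdx n m).sup (seminormDeriv n p)

instance : TopologicalSpace (DL n p) := (seminorms n p).moduleFilterBasis.topology

theorem withSeminorms (n : ℕ) (p : ℝ≥0∞) [Fact (1 ≤ p)] : WithSeminorms (seminorms n p) := ⟨rfl⟩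

instance : IsTopologicalAddGroup (DL n p) := (withSeminorms n p).topologicalAddGroup

instance : ContinuousSMul ℂ (DL n p) := (withSeminorms n p).continuousSMul

end DL

/-- The space `ℬ̇(ℝⁿ)` of the smooth functions all of whose derivatives tend to `0` at infinity,
with the subspace topology of `𝒟_{L^∞}(ℝⁿ)`. -/
def BDot (n : ℕ) : Submodule ℂ (DL n ⊤) where
  carrier := {f | ∀ α, Filter.Tendsto (pderiv α f) (Filter.cocompact (Rn n)) (nhds 0)}
  zero_mem' := fun α => by
    rw [DL.coe_zero, pderiv_zero]; exact tendsto_const_nhds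
  add_mem' := fun {f g} hf hg α => by
    rw [DL.coe_add, pderiv_add α f.contDiff g.contDiff]
    have h := (hf α).add (hg α)
    rw [add_zero] at h
    exact h
  smul_mem' := fun c f hf α => by
    rw [DL.coe_smul, pderiv_smul α c f.contDiff]
    have h := (hf α).const_smul c
    rw [smul_zero] at h
    exact h

/-- The vector space `ℰ(ℝⁿ) = C^∞(ℝⁿ)`. -/
def smoothSubmodule (n : ℕ) : Submodule ℂ (Rn n → ℂ) where
  carrier := {f | ContDiff ℝ (⊤ : ℕ∞) f}
  zero_mem' := (contDiff_zero_fun : ContDiff ℝ (⊤ : ℕ∞) (0 : Rn n → ℂ))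
  add_mem' := fun {f g} (hf : ContDiff ℝ (⊤ : ℕ∞) f) (hg : ContDiff ℝ (⊤ : ℕ∞) g) => hf.add hg
  smul_mem' := fun c f (hf : ContDiff ℝ (⊤ : ℕ∞) f) => (contDiff_const.smul hf : ContDiff ℝ (⊤ : ℕ∞) (c • f))

/-- The space `ℰ(ℝⁿ) = C^∞(ℝⁿ)`; its topology is given below. -/
def SmoothFn (n : ℕ) : Type := smoothSubmodule n

namespace SmoothFn

variable {n : ℕ}

instance : AddCommGroup (SmoothFn n) := inferInstanceAs (AddCommGroup (smoothSubmodule n))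

instance : Module ℂ (SmoothFn n) := inferInstanceAs (Module ℂ (smoothSubmodule n))

instance : FunLike (SmoothFn n) (Rn n) ℂ where
  coe f := f.1
  coe_injective _ _ h := Subtype.ext h

theorem contDiff (f : SmoothFn n) : ContDiff ℝ (⊤ : ℕ∞) f := f.2

theorem coe_add (f g : SmoothFn n) : ⇑(f + g) = ⇑f + ⇑g := rfl

theorem coe_smul (c : ℂ) (f : SmoothFn n) : ⇑(c • f) = c • ⇑f := rfl

/-- The restriction of `∂^α f` to a compact set `K`. -/
def restrictDeriv (K : Compacts (Rn n)) (α : Fin n → ℕ) : SmoothFn n →ₗ[ℂ] C(K, ℂ) where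
  toFun f := ⟨fun x => pderiv α f x, (continuous_pderiv α f.contDiff).comp continuous_subtype_val⟩
  map_add' f g := by
    ext x
    simp [coe_add, pderiv_add α f.contDiff g.contDiff]
  map_smul' c f := by
    ext x
    simp [coe_smul, pderiv_smul α c f.contDiff]

/-- The defining seminorms `p_{m,K}(f) = sup_{x ∈ K, |α| ≤ m} |∂^α f(x)|` of `ℰ`. -/
def seminorms (n : ℕ) : SeminormFamily ℂ (SmoothFn n) (ℕ × Compacts (Rn n)) :=
  fun mK => (multiIdx n mK.1).sup fun α => (normSeminorm ℂ C(mK.2, ℂ)).comp (restrictDeriv mK.2 α)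

instance : TopologicalSpace (SmoothFn n) := (seminorms n).moduleFilterBasis.topology

theorem withSeminorms (n : ℕ) : WithSeminorms (seminorms n) := ⟨rfl⟩

instance : IsTopologicalAddGroup (SmoothFn n) := (withSeminorms n).topologicalAddGroup

instance : ContinuousSMul ℂ (SmoothFn n) := (withSeminorms n).continuousSMul

end SmoothFn

/-! ## The inclusions of the test functions -/

/-- The real-valued test functions on `ℝⁿ`. -/
abbrev Test (n : ℕ) : Type := 𝓓((⊤ : Opens (Rn n)), ℝ)

/-- The complex-valued distributions on `ℝⁿ`. -/
abbrev Distr (n : ℕ) : Type := 𝓓'((⊤ : Opens (Rn n)), ℂ)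

/-- A real-valued function, regarded as a complex-valued one. -/
def toC {n : ℕ} (φ : Rn n → ℝ) (x : Rn n) : ℂ := (φ x : ℂ)

theorem contDiff_toC {n : ℕ} {φ : Rn n → ℝ} (hφ : ContDiff ℝ (⊤ : ℕ∞) φ) : ContDiff ℝ (⊤ : ℕ∞) (toC φ) :=
  Complex.ofRealCLM.contDiff.comp hφ

theorem norm_pderiv_toC_le {n : ℕ} (α : Fin n → ℕ) {φ : Rn n → ℝ} (hφ : ContDiff ℝ (⊤ : ℕ∞) φ)
    (x : Rn n) : ‖pderiv α (toC φ) x‖ ≤ ‖iteratedFDeriv ℝ (derivWord α).length φ x‖ := by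
  refine (norm_pderiv_le α _ x).trans (le_of_eq ?_)
  exact Complex.ofRealLI.norm_iteratedFDeriv_comp_left
    (hφ.of_le (smooth_le _)).contDiffAt le_rfl

theorem hasCompactSupport_pderiv_toC {n : ℕ} (α : Fin n → ℕ) {φ : Rn n → ℝ}
    (hφ : ContDiff ℝ (⊤ : ℕ∞) φ) (hc : HasCompactSupport φ) :
    HasCompactSupport (pderiv α (toC φ)) := by
  refine (hc.iteratedFDeriv (𝕜 := ℝ) (derivWord α).length).mono fun x hx => ?_
  simp only [Function.mem_support, ne_eq] at hx ⊢
  intro h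
  apply hx
  have := norm_pderiv_toC_le α hφ x
  rw [h, norm_zero] at this
  exact norm_le_zero_iff.1 this

theorem toC_mem {n : ℕ} (p : ℝ≥0∞) (φ : Test n) : toC φ ∈ dLpSubmodule n p :=
  ⟨contDiff_toC φ.contDiff, fun α =>
    (continuous_pderiv α (contDiff_toC φ.contDiff)).memLp_of_hasCompactSupport
      (hasCompactSupport_pderiv_toC α φ.contDiff φ.hasCompactSupport)⟩

/-- A linear map into a space whose topology is given by finite suprema of seminorms `q` is
continuous at `0`, hence continuous, if each of the seminorms `q` tends to `0` along it. -/
theorem continuous_of_seminorms {X V ι κ : Type*} [TopologicalSpace X] [AddCommGroup X]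
    [IsTopologicalAddGroup X] [AddCommGroup V] [Module ℂ V] [TopologicalSpace V]
    (q : κ → Seminorm ℂ V) (s : ι → Finset κ) (hV : WithSeminorms fun i => (s i).sup q)
    (f : X →+ V) (h : ∀ i, ∀ k ∈ s i, Filter.Tendsto (fun x => q k (f x)) (nhds 0) (nhds 0)) :
    Continuous f := by
  have := hV.topologicalAddGroup
  refine continuous_of_continuousAt_zero f ?_
  rw [ContinuousAt, map_zero, hV.tendsto_nhds]
  intro i ε hε
  have : ∀ᶠ x in nhds (0 : X), ∀ k ∈ s i, q k (f x) < ε :=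
    (s i).eventually_all.2 fun k hk => (h i k hk).eventually (gt_mem_nhds hε)
  filter_upwards [this] with x hx
  rw [sub_zero]
  exact Seminorm.finset_sup_apply_lt hε hx

theorem tendsto_seminorm_zero {n : ℕ} (K : Compacts (Rn n)) (k : ℕ) :
    Filter.Tendsto (fun φ : 𝓓_{K}(Rn n, ℝ) => ContDiffMapSupportedIn.seminorm ℝ (Rn n) ℝ ⊤ K k φ)
      (nhds 0) (nhds 0) := by
  have := ((ContDiffMapSupportedIn.withSeminorms ℝ (Rn n) ℝ ⊤ K).continuous_seminorm k).tendsto 0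
  rwa [map_zero] at this

theorem norm_pderiv_supported_le {n : ℕ} (α : Fin n → ℕ) {K : Compacts (Rn n)}
    (φ : 𝓓_{K}(Rn n, ℝ)) (x : Rn n) :
    ‖pderiv α (toC φ) x‖ ≤
      ContDiffMapSupportedIn.seminorm ℝ (Rn n) ℝ ⊤ K (derivWord α).length φ :=
  (norm_pderiv_toC_le α φ.contDiff x).trans
    (ContDiffMapSupportedIn.norm_iteratedFDeriv_apply_le_seminorm_top ℝ)

theorem pderiv_supported_eq_zero {n : ℕ} (α : Fin n → ℕ) {K : Compacts (Rn n)}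
    (φ : 𝓓_{K}(Rn n, ℝ)) {x : Rn n} (hx : x ∉ K) : pderiv α (toC φ) x = 0 := by
  have := norm_pderiv_toC_le α φ.contDiff x
  rw [φ.iteratedFDeriv_zero_on_compl hx] at this
  simpa using this

theorem eLpNorm_pderiv_supported_le {n : ℕ} (p : ℝ≥0∞) (α : Fin n → ℕ) {K : Compacts (Rn n)}
    (φ : 𝓓_{K}(Rn n, ℝ)) :
    (eLpNorm (pderiv α (toC φ)) p volume).toReal ≤
      (volume (K : Set (Rn n)) ^ p.toReal⁻¹).toReal *
        ContDiffMapSupportedIn.seminorm ℝ (Rn n) ℝ ⊤ K (derivWord α).length φ := by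
  have hK : volume (K : Set (Rn n)) ^ p.toReal⁻¹ ≠ ⊤ :=
    ENNReal.rpow_ne_top_of_nonneg (by positivity) K.isCompact.measure_lt_top.ne
  have h : eLpNorm (pderiv α (toC φ)) p volume ≤
      volume (K : Set (Rn n)) ^ p.toReal⁻¹ * ENNReal.ofReal
        (ContDiffMapSupportedIn.seminorm ℝ (Rn n) ℝ ⊤ K (derivWord α).length φ) := by
    have e : (K : Set (Rn n)).indicator (pderiv α (toC φ)) = pderiv α (toC φ) := by
      refine Set.indicator_eq_self.2 fun x hx => ?_
      by_contra hxK
      exact hx (pderiv_supported_eq_zero α φ hxK)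
    rw [← e, eLpNorm_indicator_eq_eLpNorm_restrict K.isCompact.measurableSet]
    refine (eLpNorm_le_of_ae_bound
      (Filter.Eventually.of_forall (norm_pderiv_supported_le α φ))).trans ?_
    rw [Measure.restrict_apply_univ]
  refine (ENNReal.toReal_mono (ENNReal.mul_ne_top hK ENNReal.ofReal_ne_top) h).trans ?_
  rw [ENNReal.toReal_mul, ENNReal.toReal_ofReal (apply_nonneg _ _)]

instance {n : ℕ} {p : ℝ≥0∞} [Fact (1 ≤ p)] : ContinuousSMul ℝ (DL n p) :=
  IsScalarTower.continuousSMul ℂ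

instance {n : ℕ} : ContinuousSMul ℝ (SmoothFn n) := IsScalarTower.continuousSMul ℂ

instance {n : ℕ} {p : ℝ≥0∞} [Fact (1 ≤ p)] : LocallyConvexSpace ℝ (DL n p) :=
  (DL.withSeminorms n p).toLocallyConvexSpace

instance {n : ℕ} : LocallyConvexSpace ℝ (SmoothFn n) :=
  (SmoothFn.withSeminorms n).toLocallyConvexSpace

/-- The continuous inclusion of the test functions into `𝒟_{L^p}`. -/
def testToDL (n : ℕ) (p : ℝ≥0∞) [Fact (1 ≤ p)] : Test n →L[ℝ] DL n p :=
  TestFunction.mkCLM ℝ (fun φ => (⟨toC φ, toC_mem p φ⟩ : dLpSubmodule n p))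
    (fun _ _ => Subtype.ext (funext fun _ => Complex.ofReal_add _ _))
    (fun _ _ => Subtype.ext (funext fun _ => Complex.ofReal_mul _ _))
    (fun K hK => continuous_of_seminorms (X := 𝓓_{K}(Rn n, ℝ)) (V := DL n p)
      (DL.seminormDeriv n p) (multiIdx n) (DL.withSeminorms n p)
      { toFun := fun φ =>
          (⟨toC φ, toC_mem p (TestFunction.ofSupportedIn hK φ)⟩ : dLpSubmodule n p)
        map_zero' := Subtype.ext (funext fun _ => Complex.ofReal_zero)
        map_add' := fun _ _ => Subtype.ext (funext fun _ => Complex.ofReal_add _ _) }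
      (fun _ α _ => squeeze_zero (fun _ => apply_nonneg _ _)
        (fun φ => eLpNorm_pderiv_supported_le p α φ)
        (by simpa using (tendsto_seminorm_zero K (derivWord α).length).const_mul
              (volume (K : Set (Rn n)) ^ p.toReal⁻¹).toReal)))

/-- The continuous inclusion of the test functions into `ℬ̇`. -/
def testToBDot (n : ℕ) : Test n →L[ℝ] BDot n where
  toFun φ := ⟨testToDL n ⊤ φ, fun α =>
    show Filter.Tendsto (pderiv α (toC φ)) _ _ from
      (hasCompactSupport_pderiv_toC α φ.contDiff φ.hasCompactSupport).is_zero_at_infty⟩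
  map_add' φ ψ := Subtype.ext (map_add (testToDL n ⊤) φ ψ)
  map_smul' c φ := Subtype.ext (map_smul (testToDL n ⊤) c φ)
  cont := (testToDL n ⊤).continuous.subtype_mk _

/-- The continuous inclusion of the test functions into `ℰ`. -/
def testToSmooth (n : ℕ) : Test n →L[ℝ] SmoothFn n :=
  TestFunction.mkCLM ℝ (fun φ => (⟨toC φ, contDiff_toC φ.contDiff⟩ : smoothSubmodule n))
    (fun _ _ => Subtype.ext (funext fun _ => Complex.ofReal_add _ _))
    (fun _ _ => Subtype.ext (funext fun _ => Complex.ofReal_mul _ _))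
    (fun K _ => continuous_of_seminorms (X := 𝓓_{K}(Rn n, ℝ)) (V := SmoothFn n)
      (fun Lα : Compacts (Rn n) × (Fin n → ℕ) =>
        (normSeminorm ℂ C(Lα.1, ℂ)).comp (SmoothFn.restrictDeriv Lα.1 Lα.2))
      (fun mL : ℕ × Compacts (Rn n) =>
        (multiIdx n mL.1).map ⟨Prod.mk mL.2, Prod.mk_right_injective _⟩)
      (by
        simp only [Finset.sup_map]
        exact SmoothFn.withSeminorms n)
      { toFun := fun φ => (⟨toC φ, contDiff_toC φ.contDiff⟩ : smoothSubmodule n)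
        map_zero' := Subtype.ext (funext fun _ => Complex.ofReal_zero)
        map_add' := fun _ _ => Subtype.ext (funext fun _ => Complex.ofReal_add _ _) }
      (fun _ Lα _ => squeeze_zero (fun _ => apply_nonneg _ _)
        (fun φ => (ContinuousMap.norm_le _ (apply_nonneg _ _)).2 fun x =>
          norm_pderiv_supported_le Lα.2 φ x)
        (tendsto_seminorm_zero K (derivWord Lα.2).length)))

/-! ## The spaces of distributions -/

/-- The functional `T` on the function space `V` is `∑_{|α| ≤ m} ∂^α f_α` for some `m` and some
`f_α ∈ L^q`, i.e. `⟨g, T⟩ = ∑_{|α| ≤ m} (-1)^|α| ∫ ∂^α g(x) f_α(x) dx` for all `g ∈ V`. -/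
def IsSumOfDerivs {n : ℕ} {V : Type} (coe : V → Rn n → ℂ) (q : ℝ≥0∞) (T : V → ℂ) : Prop :=
  ∃ (m : ℕ) (f : (Fin n → ℕ) → Rn n → ℂ), (∀ α, MemLp (f α) q volume) ∧
    ∀ g : V, T g = ∑ α ∈ multiIdx n m, (-1) ^ (∑ i, α i) * ∫ x, pderiv α (coe g) x * f α x

theorem IsSumOfDerivs.zero {n : ℕ} {V : Type} (coe : V → Rn n → ℂ) (q : ℝ≥0∞) :
    IsSumOfDerivs coe q fun _ => 0 :=
  ⟨0, fun _ _ => 0, fun _ => MemLp.zero', fun g => by simp⟩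

theorem IsSumOfDerivs.const_mul {n : ℕ} {V : Type} {coe : V → Rn n → ℂ} {q : ℝ≥0∞} {T : V → ℂ}
    (h : IsSumOfDerivs coe q T) (c : ℂ) : IsSumOfDerivs coe q fun g => c * T g := by
  obtain ⟨m, f, hf, h⟩ := h
  refine ⟨m, fun α x => c * f α x, fun α => (hf α).const_mul c, fun g => ?_⟩
  change c * T g = _
  rw [h, Finset.mul_sum]
  refine Finset.sum_congr rfl fun α _ => ?_
  rw [mul_left_comm, ← integral_const_mul]
  simp only [mul_left_comm]

/-- A sum of derivatives of order at most `m` is one of order at most `m'` if `m ≤ m'`. -/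
theorem sum_multiIdx_extend {n m m' : ℕ} (hm : m ≤ m') (g : Rn n → ℂ)
    (f : (Fin n → ℕ) → Rn n → ℂ) :
    ∑ α ∈ multiIdx n m, (-1) ^ (∑ i, α i) * ∫ x, pderiv α g x * f α x =
      ∑ α ∈ multiIdx n m', (-1) ^ (∑ i, α i) *
        ∫ x, pderiv α g x * (if α ∈ multiIdx n m then f α x else 0) := by
  have hsub : multiIdx n m ⊆ multiIdx n m' := fun α hα =>
    mem_multiIdx.2 ((mem_multiIdx.1 hα).trans hm)
  rw [← Finset.sum_subset hsub]
  · refine Finset.sum_congr rfl fun α hα => ?_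
    simp only [hα, if_true]
  · intro α _ hα
    simp [hα]

theorem IsSumOfDerivs.add {n : ℕ} {V : Type} {coe : V → Rn n → ℂ} {p q : ℝ≥0∞}
    [p.HolderConjugate q] (hV : ∀ g α, MemLp (pderiv α (coe g)) p volume) {S T : V → ℂ}
    (hS : IsSumOfDerivs coe q S) (hT : IsSumOfDerivs coe q T) :
    IsSumOfDerivs coe q fun g => S g + T g := by
  obtain ⟨m₁, f₁, hf₁, h₁⟩ := hS
  obtain ⟨m₂, f₂, hf₂, h₂⟩ := hT
  have hf₁' : ∀ α, MemLp (fun x => if α ∈ multiIdx n m₁ then f₁ α x else 0) q volume := by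
    intro α
    by_cases hα : α ∈ multiIdx n m₁
    · simpa only [hα, if_true] using hf₁ α
    · simp only [hα, if_false]
      exact MemLp.zero'
  have hf₂' : ∀ α, MemLp (fun x => if α ∈ multiIdx n m₂ then f₂ α x else 0) q volume := by
    intro α
    by_cases hα : α ∈ multiIdx n m₂
    · simpa only [hα, if_true] using hf₂ α
    · simp only [hα, if_false]
      exact MemLp.zero'
  refine ⟨max m₁ m₂, fun α x => (if α ∈ multiIdx n m₁ then f₁ α x else 0) +
    (if α ∈ multiIdx n m₂ then f₂ α x else 0), fun α => (hf₁' α).add (hf₂' α), fun g => ?_⟩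
  change S g + T g = _
  rw [h₁, h₂, sum_multiIdx_extend (le_max_left m₁ m₂), sum_multiIdx_extend (le_max_right m₁ m₂),
    ← Finset.sum_add_distrib]
  refine Finset.sum_congr rfl fun α _ => ?_
  simp only [mul_add (pderiv α (coe g) _)]
  rw [← mul_add]
  exact congrArg _ (integral_add ((hV g α).integrable_mul (hf₁' α))
    ((hV g α).integrable_mul (hf₂' α))).symm

instance {q : ℝ≥0∞} : Fact (1 ≤ q.conjExponent) := ⟨le_self_add⟩

/-- The space `𝒟'_{L^q}(ℝⁿ)` for `1 < q ≤ ∞`: the distributions that are finite sums of derivatives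
of functions in `L^q`, as functionals on `𝒟_{L^p}(ℝⁿ)`, where `1/p + 1/q = 1`. The topology is that
of the strong dual: uniform convergence on the bounded subsets of `𝒟_{L^p}(ℝⁿ)`. -/
def DPrimeL (n : ℕ) (q : ℝ≥0∞) [Fact (1 ≤ q)] :
    Submodule ℂ (StrongDual ℂ (DL n q.conjExponent)) where
  carrier := {T | IsSumOfDerivs (fun g : DL n q.conjExponent => ⇑g) q T}
  zero_mem' := IsSumOfDerivs.zero _ q
  add_mem' := fun hS hT =>
    have : q.conjExponent.HolderConjugate q := ENNReal.HolderConjugate.symm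
    IsSumOfDerivs.add (p := q.conjExponent) (fun g => DL.memLp g) hS hT
  smul_mem' := fun c _ hT => IsSumOfDerivs.const_mul hT c

/-- The space `𝒟'_{L^1}(ℝⁿ)`: the distributions that are finite sums of derivatives of functions in
`L^1`, as functionals on `ℬ̇(ℝⁿ)`. The topology is that of the strong dual: uniform convergence
on the bounded subsets of `ℬ̇(ℝⁿ)`. -/
def DPrimeLOne (n : ℕ) : Submodule ℂ (StrongDual ℂ (BDot n)) where
  carrier := {T | IsSumOfDerivs (fun g : BDot n => ⇑(g : DL n ⊤)) 1 T}
  zero_mem' := IsSumOfDerivs.zero _ 1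
  add_mem' := fun hS hT =>
    IsSumOfDerivs.add (coe := fun g : BDot n => ⇑(g : DL n ⊤)) (p := ⊤)
      (fun g => DL.memLp (g : DL n ⊤)) hS hT
  smul_mem' := fun c _ hT => IsSumOfDerivs.const_mul hT c

/-- The space `ℰ'(ℝⁿ)` of the distributions with compact support: the strong dual of `ℰ(ℝⁿ)`, with
the topology of uniform convergence on the bounded subsets of `ℰ(ℝⁿ)`. -/
abbrev EPrime (n : ℕ) : Type := StrongDual ℂ (SmoothFn n)

/-- The distribution that a continuous functional on a function space `V` restricts to, where
`j : 𝒟 → V` is the inclusion of the test functions. -/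
def restrictToTest {n : ℕ} {V : Type} [AddCommGroup V] [Module ℂ V] [TopologicalSpace V]
    (j : Test n →L[ℝ] V) (T : StrongDual ℂ V) : Distr n :=
  UniformConvergenceCLM.ofFun _ ℂ _ ((T.restrictScalars ℝ).comp j)

/-- An element of `𝒟'_{L^q}`, `1 < q ≤ ∞`, as a distribution. -/
def DPrimeL.toDistr {n : ℕ} {q : ℝ≥0∞} [Fact (1 ≤ q)] (T : DPrimeL n q) : Distr n :=
  restrictToTest (testToDL n q.conjExponent) T

/-- An element of `𝒟'_{L^1}` as a distribution. -/
def DPrimeLOne.toDistr {n : ℕ} (T : DPrimeLOne n) : Distr n := restrictToTest (testToBDot n) T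

/-- An element of `ℰ'` as a distribution. -/
def EPrime.toDistr {n : ℕ} (T : EPrime n) : Distr n := restrictToTest (testToSmooth n) T

/-! ## Convolution of distributions -/

/-- The test function `x ↦ φ(y - x)`. -/
def reflect {n : ℕ} (φ : Test n) (y : Rn n) : Test n where
  toFun x := φ (y - x)
  contDiff' := φ.contDiff.comp (contDiff_const.sub contDiff_id)
  hasCompactSupport' := φ.hasCompactSupport.comp_homeomorph (Homeomorph.subLeft y)
  tsupport_subset' := fun _ _ => trivial

/-- The convolution of two test functions, `x ↦ ∫ φ(t) ψ(x - t) dt`. -/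
def testConv {n : ℕ} (φ ψ : Test n) : Test n where
  toFun := φ ⋆[ContinuousLinearMap.mul ℝ ℝ, volume] ψ
  contDiff' := ψ.hasCompactSupport.contDiff_convolution_right _
    φ.continuous.locallyIntegrable ψ.contDiff
  hasCompactSupport' := φ.hasCompactSupport.convolution _ ψ.hasCompactSupport
  tsupport_subset' := fun _ _ => trivial

/-- The regularization `T ∗ φ` of a distribution: `(T ∗ φ)(y) = ⟨φ(y - ·), T⟩`. -/
def regularize {n : ℕ} (T : Distr n) (φ : Test n) (y : Rn n) : ℂ := T (reflect φ y)

/-- The distributions `S` and `T` are convolvable, and `U` is their convolution `S ∗ T`: for all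
test functions `φ` and `ψ` the function `y ↦ (S ∗ φ)(y) (T ∗ ψ)(-y)` is integrable, and its integral
is `((S ∗ T) ∗ (φ ∗ ψ))(0)`. This determines `U`, the functions `φ ∗ ψ` being total in `𝒟`. -/
def IsConvolution {n : ℕ} (S T U : Distr n) : Prop :=
  ∀ φ ψ : Test n,
    Integrable (fun y => regularize S φ y * regularize T ψ (-y)) volume ∧
      regularize U (testConv φ ψ) 0 = ∫ y, regularize S φ y * regularize T ψ (-y)

/-! ## Topological algebras -/

/-- The vector space `A` with its topology and the bilinear multiplication `m` is a topological
algebra: an (associative) algebra all of whose operations are jointly continuous. -/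
structure IsTopologicalAlgebra {A : Type} [AddCommGroup A] [Module ℂ A] [TopologicalSpace A]
    (m : A →ₗ[ℂ] A →ₗ[ℂ] A) : Prop where
  assoc : ∀ a b c : A, m (m a b) c = m a (m b c)
  continuous_add_neg : IsTopologicalAddGroup A
  continuous_smul : ContinuousSMul ℂ A
  continuous_mul : Continuous fun z : A × A => m z.1 z.2

end

end DistSpaces

open DistSpaces

/-! For the multiplications, Leibniz' rule bounds the m-th seminorm of a product by a constant times
the product of the m-th seminorms of the factors. By bilinearity it is enough to have continuity at
the origin, which this bound gives.

For the convolutions, T in the second factor is turned into the operator g ↦ (y ↦ ⟨g(· + y), T⟩) on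
the predual of the first factor, called `transfer` below, and S ∗ T is the functional S composed
with this operator. Write S = ∑ ∂^α f_α and T = ∑ ∂^β k_β with f_α in L^q and k_β integrable. The
operator is then a finite combination of correlations of the k_β with derivatives of g. By Young's
inequality it preserves 𝒟_{L^p}, and by dominated convergence it preserves ℬ̇. Transposing the
correlations gives S ∗ T = ∑ ∂^{α+β}(f_α ∗ k_β) (`rep_repCorr`), which again has the required form.
The identity defining convolution follows from Fubini's theorem and integration by parts
(`isConvolution_of_rep`). If q > 1, then p < ∞ and a local Sobolev inequality gives 𝒟_{L^p} ⊂ ℬ̇, so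
T can be applied to translates of g. For ℰ' the representation is a structure theorem: Sobolev's
inequality dominates T by a Hilbert norm on finitely many derivatives over a ball, and Riesz'
theorem supplies the functions (`EPrime.exists_rep`).

Joint continuity does not follow from bounds for fixed S and T. For a bounded set B in the predual
one needs bounded sets B₁ and B₂ such that S in the polar of B₁ and T in the polar of B₂ force S ∗ T
into the polar of B (`continuous_bilin_of_polars`). The predual has an increasing sequence of
seminorms, so there are c_j > 0 for which all the c_j⁻¹ ∂^α g with g in B and |α| = j lie in one
bounded set (`exists_scaling`). Let B₂ consist of the translates of these functions and B₁ of the h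
with |∂^α h| ≤ c_{|α|}. Derivatives commute with the transfer, so T in the polar of B₂ gives |∂^α
(transfer g)(y)| = |⟨∂^α g(· + y), T⟩| ≤ c_{|α|}; hence the transfer of g lies in B₁ and S is at
most 1 on it. For p < ∞ the L^p norm is computed by duality, and translates are replaced by averages
against the unit ball of L^q (`eLpNorm_le_of_forall_integral`). For ℰ one index j controls both the
order and the radius of a ball. -/

namespace DistSpaces

/-! ### Calculus of partial derivatives: words, multi-indices and Leibniz' rule. -/

section Calculus

variable {n : ℕ}

/-- The partial derivative in the direction of the `i`-th coordinate. -/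
noncomputable def pd (i : Fin n) (f : Rn n → ℂ) (x : Rn n) : ℂ :=
  fderiv ℝ f x (EuclideanSpace.single i 1)

theorem contDiff_pd (i : Fin n) {f : Rn n → ℂ} (hf : ContDiff ℝ (⊤ : ℕ∞) f) :
    ContDiff ℝ (⊤ : ℕ∞) (pd i f) :=
  (hf.fderiv_right (m := (⊤ : ℕ∞)) (by simp)).clm_apply contDiff_const

theorem differentiable_of_smooth {f : Rn n → ℂ} (hf : ContDiff ℝ (⊤ : ℕ∞) f) :
    Differentiable ℝ f := hf.differentiable (by simp)

theorem pd_comm (i j : Fin n) {f : Rn n → ℂ} (hf : ContDiff ℝ (⊤ : ℕ∞) f) :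
    pd i (pd j f) = pd j (pd i f) := by
  funext x
  have hd : DifferentiableAt ℝ (fderiv ℝ f) x :=
    (hf.fderiv_right (m := (⊤ : ℕ∞)) (by simp)).differentiable (by simp) x
  have key : ∀ v w : Rn n, fderiv ℝ (fun y => fderiv ℝ f y w) x v =
      fderiv ℝ (fderiv ℝ f) x v w := by
    intro v w
    rw [fderiv_clm_apply hd (differentiableAt_const w)]
    simp
  have hs : IsSymmSndFDerivAt ℝ f x :=
    hf.contDiffAt.isSymmSndFDerivAt (by
      simp only [minSmoothness_of_isRCLikeNormedField]; exact_mod_cast smooth_le 2)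
  change fderiv ℝ (fun y => fderiv ℝ f y _) x _ = fderiv ℝ (fun y => fderiv ℝ f y _) x _
  rw [key, key]
  exact hs.eq _ _

/-- The iterated partial derivative along a word in the coordinates. -/
noncomputable def wordDeriv (w : List (Fin n)) (f : Rn n → ℂ) : Rn n → ℂ := w.foldr pd f

theorem contDiff_wordDeriv (w : List (Fin n)) {f : Rn n → ℂ} (hf : ContDiff ℝ (⊤ : ℕ∞) f) :
    ContDiff ℝ (⊤ : ℕ∞) (wordDeriv w f) := by
  induction w with
  | nil => exact hf
  | cons i w ih => exact contDiff_pd i ih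

/-- Peeling off the first argument of the iterated derivative makes the head of the word the
outermost differentiation. This lets the multilinear definition of `pderiv` be handled recursively.
-/
theorem iteratedFDeriv_word (w : List (Fin n)) {f : Rn n → ℂ} (hf : ContDiff ℝ (⊤ : ℕ∞) f)
    (x : Rn n) :
    (iteratedFDeriv ℝ w.length f x fun j => EuclideanSpace.single (w.get j) (1 : ℝ)) =
      wordDeriv w f x := by
  induction w generalizing x with
  | nil => rfl
  | cons i w ih =>
    change (iteratedFDeriv ℝ (w.length + 1) f x fun j => EuclideanSpace.single ((i :: w).get j) 1)
      = fderiv ℝ (wordDeriv w f) x _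
    have hd : DifferentiableAt ℝ (iteratedFDeriv ℝ w.length f) x :=
      (hf.differentiable_iteratedFDeriv (m := w.length)
        (by exact_mod_cast ENat.natCast_lt_top _)) x
    rw [hd.iteratedFDeriv_succ_apply_left', ← funext fun y => ih y]
    rfl

/-- A transposition of neighbours is the symmetry of second derivatives. So only letter counts
matter, and identities such as ∂^{α+β} = ∂^α ∂^β reduce to counting. -/
theorem wordDeriv_perm {w w' : List (Fin n)} (h : w.Perm w') {f : Rn n → ℂ}
    (hf : ContDiff ℝ (⊤ : ℕ∞) f) : wordDeriv w f = wordDeriv w' f := by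
  induction h with
  | nil => rfl
  | cons i _ ih => exact congrArg (pd i) ih
  | swap i j w => exact pd_comm _ _ (contDiff_wordDeriv w hf)
  | trans _ _ h₁ h₂ => exact h₁.trans h₂

theorem wordDeriv_append (w w' : List (Fin n)) (f : Rn n → ℂ) :
    wordDeriv (w ++ w') f = wordDeriv w (wordDeriv w' f) := by
  simp [wordDeriv, List.foldr_append]

theorem count_derivWord (α : Fin n → ℕ) (i : Fin n) : (derivWord α).count i = α i := by
  rw [derivWord, List.count_flatMap]
  have : (List.count i ∘ fun j => List.replicate (α j) j) = fun j => if j = i then α j else 0 := by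
    funext j
    simp [List.count_replicate]
  rw [this, ← List.ofFn_eq_map, List.sum_ofFn]
  simp

theorem pderiv_eq_wordDeriv (α : Fin n → ℕ) {f : Rn n → ℂ} (hf : ContDiff ℝ (⊤ : ℕ∞) f) :
    pderiv α f = wordDeriv (derivWord α) f :=
  funext fun x => iteratedFDeriv_word _ hf x

theorem contDiff_pderiv (α : Fin n → ℕ) {f : Rn n → ℂ} (hf : ContDiff ℝ (⊤ : ℕ∞) f) :
    ContDiff ℝ (⊤ : ℕ∞) (pderiv α f) := by
  rw [pderiv_eq_wordDeriv α hf]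
  exact contDiff_wordDeriv _ hf

theorem pderiv_add_index (α β : Fin n → ℕ) {f : Rn n → ℂ} (hf : ContDiff ℝ (⊤ : ℕ∞) f) :
    pderiv (α + β) f = pderiv α (pderiv β f) := by
  rw [pderiv_eq_wordDeriv _ hf, pderiv_eq_wordDeriv α (contDiff_pderiv β hf),
    pderiv_eq_wordDeriv β hf, ← wordDeriv_append]
  refine wordDeriv_perm (List.perm_iff_count.2 fun i => ?_) hf
  simp [List.count_append, count_derivWord]

theorem pderiv_zero_index {f : Rn n → ℂ} (hf : ContDiff ℝ (⊤ : ℕ∞) f) : pderiv 0 f = f := by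
  rw [pderiv_eq_wordDeriv _ hf]
  have : derivWord (0 : Fin n → ℕ) = [] := by
    simp [derivWord]
  rw [this]
  rfl

theorem pderiv_single (i : Fin n) {f : Rn n → ℂ} (hf : ContDiff ℝ (⊤ : ℕ∞) f) :
    pderiv (Pi.single i 1) f = pd i f := by
  rw [pderiv_eq_wordDeriv _ hf]
  refine wordDeriv_perm (w' := [i]) (List.perm_iff_count.2 fun j => ?_) hf
  rw [count_derivWord, Pi.single_apply, List.count_singleton]
  by_cases h : i = j
  · subst h; simp
  · simp [h, Ne.symm h]

theorem pderiv_add_single (α : Fin n → ℕ) (i : Fin n) {f : Rn n → ℂ}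
    (hf : ContDiff ℝ (⊤ : ℕ∞) f) : pderiv (α + Pi.single i 1) f = pderiv α (pd i f) := by
  rw [pderiv_add_index _ _ hf, pderiv_single i hf]

theorem pderiv_add_single' (α : Fin n → ℕ) (i : Fin n) {f : Rn n → ℂ}
    (hf : ContDiff ℝ (⊤ : ℕ∞) f) : pderiv (α + Pi.single i 1) f = pd i (pderiv α f) := by
  rw [add_comm, pderiv_add_index _ _ hf, pderiv_single i (contDiff_pderiv α hf)]

/-- Induction on |α|, lowering some nonzero coordinate; it extends rules from `pd` to all `pderiv`.
-/
theorem multiIndex_induction {P : (Fin n → ℕ) → Prop} (zero : P 0)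
    (step : ∀ α i, P α → P (α + Pi.single i 1)) (α : Fin n → ℕ) : P α := by
  have : ∀ (m : ℕ) (α : Fin n → ℕ), ∑ i, α i = m → P α := by
    intro m
    induction m with
    | zero =>
      intro α hα
      have : α = 0 := by
        funext i
        exact Finset.sum_eq_zero_iff.1 hα i (Finset.mem_univ i)
      exact this ▸ zero
    | succ m ih =>
      intro α hα
      obtain ⟨i, hi⟩ : ∃ i, α i ≠ 0 := by
        by_contra! h
        simp [h] at hα
      have hle : Pi.single i 1 ≤ α := by
        intro j
        by_cases hj : j = i
        · subst hj; simp; omega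
        · simp [hj]
      have e : α = (α - Pi.single i 1) + Pi.single i 1 := (tsub_add_cancel_of_le hle).symm
      rw [e]
      refine step _ _ (ih _ ?_)
      have h2 := congrArg (fun γ : Fin n → ℕ => ∑ j, γ j) e
      simp only [Pi.add_apply, Finset.sum_add_distrib, Finset.sum_pi_single', Finset.mem_univ,
        if_true] at h2
      omega
  exact this _ α rfl

theorem sum_add_index (α β : Fin n → ℕ) : ∑ i, (α + β) i = ∑ i, α i + ∑ i, β i := by
  simp [Finset.sum_add_distrib]

theorem add_mem_multiIdx {m m' : ℕ} {α β : Fin n → ℕ} (hα : α ∈ multiIdx n m)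
    (hβ : β ∈ multiIdx n m') : α + β ∈ multiIdx n (m + m') := by
  rw [mem_multiIdx] at *
  rw [sum_add_index]
  omega

theorem contDiff_mul {f g : Rn n → ℂ} (hf : ContDiff ℝ (⊤ : ℕ∞) f)
    (hg : ContDiff ℝ (⊤ : ℕ∞) g) : ContDiff ℝ (⊤ : ℕ∞) (f * g) := hf.mul hg

theorem pd_mul (i : Fin n) {f g : Rn n → ℂ} (hf : ContDiff ℝ (⊤ : ℕ∞) f)
    (hg : ContDiff ℝ (⊤ : ℕ∞) g) : pd i (f * g) = pd i f * g + f * pd i g := by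
  funext x
  simp only [pd, Pi.add_apply, Pi.mul_apply]
  rw [fderiv_mul (differentiable_of_smooth hf x) (differentiable_of_smooth hg x)]
  simp
  ring

/-- A list with repetitions takes the place of binomial coefficients: each further derivative
duplicates it, hitting either factor. Since it depends on α alone, its length can serve as a uniform
constant. -/
theorem exists_leibniz (α : Fin n → ℕ) : ∃ s : List ((Fin n → ℕ) × (Fin n → ℕ)),
    (∀ p ∈ s, p.1 + p.2 = α) ∧ ∀ f g : Rn n → ℂ, ContDiff ℝ (⊤ : ℕ∞) f →
      ContDiff ℝ (⊤ : ℕ∞) g →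
      pderiv α (f * g) = (s.map fun p => pderiv p.1 f * pderiv p.2 g).sum := by
  induction α using multiIndex_induction with
  | zero =>
    refine ⟨[(0, 0)], by simp, fun f g hf hg => ?_⟩
    simp [pderiv_zero_index hf, pderiv_zero_index hg, pderiv_zero_index (contDiff_mul hf hg)]
  | step α i ih =>
    obtain ⟨s, hs, h⟩ := ih
    refine ⟨s.map (fun p => (p.1 + Pi.single i 1, p.2)) ++
      s.map (fun p => (p.1, p.2 + Pi.single i 1)), ?_, fun f g hf hg => ?_⟩
    · intro p hp
      simp only [List.mem_append, List.mem_map] at hp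
      rcases hp with ⟨q, hq, rfl⟩ | ⟨q, hq, rfl⟩
      · rw [← hs q hq]; simp only; abel
      · rw [← hs q hq]; simp only; abel
    · have hf' := contDiff_pd i hf
      have hg' := contDiff_pd i hg
      rw [pderiv_add_single _ _ (contDiff_mul hf hg), pd_mul i hf hg,
        pderiv_add _ (contDiff_mul hf' hg) (contDiff_mul hf hg'), h _ _ hf' hg, h _ _ hf hg',
        List.map_append,
        List.sum_append, List.map_map, List.map_map]
      simp only [Function.comp_def, pderiv_add_single _ _ hf, pderiv_add_single _ _ hg]

/-- Leibniz' rule, as an induction principle that counts the summands. -/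
theorem leibniz_induction (α : Fin n → ℕ) : ∃ C : ℕ, ∀ f g : Rn n → ℂ, ContDiff ℝ (⊤ : ℕ∞) f →
      ContDiff ℝ (⊤ : ℕ∞) g → ∀ P : (Rn n → ℂ) → ℕ → Prop, P 0 0 →
      (∀ a b i j, P a i → P b j → P (a + b) (i + j)) →
      (∀ β γ, β + γ = α → P (pderiv β f * pderiv γ g) 1) → P (pderiv α (f * g)) C := by
  obtain ⟨s, hs, h⟩ := exists_leibniz α
  refine ⟨s.length, fun f g hf hg P h0 hadd hP => ?_⟩
  rw [h f g hf hg]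
  clear h
  induction s with
  | nil => simpa using h0
  | cons p s ih =>
    simp only [List.map_cons, List.sum_cons, List.length_cons]
    rw [add_comm s.length]
    exact hadd _ _ _ _ (hP _ _ (hs p (by simp)))
      (ih fun q hq => hs q (by simp [hq]))

theorem pderiv_comp_add (α : Fin n → ℕ) (f : Rn n → ℂ) (y : Rn n) :
    pderiv α (fun x => f (x + y)) = fun x => pderiv α f (x + y) := by
  funext x
  simp only [pderiv]
  rw [iteratedFDeriv_comp_add_right]

theorem pd_comp_sub (i : Fin n) {f : Rn n → ℂ} (hf : ContDiff ℝ (⊤ : ℕ∞) f) (y : Rn n) :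
    pd i (fun x => f (y - x)) = fun x => -pd i f (y - x) := by
  funext x
  have h := (differentiable_of_smooth hf (y - x)).hasFDerivAt.comp x
    ((hasFDerivAt_id (𝕜 := ℝ) x).const_sub y)
  have h' : fderiv ℝ (fun x => f (y - x)) x = _ := h.fderiv
  simp [pd, h']

theorem pderiv_comp_sub (α : Fin n → ℕ) {f : Rn n → ℂ} (hf : ContDiff ℝ (⊤ : ℕ∞) f) (y : Rn n) :
    pderiv α (fun x => f (y - x)) = fun x => (-1) ^ (∑ i, α i) * pderiv α f (y - x) := by
  have hc : ∀ g : Rn n → ℂ, ContDiff ℝ (⊤ : ℕ∞) g → ContDiff ℝ (⊤ : ℕ∞) fun x => g (y - x) :=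
    fun g hg => hg.comp (contDiff_const.sub contDiff_id)
  induction α using multiIndex_induction generalizing f with
  | zero => simp [pderiv_zero_index hf, pderiv_zero_index (hc f hf)]
  | step α i ih =>
    have hp := contDiff_pd i hf
    have e : (fun x => -pd i f (y - x)) = (-1 : ℂ) • fun x => pd i f (y - x) := by
      funext x; simp
    rw [pderiv_add_single _ _ (hc f hf), pd_comp_sub _ hf, e, pderiv_smul _ _ (hc _ hp), ih hp]
    funext x
    rw [pderiv_add_single _ _ hf, sum_add_index]
    simp [pow_add]

end Calculus

/-! ### Joint continuity of bilinear maps from continuity at the origin. -/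

section Bilinear

variable {E F G : Type*} [AddCommGroup E] [Module ℂ E] [TopologicalSpace E]
  [AddCommGroup F] [Module ℂ F] [TopologicalSpace F]
  [AddCommGroup G] [Module ℂ G] [TopologicalSpace G]

/-- Since m(x, y) = m(cx, c⁻¹y), a small c ≠ 0 moves x into the given neighbourhood of 0, and c⁻¹y
is still small when y is. Thus continuity at the origin already yields separate continuity. -/
theorem tendsto_bilin_right [ContinuousSMul ℂ E] [ContinuousSMul ℂ F] (m : E →ₗ[ℂ] F →ₗ[ℂ] G)
    (h : Filter.Tendsto (fun z : E × F => m z.1 z.2) (nhds (0, 0)) (nhds 0)) (x : E) :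
    Filter.Tendsto (fun y => m x y) (nhds 0) (nhds 0) := by
  intro U hU
  have hU' := h hU
  rw [Filter.mem_map, nhds_prod_eq, Filter.mem_prod_iff] at hU'
  obtain ⟨V, hV, W, hW, hVW⟩ := hU'
  have h1 : ∀ᶠ c : ℂ in nhds 0, c • x ∈ V := by
    have : Filter.Tendsto (fun c : ℂ => c • x) (nhds 0) (nhds ((0 : ℂ) • x)) :=
      (continuous_id.smul continuous_const).tendsto 0
    rw [zero_smul] at this
    exact this hV
  obtain ⟨c, hc, hc0⟩ : ∃ c : ℂ, c • x ∈ V ∧ c ≠ 0 :=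
    ((h1.filter_mono (nhdsWithin_le_nhds (s := {0}ᶜ))).and self_mem_nhdsWithin).exists
  have h2 : ∀ᶠ y in nhds (0 : F), c⁻¹ • y ∈ W := by
    have : Filter.Tendsto (fun y : F => c⁻¹ • y) (nhds 0) (nhds (c⁻¹ • (0 : F))) :=
      (continuous_const_smul c⁻¹).tendsto 0
    rw [smul_zero] at this
    exact this hW
  refine Filter.mem_map.2 ?_
  filter_upwards [h2] with y hy
  have := hVW (Set.mk_mem_prod hc hy)
  simpa [smul_smul, hc0] using this

theorem continuous_bilin_of_tendsto [IsTopologicalAddGroup E] [ContinuousSMul ℂ E]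
    [IsTopologicalAddGroup F] [ContinuousSMul ℂ F] [IsTopologicalAddGroup G]
    (m : E →ₗ[ℂ] F →ₗ[ℂ] G)
    (h : Filter.Tendsto (fun z : E × F => m z.1 z.2) (nhds (0, 0)) (nhds 0)) :
    Continuous fun z : E × F => m z.1 z.2 := by
  let f : E →+ F →+ G :=
    { toFun := fun x => (m x).toAddMonoidHom
      map_zero' := by ext; simp
      map_add' := fun x y => by ext; simp }
  refine continuous_of_continuousAt_zero₂ f ?_ (fun x => ?_) (fun y => ?_)
  · have e : f 0 0 = 0 := by simp
    change Filter.Tendsto _ _ (nhds (f 0 0))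
    rw [e]
    exact h
  · have e : f x 0 = 0 := by simp
    change Filter.Tendsto _ _ (nhds (f x 0))
    rw [e]
    exact tendsto_bilin_right m h x
  · have e : f 0 y = 0 := by simp
    change Filter.Tendsto _ _ (nhds (f 0 y))
    rw [e]
    refine tendsto_bilin_right m.flip ?_ y
    exact h.comp (continuous_swap.tendsto' (0, 0) (0, 0) rfl)

theorem continuous_bilin_of_seminorms [IsTopologicalAddGroup E] [ContinuousSMul ℂ E]
    [IsTopologicalAddGroup F] [ContinuousSMul ℂ F] {ι : Type*}
    {r : SeminormFamily ℂ G ι} (hr : WithSeminorms r) (m : E →ₗ[ℂ] F →ₗ[ℂ] G)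
    (h : ∀ i, ∃ (C : ℝ) (p : Seminorm ℂ E) (q : Seminorm ℂ F), Continuous p ∧ Continuous q ∧
      ∀ x y, r i (m x y) ≤ C * (p x * q y)) :
    Continuous fun z : E × F => m z.1 z.2 := by
  have := hr.topologicalAddGroup
  refine continuous_bilin_of_tendsto m ((hr.tendsto_nhds _ _).2 fun i ε hε => ?_)
  obtain ⟨C, p, q, hp, hq, hC⟩ := h i
  have hcont : Continuous fun z : E × F => C * (p z.1 * q z.2) :=
    continuous_const.mul ((hp.comp continuous_fst).mul (hq.comp continuous_snd))
  have : Filter.Tendsto (fun z : E × F => C * (p z.1 * q z.2)) (nhds (0, 0)) (nhds 0) :=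
    hcont.tendsto' _ _ (by simp)
  filter_upwards [this.eventually (gt_mem_nhds hε)] with z hz
  rw [sub_zero]
  exact (hC _ _).trans_lt hz

end Bilinear

/-! ### Working forms of the seminorms and of boundedness. -/

section Seminorms

variable {n : ℕ}

namespace DL

variable {p : ℝ≥0∞} [Fact (1 ≤ p)]

@[ext] theorem ext {p : ℝ≥0∞} {f g : DL n p} (h : ∀ x, f x = g x) : f = g := DFunLike.ext _ _ h

theorem toReal_eLpNorm_le {m : ℕ} {α : Fin n → ℕ} (hα : α ∈ multiIdx n m) (f : DL n p) :
    (eLpNorm (pderiv α f) p volume).toReal ≤ seminorms n p m f :=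
  Seminorm.le_finset_sup_apply (p := seminormDeriv n p) hα

theorem eLpNorm_le {m : ℕ} {α : Fin n → ℕ} (hα : α ∈ multiIdx n m) (f : DL n p) :
    eLpNorm (pderiv α f) p volume ≤ ENNReal.ofReal (seminorms n p m f) := by
  rw [← ENNReal.ofReal_toReal (f.memLp α).eLpNorm_ne_top]
  exact ENNReal.ofReal_le_ofReal (toReal_eLpNorm_le hα f)

theorem seminorms_le {m : ℕ} {f : DL n p} {r : ℝ} (hr : 0 ≤ r)
    (h : ∀ α ∈ multiIdx n m, (eLpNorm (pderiv α f) p volume).toReal ≤ r) :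
    seminorms n p m f ≤ r :=
  Seminorm.finset_sup_apply_le (p := seminormDeriv n p) hr h

theorem seminorms_le' {m : ℕ} {f : DL n p} {r : ℝ} (hr : 0 ≤ r)
    (h : ∀ α ∈ multiIdx n m, eLpNorm (pderiv α f) p volume ≤ ENNReal.ofReal r) :
    seminorms n p m f ≤ r :=
  seminorms_le hr fun α hα => ENNReal.toReal_le_of_le_ofReal hr (h α hα)

theorem seminorms_mono {m m' : ℕ} (h : m ≤ m') (f : DL n p) :
    seminorms n p m f ≤ seminorms n p m' f :=
  seminorms_le (apply_nonneg _ _) fun _ hα =>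
    toReal_eLpNorm_le (mem_multiIdx.2 ((mem_multiIdx.1 hα).trans h)) f

theorem continuous_seminorms (m : ℕ) : Continuous (seminorms n p m) :=
  (withSeminorms n p).continuous_seminorm m

theorem isVonNBounded_iff {s : Set (DL n p)} :
    Bornology.IsVonNBounded ℂ s ↔ ∀ m, ∃ r > 0, ∀ f ∈ s, seminorms n p m f < r :=
  (withSeminorms n p).isVonNBounded_iff_seminorm_bounded

end DL

/-- The set where the bound holds is closed, and it is dense because its complement is null.
Essential suprema of derivatives therefore act as true suprema. -/
theorem norm_le_of_continuous_of_ae {f : Rn n → ℂ} (hf : Continuous f) {c : ℝ}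
    (h : ∀ᵐ x, ‖f x‖ ≤ c) (x : Rn n) : ‖f x‖ ≤ c := by
  have hd : Dense {x | ‖f x‖ ≤ c} := Measure.dense_of_ae h
  have hc : IsClosed {x | ‖f x‖ ≤ c} := isClosed_le hf.norm continuous_const
  have := hd.closure_eq
  rw [hc.closure_eq] at this
  exact (Set.ext_iff.1 this x).2 trivial

theorem eLpNorm_top_le_of_norm_le {f : Rn n → ℂ} {c : ℝ} (h : ∀ x, ‖f x‖ ≤ c) :
    eLpNorm f ⊤ volume ≤ ENNReal.ofReal c :=
  eLpNormEssSup_le_of_ae_bound (Filter.Eventually.of_forall h)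

theorem enorm_le_eLpNorm_top {f : Rn n → ℂ} (hf : Continuous f) (x : Rn n) :
    ‖f x‖ₑ ≤ eLpNorm f ⊤ volume := by
  by_cases ht : eLpNorm f ⊤ volume = ⊤
  · simp [ht]
  have h : ∀ᵐ y, ‖f y‖ ≤ (eLpNorm f ⊤ volume).toReal := by
    filter_upwards [ae_le_eLpNormEssSup (f := f) (μ := volume)] with y hy
    rw [← toReal_enorm]
    exact ENNReal.toReal_mono ht hy
  have := norm_le_of_continuous_of_ae hf h x
  rw [← ofReal_norm]
  exact ENNReal.ofReal_le_of_le_toReal this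

theorem DL.norm_pderiv_le {m : ℕ} {α : Fin n → ℕ} (hα : α ∈ multiIdx n m) (f : DL n ⊤) (x : Rn n) :
    ‖pderiv α f x‖ ≤ seminorms n ⊤ m f := by
  have h := (enorm_le_eLpNorm_top (continuous_pderiv α f.contDiff) x).trans (DL.eLpNorm_le hα f)
  rw [← ofReal_norm] at h
  exact (ENNReal.ofReal_le_ofReal_iff (apply_nonneg _ _)).1 h

theorem DL.seminorms_top_le {m : ℕ} {f : DL n ⊤} {r : ℝ} (hr : 0 ≤ r)
    (h : ∀ α ∈ multiIdx n m, ∀ x, ‖pderiv α f x‖ ≤ r) : seminorms n ⊤ m f ≤ r :=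
  DL.seminorms_le' hr fun α hα => eLpNorm_top_le_of_norm_le (h α hα)

theorem self_mem_multiIdx (α : Fin n → ℕ) : α ∈ multiIdx n (∑ i, α i) := mem_multiIdx.2 le_rfl

namespace SmoothFn

@[ext] theorem ext {f g : SmoothFn n} (h : ∀ x, f x = g x) : f = g := DFunLike.ext _ _ h

theorem norm_pderiv_le {m : ℕ} {K : Compacts (Rn n)} {α : Fin n → ℕ} (hα : α ∈ multiIdx n m)
    (f : SmoothFn n) {x : Rn n} (hx : x ∈ K) : ‖pderiv α f x‖ ≤ seminorms n (m, K) f :=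
  (ContinuousMap.norm_coe_le_norm (restrictDeriv K α f) ⟨x, hx⟩).trans
    (Seminorm.le_finset_sup_apply (x := f)
      (p := fun α => (normSeminorm ℂ C(K, ℂ)).comp (restrictDeriv K α)) hα)

theorem seminorms_le {m : ℕ} {K : Compacts (Rn n)} {f : SmoothFn n} {r : ℝ} (hr : 0 ≤ r)
    (h : ∀ α ∈ multiIdx n m, ∀ x ∈ K, ‖pderiv α f x‖ ≤ r) : seminorms n (m, K) f ≤ r :=
  Seminorm.finset_sup_apply_le (p := fun α => (normSeminorm ℂ C(K, ℂ)).comp (restrictDeriv K α))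
    hr fun α hα => (ContinuousMap.norm_le _ hr).2 fun x => h α hα x x.2

theorem seminorms_mono {m m' : ℕ} {K K' : Compacts (Rn n)} (h : m ≤ m') (hK : K ≤ K')
    (f : SmoothFn n) : seminorms n (m, K) f ≤ seminorms n (m', K') f :=
  seminorms_le (apply_nonneg _ _) fun _ hα _ hx =>
    norm_pderiv_le (mem_multiIdx.2 ((mem_multiIdx.1 hα).trans h)) f (hK hx)

theorem continuous_seminorms (i : ℕ × Compacts (Rn n)) : Continuous (seminorms n i) :=
  (withSeminorms n).continuous_seminorm i

theorem isVonNBounded_iff {s : Set (SmoothFn n)} :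
    Bornology.IsVonNBounded ℂ s ↔ ∀ i, ∃ r > 0, ∀ f ∈ s, seminorms n i f < r :=
  (withSeminorms n).isVonNBounded_iff_seminorm_bounded

end SmoothFn

namespace BDot

@[ext] theorem ext {f g : BDot n} (h : ∀ x, (f : DL n ⊤) x = (g : DL n ⊤) x) : f = g :=
  Subtype.ext (DL.ext h)

theorem contDiff (f : BDot n) : ContDiff ℝ (⊤ : ℕ∞) (f : DL n ⊤) := (f : DL n ⊤).contDiff

theorem tendsto (f : BDot n) (α : Fin n → ℕ) :
    Filter.Tendsto (pderiv α (f : DL n ⊤)) (Filter.cocompact (Rn n)) (nhds 0) := f.2 α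

/-- The seminorms of `𝒟_{L^∞}`, restricted to `ℬ̇`. -/
noncomputable def seminorms (n : ℕ) : SeminormFamily ℂ (BDot n) ℕ :=
  (DL.seminorms n ⊤).comp (BDot n).subtype

theorem withSeminorms (n : ℕ) : WithSeminorms (seminorms n) :=
  Topology.IsInducing.withSeminorms (f := (BDot n).subtype) (DL.withSeminorms n ⊤)
    Topology.IsInducing.subtypeVal

theorem isVonNBounded_iff {s : Set (BDot n)} :
    Bornology.IsVonNBounded ℂ s ↔ ∀ m, ∃ r > 0, ∀ f ∈ s, DL.seminorms n ⊤ m (f : DL n ⊤) < r :=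
  (withSeminorms n).isVonNBounded_iff_seminorm_bounded

/-- A smooth function all of whose derivatives tend to `0` at infinity, as an element of `ℬ̇`. -/
noncomputable def mk (f : Rn n → ℂ) (hf : ContDiff ℝ (⊤ : ℕ∞) f)
    (h : ∀ α, Filter.Tendsto (pderiv α f) (Filter.cocompact (Rn n)) (nhds 0)) : BDot n :=
  ⟨(⟨f, hf, fun α => by
    have hc := continuous_pderiv α hf
    obtain ⟨C, hC⟩ : ∃ C, ∀ x, ‖pderiv α f x‖ ≤ C := by
      obtain ⟨C, hC⟩ := (ZeroAtInftyContinuousMap.isBounded_range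
        (⟨⟨pderiv α f, hc⟩, h α⟩ : ZeroAtInftyContinuousMap (Rn n) ℂ)).exists_norm_le
      exact ⟨C, fun x => hC _ ⟨x, rfl⟩⟩
    exact memLp_top_of_bound hc.aestronglyMeasurable C (Filter.Eventually.of_forall hC)⟩ :
    dLpSubmodule n ⊤), h⟩

end BDot

end Seminorms

/-! ### The multiplications. -/

section Multiplication

variable {n : ℕ} {p : ℝ≥0∞}

theorem toReal_eLpNorm_mul_le {f g : Rn n → ℂ} (hf : MemLp f p volume) (hg : MemLp g ⊤ volume) :
    MemLp (f * g) p volume ∧ (eLpNorm (f * g) p volume).toReal ≤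
      (eLpNorm f p volume).toReal * (eLpNorm g ⊤ volume).toReal := by
  refine ⟨hg.mul hf, ?_⟩
  rw [← ENNReal.toReal_mul]
  exact ENNReal.toReal_mono (ENNReal.mul_ne_top hf.eLpNorm_ne_top hg.eLpNorm_ne_top)
    (by simpa only [smul_eq_mul] using
      eLpNorm_smul_le_mul_eLpNorm (p := p) (q := ⊤) (r := p) hg.1 hf.1)

variable [Fact (1 ≤ p)]

/-- The predicate fed to `leibniz_induction` joins membership in L^p with the estimate, so that
norms can be added along the sum; its counter becomes C. Each summand is bounded by Hölder's
inequality with exponents p and ∞. -/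
theorem DL.pderiv_mul_bound (α : Fin n → ℕ) : ∃ C : ℕ, ∀ (f : DL n p) (g : DL n ⊤),
    MemLp (pderiv α (⇑f * ⇑g)) p volume ∧ (eLpNorm (pderiv α (⇑f * ⇑g)) p volume).toReal ≤
      C * (seminorms n p (∑ i, α i) f * seminorms n ⊤ (∑ i, α i) g) := by
  obtain ⟨C, hC⟩ := leibniz_induction α
  refine ⟨C, fun f g => ?_⟩
  refine hC f g f.contDiff g.contDiff (fun h k => MemLp h p volume ∧
    (eLpNorm h p volume).toReal ≤
      k * (seminorms n p (∑ i, α i) f * seminorms n ⊤ (∑ i, α i) g)) ?_ ?_ ?_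
  · exact ⟨MemLp.zero, by simp⟩
  · rintro a b i j ⟨ha, ha'⟩ ⟨hb, hb'⟩
    refine ⟨ha.add hb, ?_⟩
    rw [Nat.cast_add, add_mul]
    refine le_trans ?_ (add_le_add ha' hb')
    rw [← ENNReal.toReal_add ha.eLpNorm_ne_top hb.eLpNorm_ne_top]
    exact ENNReal.toReal_mono (ENNReal.add_ne_top.2 ⟨ha.eLpNorm_ne_top, hb.eLpNorm_ne_top⟩)
      (eLpNorm_add_le ha.1 hb.1 Fact.out)
  · rintro β γ rfl
    obtain ⟨h1, h2⟩ := toReal_eLpNorm_mul_le (f.memLp β) (g.memLp γ)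
    refine ⟨h1, h2.trans ?_⟩
    rw [Nat.cast_one, one_mul]
    refine mul_le_mul (toReal_eLpNorm_le ?_ f) (toReal_eLpNorm_le ?_ g) ENNReal.toReal_nonneg
      (apply_nonneg _ _)
    · rw [mem_multiIdx, sum_add_index]; omega
    · rw [mem_multiIdx, sum_add_index]; omega

theorem DL.mul_mem (f : DL n p) (g : DL n ⊤) : ⇑f * ⇑g ∈ dLpSubmodule n p :=
  ⟨f.contDiff.mul g.contDiff, fun α => ((DL.pderiv_mul_bound α).choose_spec f g).1⟩

/-- The multiplication `𝒟_{L^p} × 𝒟_{L^∞} → 𝒟_{L^p}`. -/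
noncomputable def DL.mul (n : ℕ) (p : ℝ≥0∞) [Fact (1 ≤ p)] : DL n p →ₗ[ℂ] DL n ⊤ →ₗ[ℂ] DL n p :=
  LinearMap.mk₂ ℂ (fun f g => (⟨⇑f * ⇑g, DL.mul_mem f g⟩ : dLpSubmodule n p))
    (fun _ _ _ => DL.ext fun _ => add_mul _ _ _)
    (fun _ _ _ => DL.ext fun _ => mul_assoc _ _ _)
    (fun _ _ _ => DL.ext fun _ => mul_add _ _ _)
    (fun _ _ _ => DL.ext fun _ => mul_left_comm _ _ _)

theorem DL.coe_mul (f : DL n p) (g : DL n ⊤) : ⇑(DL.mul n p f g) = ⇑f * ⇑g := rfl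

theorem DL.exists_seminorms_mul_le (p : ℝ≥0∞) [Fact (1 ≤ p)] (m : ℕ) :
    ∃ C : ℝ, ∀ (f : DL n p) (g : DL n ⊤),
      seminorms n p m (DL.mul n p f g) ≤ C * (seminorms n p m f * seminorms n ⊤ m g) := by
  choose C hC using fun α : Fin n → ℕ => DL.pderiv_mul_bound (n := n) (p := p) α
  refine ⟨∑ α ∈ multiIdx n m, (C α : ℝ), fun f g => ?_⟩
  refine seminorms_le (by positivity) fun α hα => ((hC α f g).2).trans ?_
  have h1 : (C α : ℝ) ≤ ∑ α ∈ multiIdx n m, (C α : ℝ) :=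
    Finset.single_le_sum (f := fun α => (C α : ℝ)) (fun _ _ => Nat.cast_nonneg _) hα
  have h2 := mem_multiIdx.1 hα
  exact mul_le_mul h1 (mul_le_mul (seminorms_mono h2 f) (seminorms_mono h2 g) (apply_nonneg _ _)
    (apply_nonneg _ _)) (by positivity) (by positivity)

theorem DL.continuous_mul (n : ℕ) (p : ℝ≥0∞) [Fact (1 ≤ p)] :
    Continuous fun z : DL n p × DL n ⊤ => DL.mul n p z.1 z.2 :=
  continuous_bilin_of_seminorms (DL.withSeminorms n p) _ fun m =>
    let ⟨C, hC⟩ := DL.exists_seminorms_mul_le (n := n) p m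
    ⟨C, _, _, DL.continuous_seminorms m, DL.continuous_seminorms m, hC⟩

/-- Every Leibniz summand is a function vanishing at infinity times a bounded one. -/
theorem BDot.mul_mem (f : BDot n) (g : DL n ⊤) : DL.mul n ⊤ f g ∈ BDot n := by
  intro α
  obtain ⟨C, hC⟩ := leibniz_induction α
  rw [DL.coe_mul]
  refine hC f g (contDiff f) g.contDiff
    (fun h _ => Filter.Tendsto h (Filter.cocompact (Rn n)) (nhds 0)) tendsto_const_nhds
    (fun a b _ _ ha hb => by simpa only [add_zero] using! Filter.Tendsto.add ha hb) fun β γ _ => ?_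
  refine squeeze_zero_norm (a := fun x => ‖pderiv β (f : DL n ⊤) x‖ * DL.seminorms n ⊤ (∑ i, γ i) g)
    (fun x => ?_) (by simpa using (tendsto f β).norm.mul_const (DL.seminorms n ⊤ (∑ i, γ i) g))
  simp only [Pi.mul_apply, norm_mul]
  gcongr
  exact DL.norm_pderiv_le (self_mem_multiIdx γ) g x

/-- The multiplication `ℬ̇ × 𝒟_{L^∞} → ℬ̇`. -/
noncomputable def BDot.mul (n : ℕ) : BDot n →ₗ[ℂ] DL n ⊤ →ₗ[ℂ] BDot n :=
  LinearMap.mk₂ ℂ (fun f g => ⟨DL.mul n ⊤ f g, BDot.mul_mem f g⟩)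
    (fun _ _ _ => BDot.ext fun _ => add_mul _ _ _)
    (fun _ _ _ => BDot.ext fun _ => mul_assoc _ _ _)
    (fun _ _ _ => BDot.ext fun _ => mul_add _ _ _)
    (fun _ _ _ => BDot.ext fun _ => mul_left_comm _ _ _)

theorem BDot.continuous_mul (n : ℕ) :
    Continuous fun z : BDot n × DL n ⊤ => BDot.mul n z.1 z.2 :=
  ((DL.continuous_mul n ⊤).comp
    ((continuous_subtype_val.comp continuous_fst).prodMk continuous_snd)).subtype_mk _

/-- The multiplication `ℰ × ℰ → ℰ`. -/
noncomputable def SmoothFn.mul (n : ℕ) : SmoothFn n →ₗ[ℂ] SmoothFn n →ₗ[ℂ] SmoothFn n :=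
  LinearMap.mk₂ ℂ
    (fun f g => (⟨⇑f * ⇑g, f.contDiff.mul g.contDiff⟩ : smoothSubmodule n))
    (fun _ _ _ => SmoothFn.ext fun _ => add_mul _ _ _)
    (fun _ _ _ => SmoothFn.ext fun _ => mul_assoc _ _ _)
    (fun _ _ _ => SmoothFn.ext fun _ => mul_add _ _ _)
    (fun _ _ _ => SmoothFn.ext fun _ => mul_left_comm _ _ _)

theorem SmoothFn.coe_mul (f g : SmoothFn n) : ⇑(SmoothFn.mul n f g) = ⇑f * ⇑g := rfl

theorem SmoothFn.exists_seminorms_mul_le (m : ℕ) (K : Compacts (Rn n)) :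
    ∃ C : ℝ, ∀ f g : SmoothFn n, seminorms n (m, K) (SmoothFn.mul n f g) ≤
      C * (seminorms n (m, K) f * seminorms n (m, K) g) := by
  choose C hC using fun α : Fin n → ℕ => leibniz_induction α
  refine ⟨∑ α ∈ multiIdx n m, (C α : ℝ), fun f g => ?_⟩
  refine seminorms_le (by positivity) fun α hα x hx => ?_
  have h1 : (C α : ℝ) ≤ ∑ α ∈ multiIdx n m, (C α : ℝ) :=
    Finset.single_le_sum (f := fun α => (C α : ℝ)) (fun _ _ => Nat.cast_nonneg _) hα
  refine le_trans ?_ (mul_le_mul_of_nonneg_right h1 (by positivity))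
  rw [coe_mul]
  refine hC α f g f.contDiff g.contDiff
    (fun h k => ‖h x‖ ≤ k * (seminorms n (m, K) f * seminorms n (m, K) g)) ?_ ?_ ?_
  · simp
  · intro a b i j ha hb
    rw [Nat.cast_add, add_mul]
    exact (norm_add_le _ _).trans (add_le_add ha hb)
  · rintro β γ rfl
    rw [mem_multiIdx, sum_add_index] at hα
    rw [Nat.cast_one, one_mul, Pi.mul_apply, norm_mul]
    exact mul_le_mul (norm_pderiv_le (mem_multiIdx.2 (by omega)) f hx)
      (norm_pderiv_le (mem_multiIdx.2 (by omega)) g hx) (norm_nonneg _) (apply_nonneg _ _)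

theorem SmoothFn.continuous_mul (n : ℕ) :
    Continuous fun z : SmoothFn n × SmoothFn n => SmoothFn.mul n z.1 z.2 :=
  continuous_bilin_of_seminorms (SmoothFn.withSeminorms n) _ fun i =>
    let ⟨C, hC⟩ := SmoothFn.exists_seminorms_mul_le (n := n) i.1 i.2
    ⟨C, _, _, SmoothFn.continuous_seminorms i, SmoothFn.continuous_seminorms i, hC⟩

end Multiplication

/-! ### A local Sobolev inequality and decay at infinity. -/

section Sobolev

variable {n : ℕ}

theorem hasDerivAt_toLp_update (x : Fin n → ℝ) (i : Fin n) (t : ℝ) :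
    HasDerivAt (fun t => (WithLp.toLp 2 (Function.update x i t) : Rn n))
      (EuclideanSpace.single i 1) t := by
  have h := (PiLp.continuousLinearEquiv 2 ℝ (fun _ : Fin n => ℝ)).symm.hasFDerivAt.comp_hasDerivAt t
    (hasDerivAt_update x i t)
  simpa using! h

theorem hasCompactSupport_pd (i : Fin n) {f : Rn n → ℂ} (hc : HasCompactSupport f) :
    HasCompactSupport (pd i f) :=
  hc.fderiv_apply ℝ _

theorem hasCompactSupport_wordDeriv (w : List (Fin n)) {f : Rn n → ℂ} (hc : HasCompactSupport f) :
    HasCompactSupport (wordDeriv w f) := by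
  induction w with
  | nil => exact hc
  | cons i w ih => exact hasCompactSupport_pd i ih

/-- The fundamental theorem of calculus on a line parallel to the i-th axis, starting from −∞, where
v vanishes. -/
theorem enorm_le_lintegral_pd (i : Fin n) {v : Rn n → ℂ} (hv : ContDiff ℝ (⊤ : ℕ∞) v)
    (hc : HasCompactSupport v) (x : Fin n → ℝ) :
    ‖v (WithLp.toLp 2 x)‖ₑ ≤ ∫⁻ t, ‖pd i v (WithLp.toLp 2 (Function.update x i t))‖ₑ := by
  have hd : ∀ t, HasDerivAt (fun t => v (WithLp.toLp 2 (Function.update x i t)))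
      (pd i v (WithLp.toLp 2 (Function.update x i t))) t := fun t =>
    (differentiable_of_smooth hv _).hasFDerivAt.comp_hasDerivAt t (hasDerivAt_toLp_update x i t)
  have h1 : ContDiff ℝ 1 (fun t => v (WithLp.toLp 2 (Function.update x i t))) := by
    have h2 : ContDiff ℝ 1 (fun t => (WithLp.toLp 2 (Function.update x i t) : Rn n)) :=
      (PiLp.continuousLinearEquiv 2 ℝ (fun _ : Fin n => ℝ)).symm.contDiff.comp
        (contDiff_update 1 x i)
    exact (hv.of_le (by exact_mod_cast smooth_le 1)).comp h2
  have h3 : HasCompactSupport (fun t => v (WithLp.toLp 2 (Function.update x i t))) :=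
    hc.comp_isClosedEmbedding
      ((PiLp.continuousLinearEquiv 2 ℝ (fun _ : Fin n => ℝ)).symm.toHomeomorph.isClosedEmbedding.comp
        (isClosedEmbedding_update x i))
  calc ‖v (WithLp.toLp 2 x)‖ₑ = ‖v (WithLp.toLp 2 (Function.update x i (x i)))‖ₑ := by simp
    _ ≤ ∫⁻ t in Set.Iic (x i), ‖deriv (fun t => v (WithLp.toLp 2 (Function.update x i t))) t‖ₑ :=
        h3.enorm_le_lintegral_Ici_deriv h1 (x i)
    _ ≤ ∫⁻ t, ‖deriv (fun t => v (WithLp.toLp 2 (Function.update x i t))) t‖ₑ :=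
        lintegral_mono' Measure.restrict_le_self le_rfl
    _ = _ := by simp only [(hd _).deriv]

/-- Each letter contributes one application of the one-dimensional bound. As letters do not repeat,
each integrates over a fresh variable, and the iterated integrals form a marginal. -/
theorem enorm_le_lmarginal_wordDeriv (w : List (Fin n)) (hw : w.Nodup) {u : Rn n → ℂ}
    (hu : ContDiff ℝ (⊤ : ℕ∞) u) (hc : HasCompactSupport u) (x : Fin n → ℝ) :
    ‖u (WithLp.toLp 2 x)‖ₑ ≤ lmarginal (fun _ : Fin n => (volume : Measure ℝ)) w.toFinset
      (fun y => ‖wordDeriv w u (WithLp.toLp 2 y)‖ₑ) x := by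
  induction w with
  | nil => simp [wordDeriv]
  | cons i w ih =>
    rw [List.nodup_cons] at hw
    have hsm := contDiff_wordDeriv (i :: w) hu
    rw [List.toFinset_cons, lmarginal_insert' _ _ (by simpa using hw.1)]
    · exact (ih hw.2).trans (lmarginal_mono (fun y => enorm_le_lintegral_pd i
        (contDiff_wordDeriv w hu) (hasCompactSupport_wordDeriv w hc) y) x)
    · exact (hsm.continuous.comp (PiLp.continuous_toLp 2 _)).enorm.measurable

theorem enorm_le_lintegral_pderiv_one {u : Rn n → ℂ}
    (hu : ContDiff ℝ (⊤ : ℕ∞) u) (hc : HasCompactSupport u) (x : Rn n) :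
    ‖u x‖ₑ ≤ ∫⁻ y, ‖pderiv (fun _ => 1) u y‖ₑ := by
  have hperm : (derivWord fun _ : Fin n => 1).Perm (List.finRange n) :=
    List.perm_iff_count.2 fun i => by
      rw [count_derivWord, List.count_eq_one_of_mem (List.nodup_finRange n) (List.mem_finRange i)]
  have h := enorm_le_lmarginal_wordDeriv (List.finRange n) (List.nodup_finRange n) hu hc
    (WithLp.ofLp x)
  have e : (List.finRange n).toFinset = Finset.univ := by ext; simp
  rw [e, lmarginal_univ] at h
  refine h.trans (le_of_eq ?_)
  rw [pderiv_eq_wordDeriv _ hu, wordDeriv_perm hperm hu]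
  exact (PiLp.volume_preserving_toLp (Fin n)).lintegral_comp
    (f := fun y => ‖wordDeriv (List.finRange n) u y‖ₑ)
    (contDiff_wordDeriv _ hu).continuous.enorm.measurable

/-- Apply the bound of u by the L¹ norm of ∂_1⋯∂_n u to g times a cutoff around y, and expand by
Leibniz' rule. Only derivatives of order at most n occur, and translating g instead of the cutoff
makes the constant independent of y. -/
theorem exists_sobolev (n : ℕ) : ∃ C : ℝ≥0∞, C ≠ ⊤ ∧ ∀ g : Rn n → ℂ, ContDiff ℝ (⊤ : ℕ∞) g → ∀ y,
    ‖g y‖ₑ ≤ C * ∑ β ∈ multiIdx n n, ∫⁻ x in Metric.closedBall y 1, ‖pderiv β g x‖ₑ := by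
  obtain ⟨N, hN⟩ := leibniz_induction (n := n) fun _ => 1
  -- Equal to 1 at the centre, so the value g(y) survives; supported in the closed unit ball, so the
  -- integrals localize.
  let χ : ContDiffBump (0 : Rn n) := ⟨1 / 2, 1, by norm_num, by norm_num⟩
  have hχ : ContDiff ℝ (⊤ : ℕ∞) (toC χ) := contDiff_toC χ.contDiff
  have hχc : ∀ β, HasCompactSupport (pderiv β (toC χ)) := fun β =>
    hasCompactSupport_pderiv_toC β χ.contDiff χ.hasCompactSupport
  choose M hM using fun β => (hχc β).exists_bound_of_continuous (continuous_pderiv β hχ)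
  have hMpos : ∀ β, 0 ≤ M β := fun β => (norm_nonneg _).trans (hM β 0)
  have hsupp : ∀ β x, x ∉ Metric.closedBall (0 : Rn n) 1 → pderiv β (toC χ) x = 0 := by
    intro β x hx
    have h1 := norm_pderiv_toC_le β (φ := χ) χ.contDiff x
    have h2 : iteratedFDeriv ℝ (derivWord β).length χ x = 0 := by
      by_contra h
      exact hx (χ.tsupport_eq ▸ support_iteratedFDeriv_subset (𝕜 := ℝ) _ h)
    simpa [h2] using h1
  -- The number of Leibniz summands times a bound for all derivatives of the cutoff up to order n.
  set K : ℝ := N * ∑ β ∈ multiIdx n n, M β with hK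
  refine ⟨ENNReal.ofReal K, ENNReal.ofReal_ne_top, fun g hg y => ?_⟩
  have hgy : ContDiff ℝ (⊤ : ℕ∞) fun x => g (x + y) := hg.comp (contDiff_id.add contDiff_const)
  have hmain : ∀ x, ‖pderiv (fun _ => 1) (toC χ * fun x => g (x + y)) x‖ ≤ N *
      ((Metric.closedBall (0 : Rn n) 1).indicator (fun x => (∑ β ∈ multiIdx n n, M β) *
        ∑ β ∈ multiIdx n n, ‖pderiv β g (x + y)‖) x) := by
    intro x
    refine hN (toC χ) (fun x => g (x + y)) hχ hgy (fun h k => ‖h x‖ ≤ k *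
      ((Metric.closedBall (0 : Rn n) 1).indicator (fun x => (∑ β ∈ multiIdx n n, M β) *
        ∑ β ∈ multiIdx n n, ‖pderiv β g (x + y)‖) x)) (by simp) ?_ ?_
    · intro a b i j ha hb
      rw [Nat.cast_add, add_mul]
      exact (norm_add_le _ _).trans (add_le_add ha hb)
    · intro β γ hβγ
      have hsum := sum_add_index β γ
      rw [hβγ] at hsum
      simp only [Finset.sum_const, Finset.card_univ, Fintype.card_fin, smul_eq_mul, mul_one] at hsum
      have hβ : β ∈ multiIdx n n := mem_multiIdx.2 (by omega)
      have hγ : γ ∈ multiIdx n n := mem_multiIdx.2 (by omega)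
      rw [Pi.mul_apply, norm_mul, Nat.cast_one, one_mul, pderiv_comp_add]
      by_cases hx : x ∈ Metric.closedBall (0 : Rn n) 1
      · rw [Set.indicator_of_mem hx]
        exact mul_le_mul ((hM β x).trans (Finset.single_le_sum (fun β _ => hMpos β) hβ))
          (Finset.single_le_sum (f := fun γ => ‖pderiv γ g (x + y)‖) (fun β _ => norm_nonneg _) hγ)
          (norm_nonneg _) (Finset.sum_nonneg fun β _ => hMpos β)
      · rw [Set.indicator_of_notMem hx, hsupp β x hx]
        simp
  have h0 : g y = (toC χ * fun x => g (x + y)) 0 := by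
    have : χ (0 : Rn n) = 1 := χ.one_of_mem_closedBall (by simp [χ])
    simp [toC, this]
  rw [h0]
  refine (enorm_le_lintegral_pderiv_one (contDiff_mul hχ hgy) ?_ 0).trans ?_
  · exact (χ.hasCompactSupport.comp_left (g := fun r : ℝ => (r : ℂ)) (by simp)).mul_right
  calc ∫⁻ x, ‖pderiv (fun _ => 1) (toC χ * fun x => g (x + y)) x‖ₑ
      ≤ ∫⁻ x, (Metric.closedBall (0 : Rn n) 1).indicator (fun x => ENNReal.ofReal K *
          ∑ β ∈ multiIdx n n, ‖pderiv β g (x + y)‖ₑ) x := by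
        refine lintegral_mono fun x => ?_
        rw [← ofReal_norm]
        refine (ENNReal.ofReal_le_ofReal (hmain x)).trans ?_
        by_cases hx : x ∈ Metric.closedBall (0 : Rn n) 1
        · rw [Set.indicator_of_mem hx, Set.indicator_of_mem hx, ← mul_assoc, ← hK,
            ENNReal.ofReal_mul (mul_nonneg (Nat.cast_nonneg _)
              (Finset.sum_nonneg fun β _ => hMpos β)),
            ENNReal.ofReal_sum_of_nonneg fun _ _ => norm_nonneg _]
          simp only [ofReal_norm, hK, le_refl]
        · rw [Set.indicator_of_notMem hx, Set.indicator_of_notMem hx]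
          simp
    _ = ENNReal.ofReal K * ∑ β ∈ multiIdx n n,
          ∫⁻ x in Metric.closedBall (0 : Rn n) 1, ‖pderiv β g (x + y)‖ₑ := by
        have hm : ∀ β, Measurable fun x => ‖pderiv β g (x + y)‖ₑ := fun β =>
          ((continuous_pderiv β hg).comp (continuous_id.add continuous_const)).enorm.measurable
        rw [lintegral_indicator Metric.isClosed_closedBall.measurableSet,
          lintegral_const_mul _ (Finset.measurable_sum _ fun β _ => hm β),
          lintegral_finsetSum _ fun β _ => hm β]
    _ = _ := by
        congr 1
        refine Finset.sum_congr rfl fun β _ => ?_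
        rw [← (measurePreserving_add_right volume y).setLIntegral_comp_preimage
          Metric.isClosed_closedBall.measurableSet (continuous_pderiv β hg).enorm.measurable]
        congr 2
        ext x
        simp [dist_eq_norm]

theorem lintegral_closedBall_le_eLpNorm {p : ℝ≥0∞} (hp : 1 ≤ p) (y : Rn n) {r : ℝ} {h : Rn n → ℂ}
    (hh : Continuous h) :
    ∫⁻ x in Metric.closedBall y r, ‖h x‖ₑ ≤
      eLpNorm h p (volume.restrict (Metric.closedBall y r)) *
        volume (Metric.closedBall (0 : Rn n) r) ^ (1 - 1 / p.toReal) := by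
  have := eLpNorm_le_eLpNorm_mul_rpow_measure_univ (μ := volume.restrict (Metric.closedBall y r))
    hp hh.aestronglyMeasurable
  rw [eLpNorm_one_eq_lintegral_enorm, Measure.restrict_apply_univ,
    Measure.addHaar_closedBall_center volume y r] at this
  simpa using this

/-- Needed for dominated convergence along this filter. -/
instance isCountablyGenerated_cocompact : (Filter.cocompact (Rn n)).IsCountablyGenerated := by
  rw [← Metric.cobounded_eq_cocompact, ← comap_norm_atTop]
  infer_instance

/-- A fixed x eventually leaves the unit ball about y as y goes to infinity, so the localized
integrands tend to 0 pointwise, dominated by |h|^p. This fails for p = ∞. -/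
theorem tendsto_eLpNorm_closedBall {p : ℝ≥0∞} (hp : 1 ≤ p) (hp' : p ≠ ⊤) {h : Rn n → ℂ}
    (hh : Continuous h) (hm : MemLp h p volume) :
    Filter.Tendsto (fun y => eLpNorm h p (volume.restrict (Metric.closedBall y 1)))
      (Filter.cocompact (Rn n)) (nhds 0) := by
  have hp0 : p ≠ 0 := (zero_lt_one.trans_le hp).ne'
  have hpos : 0 < p.toReal := ENNReal.toReal_pos hp0 hp'
  have key : Filter.Tendsto (fun y => ∫⁻ x, (Metric.closedBall y 1).indicator
      (fun x => ‖h x‖ₑ ^ p.toReal) x) (Filter.cocompact (Rn n)) (nhds (∫⁻ _ : Rn n, 0)) := by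
    refine tendsto_lintegral_filter_of_dominated_convergence (fun x => ‖h x‖ₑ ^ p.toReal) ?_ ?_ ?_ ?_
    · exact Filter.Eventually.of_forall fun y =>
        (hh.enorm.measurable.pow_const _).indicator Metric.isClosed_closedBall.measurableSet
    · exact Filter.Eventually.of_forall fun y => Filter.Eventually.of_forall fun x =>
        Set.indicator_le_self _ _ x
    · exact (lintegral_rpow_enorm_lt_top_of_eLpNorm_lt_top hp0 hp' hm.2).ne
    · refine Filter.Eventually.of_forall fun x => tendsto_const_nhds.congr' ?_
      filter_upwards [(isCompact_closedBall x 1).compl_mem_cocompact] with y hy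
      rw [Set.indicator_of_notMem]
      simpa [dist_comm] using hy
  rw [lintegral_zero] at key
  have key2 := (ENNReal.continuous_rpow_const (y := 1 / p.toReal)).tendsto 0 |>.comp key
  rw [ENNReal.zero_rpow_of_pos (by positivity)] at key2
  refine key2.congr fun y => ?_
  rw [eLpNorm_eq_lintegral_rpow_enorm_toReal hp0 hp', Function.comp_apply,
    lintegral_indicator Metric.isClosed_closedBall.measurableSet]

/-- The Sobolev bound at y involves only L¹ norms over the unit ball about y, which Hölder's
inequality bounds by L^p norms over that ball; these tend to 0. -/
theorem tendsto_cocompact_of_memLp {p : ℝ≥0∞} (hp : 1 ≤ p) (hp' : p ≠ ⊤) {g : Rn n → ℂ}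
    (hg : ContDiff ℝ (⊤ : ℕ∞) g) (hm : ∀ β, MemLp (pderiv β g) p volume) :
    Filter.Tendsto g (Filter.cocompact (Rn n)) (nhds 0) := by
  obtain ⟨C, hC, h⟩ := exists_sobolev n
  set V : ℝ≥0∞ := volume (Metric.closedBall (0 : Rn n) 1) ^ (1 - 1 / p.toReal) with hV
  have hVt : V ≠ ⊤ := by
    have h1 : (1 : ℝ) ≤ p.toReal := by
      simpa using ENNReal.toReal_mono hp' hp
    refine ENNReal.rpow_ne_top_of_nonneg ?_ measure_closedBall_lt_top.ne
    rw [sub_nonneg, div_le_one (by positivity)]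
    exact h1
  have hlim : Filter.Tendsto (fun y => C * ∑ β ∈ multiIdx n n,
      eLpNorm (pderiv β g) p (volume.restrict (Metric.closedBall y 1)) * V)
      (Filter.cocompact (Rn n)) (nhds 0) := by
    have h1 := tendsto_finsetSum (multiIdx n n) fun β _ =>
      ENNReal.Tendsto.mul_const (b := V) (tendsto_eLpNorm_closedBall hp hp'
        (continuous_pderiv β hg) (hm β)) (Or.inr hVt)
    have h2 := ENNReal.Tendsto.const_mul (a := C) h1 (Or.inr hC)
    simpa using h2
  have h3 : Filter.Tendsto (fun y => ‖g y‖ₑ) (Filter.cocompact (Rn n)) (nhds 0) :=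
    tendsto_of_tendsto_of_tendsto_of_le_of_le tendsto_const_nhds hlim (fun _ => zero_le) fun y =>
      (h g hg y).trans (by
        gcongr with β
        exact lintegral_closedBall_le_eLpNorm hp y (continuous_pderiv β hg))
  rw [tendsto_zero_iff_norm_tendsto_zero]
  simpa using! (ENNReal.tendsto_toReal ENNReal.zero_ne_top).comp h3

theorem DL.tendsto {p : ℝ≥0∞} (hp : 1 ≤ p) (hp' : p ≠ ⊤) (g : DL n p) (α : Fin n → ℕ) :
    Filter.Tendsto (pderiv α g) (Filter.cocompact (Rn n)) (nhds 0) :=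
  tendsto_cocompact_of_memLp hp hp' (contDiff_pderiv α g.contDiff) fun β => by
    rw [← pderiv_add_index β α g.contDiff]
    exact g.memLp _

/-- `𝒟_{L^p}` is contained in `ℬ̇` if `p < ∞`. -/
noncomputable def DL.toBDot {p : ℝ≥0∞} (hp : 1 ≤ p) (hp' : p ≠ ⊤) (g : DL n p) : BDot n :=
  BDot.mk g g.contDiff (g.tendsto hp hp')

end Sobolev

/-! ### Smoothness, derivatives and decay of correlations. -/

section Correlation

variable {n : ℕ}

/-- The correlation `y ↦ ∫ g(x + y) k(x) dx`. -/
noncomputable def corr (k g : Rn n → ℂ) (y : Rn n) : ℂ := ∫ x, g (x + y) * k x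

/-- On the support of `k`, the translates of each derivative of the smooth function `g` by the
vectors of a bounded set are uniformly bounded. -/
def TranslatesBounded (k g : Rn n → ℂ) : Prop :=
  ∀ (α : Fin n → ℕ) (R : ℝ), ∃ C : ℝ, ∀ x y : Rn n, ‖y‖ ≤ R → k x ≠ 0 → ‖pderiv α g (x + y)‖ ≤ C

theorem TranslatesBounded.pderiv {k g : Rn n → ℂ} (hg : ContDiff ℝ (⊤ : ℕ∞) g)
    (h : TranslatesBounded k g) (β : Fin n → ℕ) : TranslatesBounded k (pderiv β g) := by
  intro α R
  rw [← pderiv_add_index α β hg]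
  exact h _ R

theorem TranslatesBounded.pd {k g : Rn n → ℂ} (hg : ContDiff ℝ (⊤ : ℕ∞) g)
    (h : TranslatesBounded k g) (i : Fin n) : TranslatesBounded k (pd i g) := by
  rw [← pderiv_single i hg]
  exact h.pderiv hg _

/-- The case of ℬ̇, where g is bounded and k is only integrable. -/
theorem translatesBounded_of_bounded (k : Rn n → ℂ) {g : Rn n → ℂ}
    (h : ∀ α, ∃ C : ℝ, ∀ x, ‖pderiv α g x‖ ≤ C) : TranslatesBounded k g := fun α _ =>
  let ⟨C, hC⟩ := h α
  ⟨C, fun _ _ _ _ => hC _⟩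

/-- The case of ℰ, where k has bounded support and g may grow arbitrarily. -/
theorem translatesBounded_of_support {k g : Rn n → ℂ} (hg : ContDiff ℝ (⊤ : ℕ∞) g) {r : ℝ}
    (hk : ∀ x, k x ≠ 0 → ‖x‖ ≤ r) : TranslatesBounded k g := by
  intro α R
  obtain ⟨C, hC⟩ := (isCompact_closedBall (0 : Rn n) (r + R)).exists_bound_of_continuousOn
    (continuous_pderiv α hg).continuousOn
  refine ⟨C, fun x y hy hx => hC _ ?_⟩
  rw [mem_closedBall_zero_iff]
  exact (norm_add_le _ _).trans (add_le_add (hk x hx) hy)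

theorem fderiv_eq_sum_pd (g : Rn n → ℂ) (z : Rn n) :
    fderiv ℝ g z = ∑ i, (EuclideanSpace.proj i : Rn n →L[ℝ] ℝ).smulRight (pd i g z) := by
  ext v
  have hv : v = ∑ i, v i • EuclideanSpace.single i (1 : ℝ) := by
    ext j
    simp [Finset.sum_apply, Pi.single_apply]
  conv_lhs => rw [hv, map_sum]
  simp [pd]

theorem norm_fderiv_le_sum_pd (g : Rn n → ℂ) (z : Rn n) :
    ‖fderiv ℝ g z‖ ≤ ∑ i, ‖pd i g z‖ := by
  refine ContinuousLinearMap.opNorm_le_bound _ (Finset.sum_nonneg fun _ _ => norm_nonneg _)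
    fun v => ?_
  rw [fderiv_eq_sum_pd, sum_apply, Finset.sum_mul]
  refine norm_sum_le_of_le _ fun i _ => ?_
  rw [ContinuousLinearMap.smulRight_apply, norm_smul, mul_comm]
  gcongr
  exact PiLp.norm_apply_le v i

theorem TranslatesBounded.integrable {k g : Rn n → ℂ} (hk : Integrable k)
    (hg : ContDiff ℝ (⊤ : ℕ∞) g) (h : TranslatesBounded k g) (y : Rn n) :
    Integrable fun x => g (x + y) * k x := by
  obtain ⟨C, hC⟩ := h 0 ‖y‖
  rw [pderiv_zero_index hg] at hC
  have hm : AEStronglyMeasurable (fun x => g (x + y) * k x) volume :=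
    (hg.continuous.comp (continuous_id.add continuous_const)).aestronglyMeasurable.mul hk.1
  refine (hk.norm.const_mul C).mono' hm (Filter.Eventually.of_forall fun x => ?_)
  rw [norm_mul]
  by_cases hx : k x = 0
  · simp [hx]
  · gcongr
    exact hC x y le_rfl hx

theorem TranslatesBounded.exists_norm_smul_fderiv_le {k g : Rn n → ℂ}
    (hg : ContDiff ℝ (⊤ : ℕ∞) g) (h : TranslatesBounded k g) (R : ℝ) :
    ∃ C : ℝ, ∀ x z : Rn n, ‖z‖ ≤ R → ‖k x • fderiv ℝ g (x + z)‖ ≤ C * ‖k x‖ := by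
  choose C hC using fun i => h.pd hg i 0 R
  refine ⟨∑ i, C i, fun x z hz => ?_⟩
  rw [norm_smul, mul_comm]
  by_cases hx : k x = 0
  · simp [hx]
  · gcongr
    refine (norm_fderiv_le_sum_pd g _).trans (Finset.sum_le_sum fun i _ => ?_)
    have := hC i x z hz hx
    rwa [pderiv_zero_index (contDiff_pd i hg)] at this

theorem aestronglyMeasurable_smul_fderiv {k g : Rn n → ℂ} (hk : Integrable k)
    (hg : ContDiff ℝ (⊤ : ℕ∞) g) (y : Rn n) :
    AEStronglyMeasurable (fun x => k x • fderiv ℝ g (x + y)) volume :=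
  hk.1.smul ((hg.continuous_fderiv (by simp)).comp
    (continuous_id.add continuous_const)).aestronglyMeasurable

/-- Differentiation under the integral sign; `TranslatesBounded` supplies the dominating multiple of
|k|. -/
theorem hasFDerivAt_corr {k g : Rn n → ℂ} (hk : Integrable k) (hg : ContDiff ℝ (⊤ : ℕ∞) g)
    (h : TranslatesBounded k g) (y : Rn n) :
    HasFDerivAt (corr k g) (∫ x, k x • fderiv ℝ g (x + y)) y := by
  -- The bound must hold on a neighbourhood of y, here the unit ball about y.
  obtain ⟨C, hC⟩ := h.exists_norm_smul_fderiv_le hg (‖y‖ + 1)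
  refine hasFDerivAt_integral_of_dominated_of_fderiv_le (F := fun y x => g (x + y) * k x)
    (F' := fun y x => k x • fderiv ℝ g (x + y)) (bound := fun x => C * ‖k x‖)
    (Metric.ball_mem_nhds y one_pos) ?_ (h.integrable hk hg y)
    (aestronglyMeasurable_smul_fderiv hk hg y) ?_ (hk.norm.const_mul _) ?_
  · exact Filter.Eventually.of_forall fun y => (h.integrable hk hg y).1
  · refine Filter.Eventually.of_forall fun x z hz => hC x z ?_
    have h1 : ‖z - y‖ < 1 := by simpa [dist_eq_norm] using hz
    have h2 := norm_le_norm_add_norm_sub' z y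
    linarith
  · refine Filter.Eventually.of_forall fun x z _ => ?_
    have h1 : HasFDerivAt (fun z => g (x + z)) (fderiv ℝ g (x + z)) z := by
      simpa using! (differentiable_of_smooth hg (x + z)).hasFDerivAt.comp z
        ((hasFDerivAt_id (𝕜 := ℝ) z).const_add x)
    exact h1.mul_const (k x)

theorem pd_corr {k g : Rn n → ℂ} (hk : Integrable k) (hg : ContDiff ℝ (⊤ : ℕ∞) g)
    (h : TranslatesBounded k g) (i : Fin n) : pd i (corr k g) = corr k (pd i g) := by
  funext y
  rw [pd, (hasFDerivAt_corr hk hg h y).fderiv]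
  obtain ⟨C, hC⟩ := h.exists_norm_smul_fderiv_le hg ‖y‖
  have hint : Integrable fun x => k x • fderiv ℝ g (x + y) :=
    (hk.norm.const_mul C).mono' (aestronglyMeasurable_smul_fderiv hk hg y)
      (Filter.Eventually.of_forall fun x => hC x y le_rfl)
  rw [ContinuousLinearMap.integral_apply hint]
  refine integral_congr_ae (Filter.Eventually.of_forall fun x => ?_)
  simp [pd, mul_comm]

/-- Induction on the order with g varying: the partial derivatives are correlations of the same k
with the `pd i g`. -/
theorem contDiff_corr {k g : Rn n → ℂ} (hk : Integrable k) (hg : ContDiff ℝ (⊤ : ℕ∞) g)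
    (h : TranslatesBounded k g) : ContDiff ℝ (⊤ : ℕ∞) (corr k g) := by
  have key : ∀ (m : ℕ) (g : Rn n → ℂ), ContDiff ℝ (⊤ : ℕ∞) g → TranslatesBounded k g →
      ContDiff ℝ m (corr k g) := by
    intro m
    induction m with
    | zero =>
      intro g hg h
      have hd : Differentiable ℝ (corr k g) := fun y => (hasFDerivAt_corr hk hg h y).differentiableAt
      exact_mod_cast contDiff_zero.2 hd.continuous
    | succ m ih =>
      intro g hg h
      have hd : Differentiable ℝ (corr k g) := fun y => (hasFDerivAt_corr hk hg h y).differentiableAt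
      push_cast
      refine contDiff_succ_iff_fderiv.2 ⟨hd, by simp, ?_⟩
      rw [show fderiv ℝ (corr k g) = _ from funext fun y => fderiv_eq_sum_pd (corr k g) y]
      refine ContDiff.sum fun i _ => ?_
      simp only [pd_corr hk hg h]
      exact (ContinuousLinearMap.smulRightL ℝ (Rn n) ℂ (EuclideanSpace.proj i)).contDiff.comp
        (ih _ (contDiff_pd i hg) (h.pd hg i))
  exact contDiff_infty.2 fun m => key m g hg h

theorem pderiv_corr {k g : Rn n → ℂ} (hk : Integrable k) (hg : ContDiff ℝ (⊤ : ℕ∞) g)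
    (h : TranslatesBounded k g) (α : Fin n → ℕ) :
    pderiv α (corr k g) = corr k (pderiv α g) := by
  induction α using multiIndex_induction generalizing g with
  | zero => rw [pderiv_zero_index hg, pderiv_zero_index (contDiff_corr hk hg h)]
  | step α i ih =>
    rw [pderiv_add_single _ _ hg, pderiv_add_single _ _ (contDiff_corr hk hg h),
      pd_corr hk hg h, ih (contDiff_pd i hg) (h.pd hg i)]

theorem exists_bound_of_tendsto {g : Rn n → ℂ} (hg : Continuous g)
    (h : Filter.Tendsto g (Filter.cocompact (Rn n)) (nhds 0)) : ∃ C, ∀ x, ‖g x‖ ≤ C := by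
  obtain ⟨C, hC⟩ := (ZeroAtInftyContinuousMap.isBounded_range
    (⟨⟨g, hg⟩, h⟩ : ZeroAtInftyContinuousMap (Rn n) ℂ)).exists_norm_le
  exact ⟨C, fun x => hC _ ⟨x, rfl⟩⟩

theorem tendsto_corr {k g : Rn n → ℂ} (hk : Integrable k) (hg : Continuous g)
    (h : Filter.Tendsto g (Filter.cocompact (Rn n)) (nhds 0)) :
    Filter.Tendsto (corr k g) (Filter.cocompact (Rn n)) (nhds 0) := by
  obtain ⟨C, hC⟩ := exists_bound_of_tendsto hg h
  have key : Filter.Tendsto (corr k g) (Filter.cocompact (Rn n)) (nhds (∫ _ : Rn n, 0)) := by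
    refine tendsto_integral_filter_of_dominated_convergence (fun x => C * ‖k x‖) ?_ ?_
      (hk.norm.const_mul C) ?_
    · exact Filter.Eventually.of_forall fun y =>
        (hg.comp (continuous_id.add continuous_const)).aestronglyMeasurable.mul hk.1
    · refine Filter.Eventually.of_forall fun y => Filter.Eventually.of_forall fun x => ?_
      rw [norm_mul]
      gcongr
      exact hC _
    · refine Filter.Eventually.of_forall fun x => ?_
      have h1 : Filter.Tendsto (fun y => g (x + y)) (Filter.cocompact (Rn n)) (nhds 0) :=
        h.comp (Homeomorph.addLeft x).isClosedEmbedding.tendsto_cocompact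
      simpa using h1.mul_const (k x)
  simpa using key

theorem corr_comp_add (k g : Rn n → ℂ) (y : Rn n) :
    corr k (fun x => g (x + y)) = fun z => corr k g (z + y) := by
  funext z
  simp only [corr, add_assoc]

end Correlation

/-! ### Young's inequality. -/

section Young

variable {n : ℕ}

/-- The shear (x, y) ↦ (x, x + y) preserves the product measure. Hence f(x + y) is a.e. measurable
in both variables even when f is measurable only up to null sets. -/
theorem quasiMeasurePreserving_add :
    Measure.QuasiMeasurePreserving (fun z : Rn n × Rn n => z.1 + z.2) (volume.prod volume) volume :=
  Measure.quasiMeasurePreserving_snd.comp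
    (measurePreserving_prod_add (volume : Measure (Rn n)) volume).quasiMeasurePreserving

/-- Hölder's inequality for the splitting vu = (v^p u)^{1/p} · u^{1 − 1/p}, then Tonelli's theorem
and translation invariance. -/
theorem lintegral_young {u v : Rn n → ℝ≥0∞} (hu : AEMeasurable u) (hv : AEMeasurable v) {p : ℝ}
    (hp : 1 ≤ p) :
    ∫⁻ y, (∫⁻ x, v (x + y) * u x) ^ p ≤ (∫⁻ x, u x) ^ p * ∫⁻ x, v x ^ p := by
  have hp0 : 0 < p := by linarith
  have hvy : ∀ y, AEMeasurable (fun x => v (x + y)) volume := fun y =>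
    hv.comp_quasiMeasurePreserving (measurePreserving_add_right volume y).quasiMeasurePreserving
  have hvx : ∀ x, AEMeasurable (fun y => v (x + y)) volume := fun x =>
    hv.comp_quasiMeasurePreserving (measurePreserving_add_left volume x).quasiMeasurePreserving
  have h1 : ∀ y, (∫⁻ x, v (x + y) * u x) ^ p ≤
      (∫⁻ x, u x) ^ (p - 1) * ∫⁻ x, v (x + y) ^ p * u x := by
    intro y
    -- The weighted form with exponents 1/p and 1 − 1/p also covers p = 1.
    have h2 := ENNReal.lintegral_mul_norm_pow_le (μ := (volume : Measure (Rn n)))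
      (f := fun x => v (x + y) ^ p * u x) (g := u)
      (((hvy y).pow_const p).mul hu) hu (p := p⁻¹) (q := 1 - p⁻¹) (by positivity)
      (by rw [sub_nonneg]; exact inv_le_one_of_one_le₀ hp) (by ring)
    have h3 : ∀ x, (v (x + y) ^ p * u x) ^ p⁻¹ * u x ^ (1 - p⁻¹) = v (x + y) * u x := by
      intro x
      rw [ENNReal.mul_rpow_of_nonneg _ _ (by positivity), ← ENNReal.rpow_mul,
        mul_inv_cancel₀ hp0.ne', ENNReal.rpow_one, mul_assoc,
        ← ENNReal.rpow_add_of_nonneg _ _ (by positivity)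
          (by rw [sub_nonneg]; exact inv_le_one_of_one_le₀ hp)]
      simp
    simp only [h3] at h2
    refine (ENNReal.rpow_le_rpow h2 hp0.le).trans (le_of_eq ?_)
    rw [ENNReal.mul_rpow_of_nonneg _ _ hp0.le, ← ENNReal.rpow_mul, ← ENNReal.rpow_mul,
      inv_mul_cancel₀ hp0.ne', ENNReal.rpow_one, mul_comm]
    congr 2
    field_simp
  have hmeas : AEMeasurable (fun z : Rn n × Rn n => v (z.2 + z.1) ^ p * u z.2)
      (volume.prod volume) := by
    refine AEMeasurable.mul (AEMeasurable.pow_const ?_ p)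
      (hu.comp_quasiMeasurePreserving Measure.quasiMeasurePreserving_snd)
    simp only [add_comm]
    exact hv.comp_quasiMeasurePreserving quasiMeasurePreserving_add
  calc ∫⁻ y, (∫⁻ x, v (x + y) * u x) ^ p
      ≤ ∫⁻ y, (∫⁻ x, u x) ^ (p - 1) * ∫⁻ x, v (x + y) ^ p * u x := lintegral_mono h1
    _ = (∫⁻ x, u x) ^ (p - 1) * ∫⁻ y, ∫⁻ x, v (x + y) ^ p * u x := by
        rw [lintegral_const_mul'' _ hmeas.lintegral_prod_right']
    _ = (∫⁻ x, u x) ^ (p - 1) * ∫⁻ x, ∫⁻ y, v (x + y) ^ p * u x := by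
        rw [lintegral_lintegral_swap (f := fun y x => v (x + y) ^ p * u x) hmeas]
    _ = (∫⁻ x, u x) ^ (p - 1) * ∫⁻ x, (∫⁻ y, v y ^ p) * u x := by
        congr 1
        refine lintegral_congr fun x => ?_
        rw [lintegral_mul_const'' _ ((hvx x).pow_const p),
          lintegral_add_left_eq_self (fun y => v y ^ p) x]
    _ = (∫⁻ x, u x) ^ (p - 1) * (∫⁻ x, u x) ^ (1 : ℝ) * ∫⁻ x, v x ^ p := by
        rw [lintegral_const_mul'' _ hu, ENNReal.rpow_one, mul_comm (∫⁻ y, v y ^ p), mul_assoc]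
    _ = _ := by
        rw [← ENNReal.rpow_add_of_nonneg _ _ (by linarith) zero_le_one]
        simp

theorem enorm_corr_le (k f : Rn n → ℂ) (y : Rn n) :
    ‖corr k f y‖ₑ ≤ ∫⁻ x, ‖f (x + y)‖ₑ * ‖k x‖ₑ := by
  refine (enorm_integral_le_lintegral_enorm _).trans (le_of_eq ?_)
  simp only [enorm_mul]

theorem aestronglyMeasurable_comp_add {f : Rn n → ℂ} (hf : AEStronglyMeasurable f volume) :
    AEStronglyMeasurable (fun z : Rn n × Rn n => f (z.1 + z.2)) (volume.prod volume) :=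
  hf.comp_quasiMeasurePreserving quasiMeasurePreserving_add

theorem aestronglyMeasurable_corr {k f : Rn n → ℂ} (hk : AEStronglyMeasurable k volume)
    (hf : AEStronglyMeasurable f volume) : AEStronglyMeasurable (corr k f) volume := by
  have : AEStronglyMeasurable (fun z : Rn n × Rn n => f (z.2 + z.1) * k z.2)
      (volume.prod volume) := by
    simp only [add_comm]
    exact (aestronglyMeasurable_comp_add hf).mul hk.comp_snd
  exact this.integral_prod_right'

/-- **Young's inequality** for the convolution of an integrable and an `L^p` function. -/
theorem eLpNorm_corr_le {p : ℝ≥0∞} (hp : 1 ≤ p) {k f : Rn n → ℂ}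
    (hk : AEStronglyMeasurable k volume) (hf : AEStronglyMeasurable f volume) :
    eLpNorm (corr k f) p volume ≤ (∫⁻ x, ‖k x‖ₑ) * eLpNorm f p volume := by
  by_cases hpt : p = ⊤
  · subst hpt
    refine eLpNormEssSup_le_of_ae_enorm_bound (Filter.Eventually.of_forall fun y => ?_)
    refine (enorm_corr_le k f y).trans ?_
    rw [mul_comm, ← lintegral_const_mul'' _ hk.enorm]
    refine lintegral_mono_ae ?_
    have := (measurePreserving_add_right volume y).quasiMeasurePreserving.ae
      (ae_le_eLpNormEssSup (f := f) (μ := (volume : Measure (Rn n))))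
    filter_upwards [this] with x hx
    gcongr
    exact hx
  · have hp0 : p ≠ 0 := (zero_lt_one.trans_le hp).ne'
    have h1 : 1 ≤ p.toReal := by simpa using ENNReal.toReal_mono hpt hp
    have hpos : 0 < p.toReal := by linarith
    rw [eLpNorm_eq_lintegral_rpow_enorm_toReal hp0 hpt,
      eLpNorm_eq_lintegral_rpow_enorm_toReal hp0 hpt]
    calc (∫⁻ y, ‖corr k f y‖ₑ ^ p.toReal) ^ (1 / p.toReal)
        ≤ ((∫⁻ x, ‖k x‖ₑ) ^ p.toReal * ∫⁻ x, ‖f x‖ₑ ^ p.toReal) ^ (1 / p.toReal) := by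
          gcongr
          refine (lintegral_mono fun y => ?_).trans (lintegral_young hk.enorm hf.enorm h1)
          gcongr
          exact enorm_corr_le k f y
      _ = _ := by
          rw [ENNReal.mul_rpow_of_nonneg _ _ (by positivity), ← ENNReal.rpow_mul,
            mul_one_div_cancel hpos.ne', ENNReal.rpow_one]

theorem memLp_corr {p : ℝ≥0∞} (hp : 1 ≤ p) {k f : Rn n → ℂ} (hk : Integrable k)
    (hf : MemLp f p volume) : MemLp (corr k f) p volume :=
  ⟨aestronglyMeasurable_corr hk.1 hf.1, (eLpNorm_corr_le hp hk.1 hf.1).trans_lt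
    (ENNReal.mul_lt_top hk.2 hf.2)⟩

end Young

/-! ### Transposing correlations by Fubini's theorem. -/

section Fubini

variable {n : ℕ} {p q : ℝ≥0∞}

theorem lintegral_enorm_mul_le [p.HolderConjugate q] {a b : Rn n → ℂ}
    (ha : AEStronglyMeasurable a volume) (hb : AEStronglyMeasurable b volume) :
    ∫⁻ x, ‖a x‖ₑ * ‖b x‖ₑ ≤ eLpNorm a p volume * eLpNorm b q volume := by
  have := eLpNorm_smul_le_mul_eLpNorm (p := p) (q := q) (r := 1) hb ha
  rw [eLpNorm_one_eq_lintegral_enorm] at this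
  simpa [enorm_mul] using this

theorem norm_integral_mul_le [p.HolderConjugate q] {a b : Rn n → ℂ} (ha : MemLp a p volume)
    (hb : MemLp b q volume) : ‖∫ x, a x * b x‖ ≤
      (eLpNorm a p volume).toReal * (eLpNorm b q volume).toReal := by
  rw [← ENNReal.toReal_mul, ← toReal_enorm]
  refine ENNReal.toReal_mono (ENNReal.mul_ne_top ha.eLpNorm_ne_top hb.eLpNorm_ne_top) ?_
  refine (enorm_integral_le_lintegral_enorm _).trans ?_
  simp only [enorm_mul]
  exact lintegral_enorm_mul_le ha.1 hb.1

theorem eLpNorm_comp_add_right {f : Rn n → ℂ} (hf : AEStronglyMeasurable f volume) (y : Rn n) :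
    eLpNorm (fun x => f (x + y)) p volume = eLpNorm f p volume :=
  eLpNorm_comp_measurePreserving hf (measurePreserving_add_right volume y)

theorem memLp_comp_add_right {f : Rn n → ℂ} (hf : MemLp f p volume) (y : Rn n) :
    MemLp (fun x => f (x + y)) p volume :=
  hf.comp_measurePreserving (measurePreserving_add_right volume y)

/-- For fixed x, Hölder's inequality in y gives at most |k(x)| ‖G‖_p ‖f‖_q, the translate of G
having the same norm; this is integrable in x. All later exchanges of integrals rest on it. -/
theorem integrable_triple [p.HolderConjugate q] {G k f : Rn n → ℂ} (hG : MemLp G p volume)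
    (hk : Integrable k) (hf : MemLp f q volume) :
    Integrable (fun z : Rn n × Rn n => G (z.1 + z.2) * k z.1 * f z.2) (volume.prod volume) := by
  have hm : AEStronglyMeasurable (fun z : Rn n × Rn n => G (z.1 + z.2) * k z.1 * f z.2)
      (volume.prod volume) :=
    ((aestronglyMeasurable_comp_add hG.1).mul hk.1.comp_fst).mul hf.1.comp_snd
  refine ⟨hm, ?_⟩
  rw [HasFiniteIntegral, lintegral_prod _ hm.enorm]
  have h1 : ∀ x, ∫⁻ y, ‖G (x + y) * k x * f y‖ₑ ≤
      ‖k x‖ₑ * (eLpNorm G p volume * eLpNorm f q volume) := by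
    intro x
    have h2 : AEStronglyMeasurable (fun y => G (y + x)) volume :=
      (memLp_comp_add_right hG x).1
    have h3 : ∫⁻ y, ‖G (x + y) * k x * f y‖ₑ = ∫⁻ y, ‖k x‖ₑ * (‖G (y + x)‖ₑ * ‖f y‖ₑ) := by
      refine lintegral_congr fun y => ?_
      rw [enorm_mul, enorm_mul, add_comm x y]
      ring
    have h4 : AEMeasurable (fun y => ‖G (y + x)‖ₑ * ‖f y‖ₑ) volume := h2.enorm.mul hf.1.enorm
    rw [h3, lintegral_const_mul'' _ h4]
    gcongr
    rw [← eLpNorm_comp_add_right hG.1 x]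
    exact lintegral_enorm_mul_le h2 hf.1
  refine (lintegral_mono h1).trans_lt ?_
  rw [lintegral_mul_const'' _ hk.1.enorm]
  exact ENNReal.mul_lt_top hk.2 (ENNReal.mul_lt_top hG.2 hf.2)

theorem integral_corr_mul_eq [p.HolderConjugate q] {G k f : Rn n → ℂ} (hG : MemLp G p volume)
    (hk : Integrable k) (hf : MemLp f q volume) :
    ∫ y, corr k G y * f y = ∫ x, ∫ y, G (x + y) * k x * f y := by
  rw [integral_integral_swap (integrable_triple hG hk hf)]
  simp only [corr, integral_mul_const]

/-- The roles of `k` and `f` in `∫∫ G(x + y) k(x) f(y) dx dy` can be exchanged. -/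
theorem integral_corr_mul_comm [p.HolderConjugate q] {G k f : Rn n → ℂ} (hG : MemLp G p volume)
    (hk : Integrable k) (hf : MemLp f q volume) :
    ∫ y, corr k G y * f y = ∫ x, corr f G x * k x := by
  rw [integral_corr_mul_eq hG hk hf]
  refine integral_congr_ae (Filter.Eventually.of_forall fun x => ?_)
  simp only [corr]
  rw [← integral_mul_const]
  refine integral_congr_ae (Filter.Eventually.of_forall fun y => ?_)
  simp only [add_comm x y]
  ring

/-- The adjoint of the correlation with `k` is the correlation with `x ↦ k(-x)`. -/
theorem integral_corr_mul [p.HolderConjugate q] {G k f : Rn n → ℂ} (hG : MemLp G p volume)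
    (hk : Integrable k) (hf : MemLp f q volume) :
    ∫ y, corr k G y * f y = ∫ w, G w * corr (fun x => k (-x)) f w := by
  have hk' : Integrable fun x => k (-x) := hk.comp_neg
  have : q.HolderConjugate p := ENNReal.HolderConjugate.symm
  rw [integral_corr_mul_eq hG hk hf, ← integral_neg_eq_self]
  -- After x ↦ −x, the substitution y = x + w moves the shift from G to f.
  have h1 : ∀ x, ∫ y, G (-x + y) * k (-x) * f y = ∫ w, f (x + w) * k (-x) * G w := by
    intro x
    rw [← integral_add_left_eq_self _ x]
    refine integral_congr_ae (Filter.Eventually.of_forall fun w => ?_)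
    simp only [neg_add_cancel_left]
    ring
  simp only [h1]
  rw [← integral_corr_mul_eq hf hk' hG]
  simp only [mul_comm]

theorem memLp_top_of_continuous {b : Rn n → ℂ} (hb : Continuous b) {C : ℝ} (hC : ∀ x, ‖b x‖ ≤ C) :
    MemLp b ⊤ volume :=
  memLp_top_of_bound hb.aestronglyMeasurable C (Filter.Eventually.of_forall hC)

/-- The exchange of `k` and `f` in the double integral, applied to the translate b(· + y) with
exponents ∞ and 1. -/
theorem corr_corr_comm {a k b : Rn n → ℂ} (ha : Integrable a) (hk : Integrable k)
    (hb : Continuous b) {C : ℝ} (hC : ∀ x, ‖b x‖ ≤ C) :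
    corr a (corr k b) = corr k (corr a b) := by
  funext y
  have hby : MemLp (fun x => b (x + y)) ⊤ volume :=
    memLp_top_of_continuous (hb.comp (continuous_id.add continuous_const)) fun x => hC _
  have h := integral_corr_mul_comm (q := 1) hby hk (memLp_one_iff_integrable.2 ha)
  simp only [corr_comp_add] at h
  exact h

end Fubini

/-! ### The L^p norm by duality. -/

section Duality

variable {n : ℕ} {p q : ℝ≥0∞}

/-- Test against the extremal function conj(h)/|h| · |h|^{r−1}, where r = p. Cutting it off to a
ball makes it bounded with compact support, so it is an admissible test function before h is known
to be in L^p. The factor J^{1/r−1} brings its L^q norm to at most 1 and its pairing with h to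
J^{1/r}. -/
theorem eLpNorm_restrict_le_of_forall_integral [p.HolderConjugate q] (hpt : p ≠ ⊤)
    {h : Rn n → ℂ} (hh : Continuous h) {c : ℝ} (R : ℝ)
    (hc : ∀ ψ : Rn n → ℂ, Integrable ψ → MemLp ψ q volume → eLpNorm ψ q volume ≤ 1 →
      ‖∫ x, h x * ψ x‖ ≤ c) :
    eLpNorm h p (volume.restrict (Metric.closedBall 0 R)) ≤ ENNReal.ofReal c := by
  have hp1 : 1 ≤ p := ENNReal.HolderConjugate.one_le p q
  have hp0 : p ≠ 0 := (zero_lt_one.trans_le hp1).ne'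
  set r : ℝ := p.toReal with hr
  have hr1 : 1 ≤ r := by simpa using ENNReal.toReal_mono hpt hp1
  have hr0 : 0 < r := by linarith
  set B : Set (Rn n) := Metric.closedBall 0 R
  have hBm : MeasurableSet B := Metric.isClosed_closedBall.measurableSet
  have hBfin : volume B < ⊤ := measure_closedBall_lt_top
  obtain ⟨M, hM⟩ := (isCompact_closedBall (0 : Rn n) R).exists_bound_of_continuousOn hh.continuousOn
  set J : ℝ := ∫ x in B, ‖h x‖ ^ r with hJ
  have hcr : Continuous fun x => ‖h x‖ ^ r := hh.norm.rpow_const fun _ => Or.inr hr0.le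
  have hint : IntegrableOn (fun x => ‖h x‖ ^ r) B :=
    hcr.continuousOn.integrableOn_compact (isCompact_closedBall (0 : Rn n) R)
  have hJ0 : 0 ≤ J := integral_nonneg fun x => Real.rpow_nonneg (norm_nonneg _) _
  have hnorm : eLpNorm h p (volume.restrict B) = ENNReal.ofReal (J ^ (1 / r)) := by
    rw [eLpNorm_eq_lintegral_rpow_enorm_toReal hp0 hpt, ← hr,
      ← ENNReal.ofReal_rpow_of_nonneg hJ0 (by positivity), hJ,
      ofReal_integral_eq_lintegral_ofReal hint
        (Filter.Eventually.of_forall fun x => Real.rpow_nonneg (norm_nonneg _) _)]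
    congr 1
    refine lintegral_congr fun x => ?_
    rw [← ENNReal.ofReal_rpow_of_nonneg (norm_nonneg _) hr0.le, ofReal_norm]
  rw [hnorm]
  refine ENNReal.ofReal_le_ofReal ?_
  rcases hJ0.eq_or_lt with hJ0' | hJpos
  -- Only c ≥ 0 is needed here; it follows by testing with ψ = 0.
  · rw [← hJ0', Real.zero_rpow (by positivity)]
    have := hc 0 (integrable_zero _ _ _) MemLp.zero (by simp)
    exact (norm_nonneg _).trans this
  -- the normalized extremal function
  set s : ℝ := J ^ (1 / r - 1) with hs
  have hspos : 0 < s := Real.rpow_pos_of_pos hJpos _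
  set ψ : Rn n → ℂ := B.indicator fun x =>
    (s : ℂ) * ((starRingEnd ℂ (h x) / ‖h x‖) * ((‖h x‖ ^ (r - 1) : ℝ) : ℂ)) with hψ
  have hψm : Measurable ψ := by
    refine Measurable.indicator ?_ hBm
    have h1 : Measurable h := hh.measurable
    have h2 : Measurable fun x => starRingEnd ℂ (h x) :=
      (Complex.continuous_conj.comp hh).measurable
    have h3 : Measurable fun x => ((‖h x‖ ^ (r - 1) : ℝ) : ℂ) :=
      Complex.continuous_ofReal.measurable.comp (h1.norm.pow_const _)
    have h4 : Measurable fun x => ((‖h x‖ : ℝ) : ℂ) :=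
      Complex.continuous_ofReal.measurable.comp h1.norm
    exact (h2.div h4 |>.mul h3).const_mul _
  have hψle : ∀ x, ‖ψ x‖ ≤ B.indicator (fun x => s * ‖h x‖ ^ (r - 1)) x := by
    intro x
    by_cases hx : x ∈ B
    · rw [hψ, Set.indicator_of_mem hx, Set.indicator_of_mem hx, norm_mul, norm_mul,
        Complex.norm_of_nonneg hspos.le,
        Complex.norm_of_nonneg (Real.rpow_nonneg (norm_nonneg _) _)]
      refine mul_le_mul_of_nonneg_left ?_ hspos.le
      refine mul_le_of_le_one_left (Real.rpow_nonneg (norm_nonneg _) _) ?_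
      rw [norm_div, RCLike.norm_conj, Complex.norm_of_nonneg (norm_nonneg _)]
      -- An inequality only, since the quotient is 0 at the zeros of h.
      exact div_self_le_one _
    · rw [hψ, Set.indicator_of_notMem hx, Set.indicator_of_notMem hx, norm_zero]
  have hψb : ∀ x, ‖ψ x‖ ≤ B.indicator (fun _ => s * M ^ (r - 1)) x := by
    intro x
    refine (hψle x).trans ?_
    by_cases hx : x ∈ B
    · rw [Set.indicator_of_mem hx, Set.indicator_of_mem hx]
      exact mul_le_mul_of_nonneg_left
        (Real.rpow_le_rpow (norm_nonneg _) (hM x hx) (by linarith)) hspos.le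
    · rw [Set.indicator_of_notMem hx, Set.indicator_of_notMem hx]
  have hψall : ∀ t : ℝ≥0∞, MemLp ψ t volume := fun t =>
    (memLp_indicator_const t hBm (s * M ^ (r - 1)) (Or.inr hBfin.ne)).mono
      hψm.aestronglyMeasurable (Filter.Eventually.of_forall fun x => (hψb x).trans (le_abs_self _))
  have hψq : eLpNorm ψ q volume ≤ 1 := by
    by_cases hqt : q = ⊤
    -- If q = ∞, then r = 1 and both powers in ψ have exponent 0, so |ψ| ≤ 1.
    · have hp1' : r = 1 := by
        have h1 := ENNReal.HolderConjugate.inv_add_inv_eq_one p q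
        rw [hqt, ENNReal.inv_top, add_zero, ENNReal.inv_eq_one] at h1
        rw [hr, h1, ENNReal.toReal_one]
      rw [hqt, ← ENNReal.ofReal_one]
      refine eLpNorm_top_le_of_norm_le fun x => (hψle x).trans ?_
      by_cases hx : x ∈ B
      · rw [Set.indicator_of_mem hx, hs, hp1']
        simp
      · rw [Set.indicator_of_notMem hx]
        exact zero_le_one
    · have hconj : r.HolderConjugate q.toReal := ENNReal.HolderConjugate.toReal_of_ne_top hpt hqt
      have hq0 : q ≠ 0 := by
        rintro rfl
        exact hconj.symm.ne_zero (by simp)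
      have hqpos : 0 < q.toReal := hconj.symm.pos
      have hpt' : ∀ x, ‖ψ x‖ₑ ^ q.toReal ≤
          B.indicator (fun x => ENNReal.ofReal (J⁻¹ * ‖h x‖ ^ r)) x := by
        intro x
        rw [← ofReal_norm]
        refine (ENNReal.rpow_le_rpow (ENNReal.ofReal_le_ofReal (hψle x)) hqpos.le).trans ?_
        by_cases hx : x ∈ B
        · rw [Set.indicator_of_mem hx, Set.indicator_of_mem hx,
            ENNReal.ofReal_rpow_of_nonneg (by positivity) hqpos.le,
            Real.mul_rpow hspos.le (by positivity), hs, ← Real.rpow_mul hJ0,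
            ← Real.rpow_mul (norm_nonneg _), hconj.sub_one_mul_conj]
          have : (1 / r - 1) * q.toReal = -1 := by
            have := hconj.sub_one_mul_conj
            field_simp
            linarith
          rw [this, Real.rpow_neg_one]
        · rw [Set.indicator_of_notMem hx, Set.indicator_of_notMem hx]
          simp [hqpos]
      rw [eLpNorm_eq_lintegral_rpow_enorm_toReal hq0 hqt]
      refine ENNReal.rpow_le_one ?_ (by positivity)
      refine (lintegral_mono hpt').trans ?_
      rw [lintegral_indicator hBm, ← ofReal_integral_eq_lintegral_ofReal (hint.const_mul _)
        (Filter.Eventually.of_forall fun x => by positivity), integral_const_mul, ← hJ,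
        inv_mul_cancel₀ hJpos.ne', ENNReal.ofReal_one]
  have hfin := hc ψ (memLp_one_iff_integrable.1 (hψall 1)) (hψall q) hψq
  have hval : ∫ x, h x * ψ x = ((J ^ (1 / r) : ℝ) : ℂ) := by
    have h1 : (fun x => h x * ψ x) = B.indicator fun x => ((s * ‖h x‖ ^ r : ℝ) : ℂ) := by
      funext x
      by_cases hx : x ∈ B
      · rw [hψ, Set.indicator_of_mem hx, Set.indicator_of_mem hx]
        by_cases h0 : h x = 0
        · simp [h0, hr0.ne']
        · have h2 : (‖h x‖ : ℂ) ≠ 0 := by simpa using h0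
          have h3 : h x * starRingEnd ℂ (h x) = (‖h x‖ : ℂ) ^ 2 := by
            rw [Complex.mul_conj, Complex.normSq_eq_norm_sq]
            push_cast
            ring
          have h4 : ‖h x‖ ^ r = ‖h x‖ * ‖h x‖ ^ (r - 1) := by
            rw [Real.rpow_sub_one (by simpa using h0)]
            field_simp
          rw [h4]
          push_cast
          field_simp
          linear_combination (s * ((‖h x‖ ^ (r - 1) : ℝ) : ℂ)) * h3
      · rw [hψ, Set.indicator_of_notMem hx, Set.indicator_of_notMem hx, mul_zero]
    rw [h1, integral_indicator hBm, integral_complex_ofReal, integral_const_mul, ← hJ, hs,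
      ← Real.rpow_add_one hJpos.ne']
    congr 2
    ring
  rw [hval, Complex.norm_of_nonneg (by positivity)] at hfin
  exact hfin

/-- The `L^p` norm of a continuous function is at most `c` if its pairings with the integrable
functions of `L^q` norm at most `1` are. -/
theorem eLpNorm_le_of_forall_integral [p.HolderConjugate q] (hpt : p ≠ ⊤)
    {h : Rn n → ℂ} (hh : Continuous h) {c : ℝ}
    (hc : ∀ ψ : Rn n → ℂ, Integrable ψ → MemLp ψ q volume → eLpNorm ψ q volume ≤ 1 →
      ‖∫ x, h x * ψ x‖ ≤ c) :
    eLpNorm h p volume ≤ ENNReal.ofReal c := by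
  have hp1 : 1 ≤ p := ENNReal.HolderConjugate.one_le p q
  have hp0 : p ≠ 0 := (zero_lt_one.trans_le hp1).ne'
  have hr0 : 0 < p.toReal := ENNReal.toReal_pos hp0 hpt
  have hU : ⋃ N : ℕ, Metric.closedBall (0 : Rn n) N = Set.univ := Metric.iUnion_closedBall_nat 0
  -- The bound on balls does not depend on the radius, so it passes to the supremum over an
  -- exhaustion.
  rw [eLpNorm_eq_lintegral_rpow_enorm_toReal hp0 hpt, ← setLIntegral_univ, ← hU,
    setLIntegral_iUnion_of_directed]
  · rw [one_div, ENNReal.rpow_inv_le_iff hr0]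
    refine iSup_le fun N => ?_
    have := eLpNorm_restrict_le_of_forall_integral hpt hh N hc
    rwa [eLpNorm_eq_lintegral_rpow_enorm_toReal hp0 hpt, one_div, ENNReal.rpow_inv_le_iff hr0]
      at this
  · exact directed_of_isDirected_le fun a b hab =>
      Metric.closedBall_subset_closedBall (by exact_mod_cast hab)

end Duality

/-! ### Sums of derivatives and their transfer operators. -/

section Representation

variable {n : ℕ} {p q : ℝ≥0∞}

/-- The pairing of `g` with the distribution `∑_{|α| ≤ m} ∂^α f_α`. -/
noncomputable def rep (m : ℕ) (f : (Fin n → ℕ) → Rn n → ℂ) (g : Rn n → ℂ) : ℂ :=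
  ∑ α ∈ multiIdx n m, (-1) ^ (∑ i, α i) * ∫ x, pderiv α g x * f α x

/-- The function whose value at `y` is the pairing of the translate `g(· + y)` with
`∑_{|α| ≤ m} ∂^α f_α`. -/
noncomputable def repCorr (m : ℕ) (f : (Fin n → ℕ) → Rn n → ℂ) (g : Rn n → ℂ) (y : Rn n) : ℂ :=
  rep m f fun x => g (x + y)

theorem repCorr_eq (m : ℕ) (f : (Fin n → ℕ) → Rn n → ℂ) (g : Rn n → ℂ) :
    repCorr m f g =
      ∑ α ∈ multiIdx n m, ((-1) ^ (∑ i, α i) : ℂ) • corr (f α) (pderiv α g) := by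
  funext y
  simp only [repCorr, rep, pderiv_comp_add, Finset.sum_apply, Pi.smul_apply, smul_eq_mul, corr]

theorem contDiff_sum_smul {ι : Type*} (s : Finset ι) (c : ι → ℂ) {h : ι → Rn n → ℂ}
    (hh : ∀ i, ContDiff ℝ (⊤ : ℕ∞) (h i)) : ContDiff ℝ (⊤ : ℕ∞) (∑ i ∈ s, c i • h i) := by
  classical
  induction s using Finset.induction_on with
  | empty => simpa using! (contDiff_zero_fun : ContDiff ℝ (⊤ : ℕ∞) (0 : Rn n → ℂ))
  | insert i s hi ih =>
    rw [Finset.sum_insert hi]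
    exact ContDiff.add (contDiff_const.smul (hh i)) ih

theorem pderiv_sum_smul {ι : Type*} (s : Finset ι) (c : ι → ℂ) {h : ι → Rn n → ℂ}
    (hh : ∀ i, ContDiff ℝ (⊤ : ℕ∞) (h i)) (β : Fin n → ℕ) :
    pderiv β (∑ i ∈ s, c i • h i) = ∑ i ∈ s, c i • pderiv β (h i) := by
  classical
  induction s using Finset.induction_on with
  | empty => simp [pderiv_zero]
  | insert i s hi ih =>
    rw [Finset.sum_insert hi, Finset.sum_insert hi,
      pderiv_add β (f := c i • h i) (contDiff_const.smul (hh i)) (contDiff_sum_smul s c hh),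
      pderiv_smul β _ (hh i), ih]

section

variable {m : ℕ} {f : (Fin n → ℕ) → Rn n → ℂ} {g : Rn n → ℂ}

theorem contDiff_repCorr (hf : ∀ α, Integrable (f α)) (hg : ContDiff ℝ (⊤ : ℕ∞) g)
    (h : ∀ α, TranslatesBounded (f α) g) : ContDiff ℝ (⊤ : ℕ∞) (repCorr m f g) := by
  rw [repCorr_eq]
  exact contDiff_sum_smul _ _ fun α =>
    contDiff_corr (hf α) (contDiff_pderiv α hg) ((h α).pderiv hg α)

/-- Differentiation passes under each correlation and commutes with ∂^α there. -/
theorem pderiv_repCorr (hf : ∀ α, Integrable (f α)) (hg : ContDiff ℝ (⊤ : ℕ∞) g)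
    (h : ∀ α, TranslatesBounded (f α) g) (β : Fin n → ℕ) :
    pderiv β (repCorr m f g) = repCorr m f (pderiv β g) := by
  rw [repCorr_eq, repCorr_eq, pderiv_sum_smul _ _ fun α =>
    contDiff_corr (hf α) (contDiff_pderiv α hg) ((h α).pderiv hg α)]
  refine Finset.sum_congr rfl fun α _ => ?_
  rw [pderiv_corr (hf α) (contDiff_pderiv α hg) ((h α).pderiv hg α), ← pderiv_add_index _ _ hg,
    ← pderiv_add_index _ _ hg, add_comm]

theorem memLp_repCorr (hp : 1 ≤ p) (hf : ∀ α, Integrable (f α))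
    (hg : ∀ α, MemLp (pderiv α g) p volume) : MemLp (repCorr m f g) p volume := by
  rw [repCorr_eq]
  exact memLp_finsetSum' _ fun α _ => (memLp_corr hp (hf α) (hg α)).const_smul _

theorem tendsto_repCorr (hf : ∀ α, Integrable (f α)) (hg : ContDiff ℝ (⊤ : ℕ∞) g)
    (h : ∀ α, Filter.Tendsto (pderiv α g) (Filter.cocompact (Rn n)) (nhds 0)) :
    Filter.Tendsto (repCorr m f g) (Filter.cocompact (Rn n)) (nhds 0) := by
  rw [repCorr_eq]
  have := tendsto_finsetSum (multiIdx n m) fun α _ =>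
    (tendsto_corr (hf α) (continuous_pderiv α hg) (h α)).const_smul ((-1 : ℂ) ^ (∑ i, α i))
  simpa only [smul_zero, Finset.sum_const_zero, ← Finset.sum_fn] using! this

/-- Pairing with `∑ ∂^α f_α` commutes with averaging over the translates. -/
theorem integral_repCorr_mul (hf : ∀ α, Integrable (f α)) (hg : ContDiff ℝ (⊤ : ℕ∞) g)
    (hb : ∀ α, MemLp (pderiv α g) ⊤ volume) {ψ : Rn n → ℂ} (hψ : Integrable ψ)
    (h : TranslatesBounded ψ g) :
    ∫ y, repCorr m f g y * ψ y = rep m f (corr ψ g) := by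
  rw [repCorr_eq, rep]
  simp only [Finset.sum_apply, Pi.smul_apply, smul_eq_mul, Finset.sum_mul]
  have h1 : ∀ α, Integrable fun y => corr (f α) (pderiv α g) y * ψ y := fun α =>
    memLp_one_iff_integrable.1 <| (memLp_one_iff_integrable.2 hψ).mul
      (memLp_corr le_top (hf α) (hb α))
  rw [integral_finsetSum _ fun α _ => by
    simpa only [mul_assoc] using (h1 α).const_mul ((-1 : ℂ) ^ (∑ i, α i))]
  refine Finset.sum_congr rfl fun α _ => ?_
  simp only [mul_assoc]
  rw [integral_const_mul, pderiv_corr hψ hg h,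
    integral_corr_mul_comm (p := ⊤) (q := 1) (hb α) (hf α) (memLp_one_iff_integrable.2 hψ)]

theorem norm_rep_le [p.HolderConjugate q] (hf : ∀ α, MemLp (f α) q volume)
    (hg : ∀ α, MemLp (pderiv α g) p volume) :
    ‖rep m f g‖ ≤ ∑ α ∈ multiIdx n m,
      (eLpNorm (f α) q volume).toReal * (eLpNorm (pderiv α g) p volume).toReal := by
  refine norm_sum_le_of_le _ fun α _ => ?_
  rw [norm_mul, norm_pow, norm_neg, norm_one, one_pow, one_mul, mul_comm]
  exact norm_integral_mul_le (hg α) (hf α)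

end

/-- The coefficient functions of the convolution of `∑ ∂^α f_α` and `∑ ∂^β k_β`. -/
noncomputable def convCoeff (m m' : ℕ) (f k : (Fin n → ℕ) → Rn n → ℂ) (γ : Fin n → ℕ) :
    Rn n → ℂ :=
  ∑ z ∈ (multiIdx n m ×ˢ multiIdx n m').filter (fun z => z.1 + z.2 = γ),
    corr (fun x => k z.2 (-x)) (f z.1)

section

variable {m m' : ℕ} {f k : (Fin n → ℕ) → Rn n → ℂ} {g : Rn n → ℂ}

theorem memLp_convCoeff (hq : 1 ≤ q) (hf : ∀ α, MemLp (f α) q volume)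
    (hk : ∀ α, Integrable (k α)) (γ : Fin n → ℕ) : MemLp (convCoeff m m' f k γ) q volume :=
  memLp_finsetSum' _ fun _ _ => memLp_corr hq (hk _).comp_neg (hf _)

/-- The computation behind S ∗ T = ∑ ∂^{α+β}(f_α ∗ k_β): in each term the correlation with k_β is
moved to f_α with k_β reflected, and the terms with α + β = γ are collected. -/
theorem rep_repCorr [p.HolderConjugate q] (hf : ∀ α, MemLp (f α) q volume)
    (hk : ∀ α, Integrable (k α)) (hg : ContDiff ℝ (⊤ : ℕ∞) g)
    (hb : ∀ α, TranslatesBounded (k α) g) (hgp : ∀ α, MemLp (pderiv α g) p volume) :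
    rep m f (repCorr m' k g) = rep (m + m') (convCoeff m m' f k) g := by
  have hp : 1 ≤ p := ENNReal.HolderConjugate.one_le p q
  have hq : 1 ≤ q := ENNReal.HolderConjugate.one_le q p
  have hL : ∀ α, (-1 : ℂ) ^ (∑ i, α i) * ∫ x, pderiv α (repCorr m' k g) x * f α x =
      ∑ β ∈ multiIdx n m', (-1 : ℂ) ^ (∑ i, (α + β) i) *
        ∫ x, pderiv (α + β) g x * corr (fun x => k β (-x)) (f α) x := by
    intro α
    rw [pderiv_repCorr hk hg hb, repCorr_eq]
    simp only [Finset.sum_apply, Pi.smul_apply, smul_eq_mul, Finset.sum_mul]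
    have h1 : ∀ β, Integrable fun y => corr (k β) (pderiv β (pderiv α g)) y * f α y := by
      intro β
      rw [← pderiv_add_index _ _ hg]
      exact memLp_one_iff_integrable.1 ((hf α).mul (memLp_corr hp (hk β) (hgp _)))
    rw [integral_finsetSum _ fun β _ => by
      simpa only [mul_assoc] using (h1 β).const_mul ((-1 : ℂ) ^ (∑ i, β i)), Finset.mul_sum]
    refine Finset.sum_congr rfl fun β _ => ?_
    simp only [mul_assoc]
    rw [integral_const_mul, sum_add_index, pow_add, mul_assoc, ← pderiv_add_index _ _ hg,
      integral_corr_mul (hgp _) (hk β) (hf α), add_comm β α]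
  have hR : ∀ γ, (-1 : ℂ) ^ (∑ i, γ i) * ∫ x, pderiv γ g x * convCoeff m m' f k γ x =
      ∑ z ∈ (multiIdx n m ×ˢ multiIdx n m').filter (fun z => z.1 + z.2 = γ),
        (-1 : ℂ) ^ (∑ i, (z.1 + z.2) i) *
          ∫ x, pderiv (z.1 + z.2) g x * corr (fun x => k z.2 (-x)) (f z.1) x := by
    intro γ
    simp only [convCoeff, Finset.sum_apply, Finset.mul_sum]
    rw [integral_finsetSum _ fun z _ => memLp_one_iff_integrable.1
      ((memLp_corr hq (hk z.2).comp_neg (hf z.1)).mul (hgp γ)), Finset.mul_sum]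
    refine Finset.sum_congr rfl fun z hz => ?_
    rw [(Finset.mem_filter.1 hz).2]
  rw [rep, rep, Finset.sum_congr rfl fun α _ => hL α, Finset.sum_congr rfl fun γ _ => hR γ,
    ← Finset.sum_product' (f := fun α β => (-1 : ℂ) ^ (∑ i, (α + β) i) *
        ∫ x, pderiv (α + β) g x * corr (fun x => k β (-x)) (f α) x)]
  exact (Finset.sum_fiberwise_of_maps_to (fun z hz =>
    add_mem_multiIdx (Finset.mem_product.1 hz).1 (Finset.mem_product.1 hz).2) _).symm

end

end Representation

/-! ### The defining identity of convolution. -/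

section ConvolutionOfDistributions

variable {n : ℕ} {p q : ℝ≥0∞}

/-- Integration by parts; the compact support of φ makes all the products integrable. -/
theorem corr_pd {φ h : Rn n → ℂ} (hφ : ContDiff ℝ (⊤ : ℕ∞) φ) (hc : HasCompactSupport φ)
    (hh : ContDiff ℝ (⊤ : ℕ∞) h) (i : Fin n) :
    corr (pd i φ) h = (-1 : ℂ) • corr φ (pd i h) := by
  funext y
  have hy : ContDiff ℝ (⊤ : ℕ∞) fun x => h (x + y) := hh.comp (contDiff_id.add contDiff_const)
  have hpd : pd i (fun x => h (x + y)) = fun x => pd i h (x + y) := by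
    rw [← pderiv_single i hy, ← pderiv_single i hh, pderiv_comp_add]
  have hint : ∀ {a b : Rn n → ℂ}, Continuous a → Continuous b → HasCompactSupport b →
      Integrable fun x => a x * b x := fun ha hb hcb =>
    (ha.mul hb).integrable_of_hasCompactSupport hcb.mul_left
  have h2 := integral_mul_fderiv_eq_neg_fderiv_mul_of_integrable (μ := (volume : Measure (Rn n)))
    (f := fun x => h (x + y)) (g := φ) (v := EuclideanSpace.single i 1)
    (hint (contDiff_pd i hy).continuous hφ.continuous hc)
    (hint hy.continuous (contDiff_pd i hφ).continuous (hasCompactSupport_pd i hc))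
    (hint hy.continuous hφ.continuous hc)
    (fun x _ => differentiable_of_smooth hy x) (fun x _ => differentiable_of_smooth hφ x)
  change ∫ x, h (x + y) * pd i φ x = - ∫ x, pd i (fun x => h (x + y)) x * φ x at h2
  rw [hpd] at h2
  simpa [corr] using h2

theorem hasCompactSupport_pderiv (α : Fin n → ℕ) {φ : Rn n → ℂ} (hφ : ContDiff ℝ (⊤ : ℕ∞) φ)
    (hc : HasCompactSupport φ) : HasCompactSupport (pderiv α φ) := by
  rw [pderiv_eq_wordDeriv α hφ]
  exact hasCompactSupport_wordDeriv _ hc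

theorem corr_pderiv {φ h : Rn n → ℂ} (hφ : ContDiff ℝ (⊤ : ℕ∞) φ) (hc : HasCompactSupport φ)
    (hh : ContDiff ℝ (⊤ : ℕ∞) h) (α : Fin n → ℕ) :
    corr (pderiv α φ) h = ((-1) ^ (∑ i, α i) : ℂ) • corr φ (pderiv α h) := by
  induction α using multiIndex_induction generalizing h with
  | zero => simp [pderiv_zero_index hφ, pderiv_zero_index hh]
  | step α i ih =>
    rw [pderiv_add_single' _ _ hφ, corr_pd (contDiff_pderiv α hφ)
      (hasCompactSupport_pderiv α hφ hc) hh, ih (contDiff_pd i hh), pderiv_add_single _ _ hh,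
      sum_add_index, pow_add, smul_smul]
    simp

theorem integrable_of_test {φ : Rn n → ℂ} (hφ : ContDiff ℝ (⊤ : ℕ∞) φ)
    (hc : HasCompactSupport φ) (α : Fin n → ℕ) : Integrable (pderiv α φ) :=
  (continuous_pderiv α hφ).integrable_of_hasCompactSupport (hasCompactSupport_pderiv α hφ hc)

theorem translatesBounded_of_hasCompactSupport {φ h : Rn n → ℂ} (hc : HasCompactSupport φ)
    (hh : ContDiff ℝ (⊤ : ℕ∞) h) : TranslatesBounded φ h := by
  obtain ⟨r, hr⟩ := hc.isCompact.isBounded.exists_norm_le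
  exact translatesBounded_of_support hh fun x hx => hr x (subset_tsupport φ hx)

theorem exists_bound_pderiv {φ : Rn n → ℂ} (hφ : ContDiff ℝ (⊤ : ℕ∞) φ)
    (hc : HasCompactSupport φ) (α : Fin n → ℕ) : ∃ C : ℝ, ∀ x, ‖pderiv α φ x‖ ≤ C :=
  (hasCompactSupport_pderiv α hφ hc).exists_bound_of_continuous (continuous_pderiv α hφ)

section

variable {m m' : ℕ} {f k : (Fin n → ℕ) → Rn n → ℂ}

/-- The regularization of `∑ ∂^α f_α` by `φ`. -/
theorem rep_comp_sub {φ : Rn n → ℂ} (hφ : ContDiff ℝ (⊤ : ℕ∞) φ) (y : Rn n) :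
    (rep m f fun x => φ (y - x)) =
      ∑ α ∈ multiIdx n m, corr (fun x => pderiv α φ (-x)) (f α) y := by
  refine Finset.sum_congr rfl fun α _ => ?_
  rw [pderiv_comp_sub α hφ]
  simp only [mul_assoc]
  rw [integral_const_mul, ← mul_assoc, ← mul_pow, neg_one_mul, neg_neg, one_pow, one_mul, corr,
    ← integral_add_right_eq_self _ y]
  refine integral_congr_ae (Filter.Eventually.of_forall fun x => ?_)
  simp only [sub_add_cancel_right, mul_comm]

theorem integrable_regularize_mul [p.HolderConjugate q] (hf : ∀ α, MemLp (f α) q volume)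
    {φ h : Rn n → ℂ} (hφ : ContDiff ℝ (⊤ : ℕ∞) φ) (hc : HasCompactSupport φ)
    (hh : MemLp h p volume) (α : Fin n → ℕ) :
    Integrable fun y => corr (fun x => pderiv α φ (-x)) (f α) y * h y := by
  have hq : 1 ≤ q := ENNReal.HolderConjugate.one_le q p
  have : q.HolderConjugate p := ENNReal.HolderConjugate.symm
  exact memLp_one_iff_integrable.1
    (hh.mul (memLp_corr hq (integrable_of_test hφ hc α).comp_neg (hf α)))

/-- The regularization is a sum of correlations of the f_α, in L^q by Young's inequality, so
Hölder's inequality gives integrability. Transposing them and moving ∂^α from φ to h turns the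
integral into one pairing. -/
theorem integral_regularize_mul [p.HolderConjugate q] (hf : ∀ α, MemLp (f α) q volume)
    {φ h : Rn n → ℂ} (hφ : ContDiff ℝ (⊤ : ℕ∞) φ) (hc : HasCompactSupport φ)
    (hs : ContDiff ℝ (⊤ : ℕ∞) h) (hh : MemLp h p volume) :
    Integrable (fun y => (rep m f fun x => φ (y - x)) * h y) ∧
      ∫ y, (rep m f fun x => φ (y - x)) * h y = rep m f (corr φ h) := by
  simp only [rep_comp_sub hφ, Finset.sum_mul]
  have h1 := integrable_regularize_mul hf hφ hc hh
  refine ⟨integrable_finsetSum _ fun α _ => h1 α, ?_⟩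
  rw [integral_finsetSum _ fun α _ => h1 α]
  refine Finset.sum_congr rfl fun α _ => ?_
  have h2 := integral_corr_mul hh (integrable_of_test hφ hc α) (hf α)
  simp only [mul_comm (corr (fun x => pderiv α φ (-x)) (f α) _)]
  have hi : Integrable φ := hφ.continuous.integrable_of_hasCompactSupport hc
  rw [← h2, corr_pderiv hφ hc hs, pderiv_corr hi hs (translatesBounded_of_hasCompactSupport hc hs),
    ← integral_const_mul]
  simp only [Pi.smul_apply, smul_eq_mul, mul_assoc]

/-- Correlations with φ and with the coefficients k_β commute, and derivatives pass through both. -/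
theorem corr_repCorr (hk : ∀ α, Integrable (k α)) {φ g : Rn n → ℂ} (hφ : ContDiff ℝ (⊤ : ℕ∞) φ)
    (hc : HasCompactSupport φ) (hg : ContDiff ℝ (⊤ : ℕ∞) g) (hgc : HasCompactSupport g) :
    corr φ (repCorr m' k g) = repCorr m' k (corr φ g) := by
  have hi : Integrable φ := hφ.continuous.integrable_of_hasCompactSupport hc
  have hb := exists_bound_pderiv hg hgc
  rw [repCorr_eq, repCorr_eq]
  have h1 : ∀ β, corr (k β) (pderiv β (corr φ g)) = corr φ (corr (k β) (pderiv β g)) := by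
    intro β
    obtain ⟨C, hC⟩ := hb β
    rw [pderiv_corr hi hg (translatesBounded_of_hasCompactSupport hc hg),
      corr_corr_comm (hk β) hi (continuous_pderiv β hg) hC]
  simp only [h1]
  funext y
  rw [corr]
  simp only [Finset.sum_apply, Pi.smul_apply, smul_eq_mul, Finset.sum_mul, mul_assoc]
  have h2 : ∀ β, Integrable fun x => corr (k β) (pderiv β g) (x + y) * φ x := by
    intro β
    have hsm : ContDiff ℝ (⊤ : ℕ∞) (corr (k β) (pderiv β g)) :=
      contDiff_corr (hk β) (contDiff_pderiv β hg)
        ((translatesBounded_of_bounded _ hb).pderiv hg β)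
    exact (translatesBounded_of_hasCompactSupport hc hsm).integrable hi hsm y
  rw [integral_finsetSum _ fun β _ => (h2 β).const_mul _]
  exact Finset.sum_congr rfl fun β _ => integral_const_mul _ _

/-- The distributions `∑ ∂^α f_α` and `∑ ∂^β k_β` with `f_α ∈ L^q` and `k_β ∈ L^1` are
convolvable. -/
theorem isConvolution_of_rep [p.HolderConjugate q] (hf : ∀ α, MemLp (f α) q volume)
    (hk : ∀ α, Integrable (k α)) {S T U : Distr n} (hS : ∀ φ : Test n, S φ = rep m f (toC φ))
    (hT : ∀ φ : Test n, T φ = rep m' k (toC φ))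
    (hU : ∀ φ : Test n, U φ = rep m f (repCorr m' k (toC φ))) : IsConvolution S T U := by
  intro φ ψ
  have hp : 1 ≤ p := ENNReal.HolderConjugate.one_le p q
  -- With this reflection, (T ∗ ψ)(−y) is the pairing of T with ψ'(· + y), a value of the transfer.
  set ψ' : Rn n → ℂ := fun x => toC ψ (-x) with hψ'
  have hψs : ContDiff ℝ (⊤ : ℕ∞) ψ' := (contDiff_toC ψ.contDiff).comp contDiff_neg
  have hφs : ContDiff ℝ (⊤ : ℕ∞) (toC φ) := contDiff_toC φ.contDiff
  have hφc : HasCompactSupport (toC φ) :=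
    φ.hasCompactSupport.comp_left (g := fun r : ℝ => (r : ℂ)) (by simp)
  have hψc : HasCompactSupport ψ' :=
    (ψ.hasCompactSupport.comp_left (g := fun r : ℝ => (r : ℂ)) (by simp)).comp_homeomorph
      (Homeomorph.neg (Rn n))
  have hb : ∀ α, TranslatesBounded (k α) ψ' := fun α =>
    translatesBounded_of_bounded _ (exists_bound_pderiv hψs hψc)
  have hLp : ∀ α, MemLp (pderiv α ψ') p volume := fun α =>
    (continuous_pderiv α hψs).memLp_of_hasCompactSupport (hasCompactSupport_pderiv α hψs hψc)
  have e1 : ∀ y, regularize S φ y = rep m f fun x => toC φ (y - x) := fun y => hS _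
  have e2 : ∀ y, regularize T ψ (-y) = repCorr m' k ψ' y := by
    intro y
    rw [regularize, hT, repCorr]
    congr 1
    funext x
    change ((ψ (-y - x) : ℝ) : ℂ) = (ψ (-(x + y)) : ℝ)
    congr 2
    abel
  -- The function x ↦ (φ ∗ ψ)(−x) is the correlation of φ with ψ'.
  have e3 : regularize U (testConv φ ψ) 0 = rep m f (repCorr m' k (corr (toC φ) ψ')) := by
    rw [regularize, hU]
    congr 2
    funext x
    change ((∫ t, φ t * ψ (0 - x - t) : ℝ) : ℂ) = ∫ t, ((ψ (-(t + x)) : ℝ) : ℂ) * (φ t : ℝ)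
    rw [← integral_complex_ofReal]
    refine integral_congr_ae (Filter.Eventually.of_forall fun t => ?_)
    have : 0 - x - t = -(t + x) := by abel
    simp only [this, Complex.ofReal_mul, mul_comm]
  have := integral_regularize_mul (m := m) hf hφs hφc (contDiff_repCorr (m := m') hk hψs hb)
    (memLp_repCorr (m := m') hp hk hLp)
  simp only [e1, e2, e3]
  rw [← corr_repCorr hk hφs hφc hψs hψc]
  exact ⟨this.1, this.2.symm⟩

end

end ConvolutionOfDistributions

/-! ### Joint continuity by polars. -/

section Polars

variable {E F V W : Type*}
  [AddCommGroup E] [Module ℂ E] [TopologicalSpace E] [AddCommGroup F] [Module ℂ F]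
  [TopologicalSpace F] [AddCommGroup V] [Module ℂ V] [TopologicalSpace V]
  [AddCommGroup W] [Module ℂ W] [TopologicalSpace W]

theorem polar_mem_nhds (ι : E →ₗ[ℂ] StrongDual ℂ V) (hι : Continuous ι) {B : Set V}
    (hB : Bornology.IsVonNBounded ℂ B) : {S : E | ∀ g ∈ B, ‖ι S g‖ ≤ 1} ∈ nhds (0 : E) := by
  have h1 : {f : StrongDual ℂ V | ∀ g ∈ B, f g ∈ Metric.closedBall (0 : ℂ) 1} ∈
      nhds (0 : StrongDual ℂ V) :=
    ContinuousLinearMap.hasBasis_nhds_zero.mem_of_mem (i := (B, Metric.closedBall (0 : ℂ) 1))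
      ⟨hB, Metric.closedBall_mem_nhds _ one_pos⟩
  have h2 := hι.tendsto' 0 0 (map_zero ι) h1
  simpa using! h2

/-- A bilinear map `E × F → E` of spaces of functionals with the strong topology is jointly
continuous if every polar contains the image of a product of polars. -/
theorem continuous_bilin_of_polars [IsTopologicalAddGroup E] [ContinuousSMul ℂ E]
    [IsTopologicalAddGroup F] [ContinuousSMul ℂ F] [ContinuousSMul ℂ V]
    (ι : E →ₗ[ℂ] StrongDual ℂ V) (hι : Topology.IsInducing ι)
    (κ : F →ₗ[ℂ] StrongDual ℂ W) (hκ : Topology.IsInducing κ) (c : E →ₗ[ℂ] F →ₗ[ℂ] E)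
    (h : ∀ B : Set V, Bornology.IsVonNBounded ℂ B → ∃ (B₁ : Set V) (B₂ : Set W),
      Bornology.IsVonNBounded ℂ B₁ ∧ Bornology.IsVonNBounded ℂ B₂ ∧ ∀ S T,
        (∀ g ∈ B₁, ‖ι S g‖ ≤ 1) → (∀ g ∈ B₂, ‖κ T g‖ ≤ 1) → ∀ g ∈ B, ‖ι (c S T) g‖ ≤ 1) :
    Continuous fun z : E × F => c z.1 z.2 := by
  refine continuous_bilin_of_tendsto c ?_
  rw [hι.nhds_eq_comap, Filter.tendsto_comap_iff, map_zero,
    ContinuousLinearMap.hasBasis_nhds_zero.tendsto_right_iff]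
  rintro ⟨B, U⟩ ⟨hB, hU⟩
  obtain ⟨ε, hε, hεU⟩ := Metric.mem_nhds_iff.1 hU
  have hε2 : (0 : ℝ) < ε / 2 := by positivity
  have hne : ((ε / 2 : ℝ) : ℂ) ≠ 0 := by exact_mod_cast hε2.ne'
  -- Being at most 1 on (ε/2)⁻¹B means being at most ε/2 < ε on B, so only polars need to be
  -- considered.
  have hB' : Bornology.IsVonNBounded ℂ ((fun g : V => ((ε / 2 : ℝ) : ℂ)⁻¹ • g) '' B) :=
    hB.image (((ε / 2 : ℝ) : ℂ)⁻¹ • ContinuousLinearMap.id ℂ V)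
  obtain ⟨B₁, B₂, hB₁, hB₂, hST⟩ := h _ hB'
  rw [nhds_prod_eq]
  filter_upwards [Filter.prod_mem_prod (polar_mem_nhds ι hι.continuous hB₁)
    (polar_mem_nhds κ hκ.continuous hB₂)] with z hz g hg
  have h1 := hST z.1 z.2 hz.1 hz.2 _ ⟨g, hg, rfl⟩
  rw [map_smul, norm_smul, norm_inv, Complex.norm_of_nonneg hε2.le, inv_mul_le_iff₀ hε2] at h1
  refine hεU ?_
  rw [mem_ball_zero_iff]
  change ‖ι (c z.1 z.2) g‖ < ε
  linarith

/-- A diagonal choice. With r_m a bound for P_m on B, put c_j = r_{2j}: for j ≥ m monotonicity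
bounds P_{j+m} by P_{2j}, hence the scaled value by 1, and only the finitely many j < m remain. This
is where an increasing sequence of seminorms is essential. -/
theorem exists_scaling {X : Type*} (P : ℕ → X → ℝ) {B : Set X}
    (hB : ∀ m, ∃ r > 0, ∀ x ∈ B, P m x < r) (hmono : ∀ m m' x, m ≤ m' → P m x ≤ P m' x) :
    ∃ c : ℕ → ℝ, (∀ j, 0 < c j) ∧ ∀ m, ∃ r > 0, ∀ j, ∀ x ∈ B, (c j)⁻¹ * P (j + m) x < r := by
  choose r hr hP using hB
  refine ⟨fun j => r (2 * j), fun j => hr _, fun m => ?_⟩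
  have hnn : ∀ j, 0 ≤ (r (2 * j))⁻¹ * r (j + m) := fun j =>
    mul_nonneg (inv_nonneg.2 (hr _).le) (hr _).le
  refine ⟨1 + ∑ j ∈ Finset.range m, (r (2 * j))⁻¹ * r (j + m),
    add_pos_of_pos_of_nonneg one_pos (Finset.sum_nonneg fun j _ => hnn j), fun j x hx => ?_⟩
  have hpos : 0 < (r (2 * j))⁻¹ := inv_pos.2 (hr _)
  by_cases hj : j < m
  · calc (r (2 * j))⁻¹ * P (j + m) x < (r (2 * j))⁻¹ * r (j + m) :=
          mul_lt_mul_of_pos_left (hP _ x hx) hpos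
      _ ≤ ∑ j ∈ Finset.range m, (r (2 * j))⁻¹ * r (j + m) :=
          Finset.single_le_sum (f := fun j => (r (2 * j))⁻¹ * r (j + m)) (fun j _ => hnn j)
            (Finset.mem_range.2 hj)
      _ ≤ _ := by linarith
  · calc (r (2 * j))⁻¹ * P (j + m) x < (r (2 * j))⁻¹ * r (2 * j) :=
          mul_lt_mul_of_pos_left ((hmono _ _ x (by omega)).trans_lt (hP _ x hx)) hpos
      _ = 1 := inv_mul_cancel₀ (hr _).ne'
      _ ≤ _ := le_add_of_nonneg_right (Finset.sum_nonneg fun j _ => hnn j)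

theorem continuous_of_norm_le_seminorm [IsTopologicalAddGroup V] (f : V →ₗ[ℂ] ℂ)
    {p : Seminorm ℂ V} (hp : Continuous p)
    {C : ℝ} (h : ∀ x, ‖f x‖ ≤ C * p x) : Continuous f := by
  refine continuous_of_continuousAt_zero f ?_
  rw [ContinuousAt, map_zero]
  refine squeeze_zero_norm h ?_
  have := (continuous_const (y := C)).mul hp
  exact this.tendsto' 0 0 (by simp)

end Polars

/-! ### Translates, derivatives and averages in ℬ̇. -/

section BDotOperations

variable {n : ℕ}

namespace BDot

theorem coe_mk (f : Rn n → ℂ) (hf : ContDiff ℝ (⊤ : ℕ∞) f)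
    (h : ∀ α, Filter.Tendsto (pderiv α f) (Filter.cocompact (Rn n)) (nhds 0)) :
    ⇑(mk f hf h : DL n ⊤) = f := rfl

theorem memLp (g : BDot n) (α : Fin n → ℕ) : MemLp (pderiv α (g : DL n ⊤)) ⊤ volume :=
  (g : DL n ⊤).memLp α

theorem exists_bound (g : BDot n) (α : Fin n → ℕ) : ∃ C : ℝ, ∀ x, ‖pderiv α (g : DL n ⊤) x‖ ≤ C :=
  exists_bound_of_tendsto (continuous_pderiv α (contDiff g)) (tendsto g α)

theorem translatesBounded (k : Rn n → ℂ) (g : BDot n) : TranslatesBounded k (g : DL n ⊤) :=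
  translatesBounded_of_bounded k (exists_bound g)

/-- The translate `x ↦ g(x + y)`. -/
noncomputable def translate (g : BDot n) (y : Rn n) : BDot n :=
  mk (fun x => (g : DL n ⊤) (x + y)) ((contDiff g).comp (contDiff_id.add contDiff_const))
    fun α => by
      rw [pderiv_comp_add]
      exact (tendsto g α).comp (Homeomorph.addRight y).isClosedEmbedding.tendsto_cocompact

/-- The derivative `∂^α g`. -/
noncomputable def deriv (α : Fin n → ℕ) (g : BDot n) : BDot n :=
  mk (pderiv α (g : DL n ⊤)) (contDiff_pderiv α (contDiff g)) fun β => by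
    rw [← pderiv_add_index β α (contDiff g)]
    exact tendsto g _

/-- The correlation of an integrable function with an element of `ℬ̇`. -/
noncomputable def corr (ψ : Rn n → ℂ) (hψ : Integrable ψ) (g : BDot n) : BDot n :=
  mk (DistSpaces.corr ψ (g : DL n ⊤)) (contDiff_corr hψ (contDiff g) (translatesBounded ψ g))
    fun α => by
      rw [pderiv_corr hψ (contDiff g) (translatesBounded ψ g)]
      exact tendsto_corr hψ (continuous_pderiv α (contDiff g)) (tendsto g α)

theorem translate_add (f g : BDot n) (y : Rn n) :
    translate (f + g) y = translate f y + translate g y := rfl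

theorem translate_smul (c : ℂ) (g : BDot n) (y : Rn n) :
    translate (c • g) y = c • translate g y := rfl

end BDot

theorem DL.toBDot_add {p : ℝ≥0∞} (hp : 1 ≤ p) (hp' : p ≠ ⊤) (f g : DL n p) :
    (f + g).toBDot hp hp' = f.toBDot hp hp' + g.toBDot hp hp' := rfl

theorem DL.toBDot_smul {p : ℝ≥0∞} (hp : 1 ≤ p) (hp' : p ≠ ⊤) (c : ℂ) (g : DL n p) :
    (c • g).toBDot hp hp' = c • g.toBDot hp hp' := rfl

end BDotOperations

/-! ### The transfer operator of an element of 𝒟'_{L^1}. -/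

section Transfer

variable {n : ℕ} {p : ℝ≥0∞}

namespace DPrimeLOne

theorem exists_rep (T : DPrimeLOne n) : ∃ (m : ℕ) (k : (Fin n → ℕ) → Rn n → ℂ),
    (∀ α, Integrable (k α)) ∧ ∀ g : BDot n, (T : StrongDual ℂ (BDot n)) g = rep m k (g : DL n ⊤) :=
  let ⟨m, k, hk, h⟩ := T.2
  ⟨m, k, fun α => memLp_one_iff_integrable.1 (hk α), h⟩

/-- The function `y ↦ ⟨g(· + y), T⟩`. -/
noncomputable def transfer (T : DPrimeLOne n) (g : BDot n) (y : Rn n) : ℂ :=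
  (T : StrongDual ℂ (BDot n)) (BDot.translate g y)

/-- The transfer is defined without choosing a representation, which keeps linearity and
associativity formal; any representation may be inserted for its analytic properties. -/
theorem transfer_eq (T : DPrimeLOne n) {m : ℕ} {k : (Fin n → ℕ) → Rn n → ℂ}
    (h : ∀ g : BDot n, (T : StrongDual ℂ (BDot n)) g = rep m k (g : DL n ⊤)) (g : BDot n) :
    transfer T g = repCorr m k (g : DL n ⊤) := funext fun _ => h _

theorem contDiff_transfer (T : DPrimeLOne n) (g : BDot n) :
    ContDiff ℝ (⊤ : ℕ∞) (transfer T g) := by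
  obtain ⟨m, k, hk, h⟩ := exists_rep T
  rw [transfer_eq T h]
  exact contDiff_repCorr hk (BDot.contDiff g) fun α => BDot.translatesBounded _ g

/-- Each derivative of the transfer is again a pairing with T, so bounds on T over a bounded set
control all derivatives. -/
theorem pderiv_transfer (T : DPrimeLOne n) (g : BDot n) (α : Fin n → ℕ) :
    pderiv α (transfer T g) = transfer T (BDot.deriv α g) := by
  obtain ⟨m, k, hk, h⟩ := exists_rep T
  rw [transfer_eq T h, transfer_eq T h,
    pderiv_repCorr hk (BDot.contDiff g) fun α => BDot.translatesBounded _ g]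
  rfl

theorem tendsto_transfer (T : DPrimeLOne n) (g : BDot n) :
    Filter.Tendsto (transfer T g) (Filter.cocompact (Rn n)) (nhds 0) := by
  obtain ⟨m, k, hk, h⟩ := exists_rep T
  rw [transfer_eq T h]
  exact tendsto_repCorr hk (BDot.contDiff g) (BDot.tendsto g)

theorem memLp_transfer (hp : 1 ≤ p) (T : DPrimeLOne n) {g : BDot n}
    (hg : ∀ α, MemLp (pderiv α (g : DL n ⊤)) p volume) : MemLp (transfer T g) p volume := by
  obtain ⟨m, k, hk, h⟩ := exists_rep T
  rw [transfer_eq T h]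
  exact memLp_repCorr hp hk hg

/-- T is pulled through the integral by Fubini's theorem in a representation, so no vector-valued
integral is needed. -/
theorem integral_transfer_mul (T : DPrimeLOne n) (g : BDot n) {ψ : Rn n → ℂ}
    (hψ : Integrable ψ) :
    ∫ y, transfer T g y * ψ y = (T : StrongDual ℂ (BDot n)) (BDot.corr ψ hψ g) := by
  obtain ⟨m, k, hk, h⟩ := exists_rep T
  rw [transfer_eq T h, h, integral_repCorr_mul hk (BDot.contDiff g) (BDot.memLp g) hψ
    (BDot.translatesBounded ψ g)]
  rfl

/-- `g ↦ (y ↦ ⟨g(· + y), T⟩)` as an endomorphism of `ℬ̇`. -/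
noncomputable def transferBDot (T : DPrimeLOne n) : BDot n →ₗ[ℂ] BDot n where
  toFun g := BDot.mk (transfer T g) (contDiff_transfer T g) fun α => by
    rw [pderiv_transfer]
    exact tendsto_transfer T _
  map_add' f g := BDot.ext fun y => by
    change transfer T (f + g) y = transfer T f y + transfer T g y
    rw [transfer, BDot.translate_add, map_add]
    rfl
  map_smul' c g := BDot.ext fun y => by
    change transfer T (c • g) y = c * transfer T g y
    rw [transfer, BDot.translate_smul, map_smul]
    rfl

theorem coe_transferBDot (T : DPrimeLOne n) (g : BDot n) :
    ⇑(transferBDot T g : DL n ⊤) = transfer T g := rfl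

/-- `g ↦ (y ↦ ⟨g(· + y), T⟩)` as an endomorphism of `𝒟_{L^p}`, `p < ∞`. -/
noncomputable def transferDL (hp : 1 ≤ p) (hp' : p ≠ ⊤) (T : DPrimeLOne n) :
    DL n p →ₗ[ℂ] DL n p where
  toFun g := (⟨transfer T (g.toBDot hp hp'), contDiff_transfer T _, fun α => by
    rw [pderiv_transfer]
    refine memLp_transfer hp T fun β => ?_
    change MemLp (pderiv β (pderiv α g)) p volume
    rw [← pderiv_add_index β α g.contDiff]
    exact g.memLp _⟩ : dLpSubmodule n p)
  map_add' f g := DL.ext fun y => by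
    change transfer T ((f + g).toBDot hp hp') y =
      transfer T (f.toBDot hp hp') y + transfer T (g.toBDot hp hp') y
    rw [transfer, DL.toBDot_add, BDot.translate_add, map_add]
    rfl
  map_smul' c g := DL.ext fun y => by
    change transfer T ((c • g).toBDot hp hp') y = c * transfer T (g.toBDot hp hp') y
    rw [transfer, DL.toBDot_smul, BDot.translate_smul, map_smul]
    rfl

theorem coe_transferDL (hp : 1 ≤ p) (hp' : p ≠ ⊤) (T : DPrimeLOne n) (g : DL n p) :
    ⇑(transferDL hp hp' T g) = transfer T (g.toBDot hp hp') := rfl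

end DPrimeLOne

theorem DL.exists_norm_rep_le {p q : ℝ≥0∞} [Fact (1 ≤ p)] [p.HolderConjugate q] {m : ℕ}
    {f : (Fin n → ℕ) → Rn n → ℂ} (hf : ∀ α, MemLp (f α) q volume) :
    ∃ C : ℝ, ∀ g : DL n p, ‖rep m f g‖ ≤ C * DL.seminorms n p m g := by
  refine ⟨∑ α ∈ multiIdx n m, (eLpNorm (f α) q volume).toReal, fun g => ?_⟩
  rw [Finset.sum_mul]
  refine (norm_rep_le hf g.memLp).trans (Finset.sum_le_sum fun α hα => ?_)
  gcongr
  exact DL.toReal_eLpNorm_le hα g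

end Transfer

/-! ### The convolution on 𝒟'_{L^q} × 𝒟'_{L^1}, q > 1. -/

section ConvolutionDPrimeL

variable {n : ℕ} {q : ℝ≥0∞}

theorem conjExponent_ne_top (hq : 1 < q) : q.conjExponent ≠ ⊤ := by
  rw [ENNReal.conjExponent]
  exact ENNReal.add_ne_top.2 ⟨ENNReal.one_ne_top, ENNReal.inv_ne_top.2 (tsub_pos_of_lt hq).ne'⟩

instance [Fact (1 ≤ q)] : q.conjExponent.HolderConjugate q := ENNReal.HolderConjugate.symm

theorem one_le_conjExponent : 1 ≤ q.conjExponent := Fact.out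

variable [Fact (1 ≤ q)]

/-- Serves twice: it gives the continuity of the convolution as a functional and its membership in
𝒟'_{L^q}. -/
theorem DPrimeL.exists_conv_rep (hq : 1 < q) (S : DPrimeL n q) (T : DPrimeLOne n) :
    ∃ (m : ℕ) (F : (Fin n → ℕ) → Rn n → ℂ), (∀ α, MemLp (F α) q volume) ∧
      ∀ g : DL n q.conjExponent, (S : StrongDual ℂ (DL n q.conjExponent))
        (DPrimeLOne.transferDL one_le_conjExponent (conjExponent_ne_top hq) T g) = rep m F g := by
  obtain ⟨m, f, hf, hS⟩ := S.2
  obtain ⟨m', k, hk, hT⟩ := DPrimeLOne.exists_rep T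
  refine ⟨m + m', convCoeff m m' f k, memLp_convCoeff hq.le hf hk, fun g => ?_⟩
  rw [← rep_repCorr (p := q.conjExponent) hf hk g.contDiff (fun α => BDot.translatesBounded _
    (g.toBDot one_le_conjExponent (conjExponent_ne_top hq))) g.memLp]
  refine (hS _).trans ?_
  change rep m f _ = _
  beta_reduce
  rw [DPrimeLOne.coe_transferDL, DPrimeLOne.transfer_eq T hT]
  rfl

/-- The convolution of an element of `𝒟'_{L^q}` and an element of `𝒟'_{L^1}`. -/
noncomputable def DPrimeL.convElem (hq : 1 < q) (S : DPrimeL n q) (T : DPrimeLOne n) :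
    DPrimeL n q :=
  ⟨⟨(S : StrongDual ℂ (DL n q.conjExponent)).toLinearMap.comp
      (DPrimeLOne.transferDL one_le_conjExponent (conjExponent_ne_top hq) T), by
    obtain ⟨m, F, hF, h⟩ := DPrimeL.exists_conv_rep hq S T
    obtain ⟨C, hC⟩ := DL.exists_norm_rep_le (p := q.conjExponent) (m := m) hF
    exact continuous_of_norm_le_seminorm _ (DL.continuous_seminorms m) (C := C) fun g =>
      (congrArg norm (h g)).trans_le (hC g)⟩,
    DPrimeL.exists_conv_rep hq S T⟩

/-- The convolution `𝒟'_{L^q} × 𝒟'_{L^1} → 𝒟'_{L^q}`. -/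
noncomputable def DPrimeL.conv (n : ℕ) {q : ℝ≥0∞} [Fact (1 ≤ q)] (hq : 1 < q) :
    DPrimeL n q →ₗ[ℂ] DPrimeLOne n →ₗ[ℂ] DPrimeL n q :=
  LinearMap.mk₂ ℂ (DPrimeL.convElem hq)
    (fun _ _ _ => rfl) (fun _ _ _ => rfl)
    (fun S T T' => Subtype.ext (ContinuousLinearMap.ext fun g =>
      map_add (S : StrongDual ℂ (DL n q.conjExponent))
        (DPrimeLOne.transferDL one_le_conjExponent (conjExponent_ne_top hq) T g)
        (DPrimeLOne.transferDL one_le_conjExponent (conjExponent_ne_top hq) T' g)))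
    (fun c S T => Subtype.ext (ContinuousLinearMap.ext fun g =>
      map_smul (S : StrongDual ℂ (DL n q.conjExponent)) c
        (DPrimeLOne.transferDL one_le_conjExponent (conjExponent_ne_top hq) T g)))

theorem DPrimeL.isConvolution_conv (hq : 1 < q) (S : DPrimeL n q) (T : DPrimeLOne n) :
    IsConvolution (DPrimeL.toDistr S) (DPrimeLOne.toDistr T)
      (DPrimeL.toDistr (DPrimeL.conv n hq S T)) := by
  obtain ⟨m, f, hf, hS⟩ := S.2
  obtain ⟨m', k, hk, hT⟩ := DPrimeLOne.exists_rep T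
  refine isConvolution_of_rep (p := q.conjExponent) (m := m) (m' := m') hf hk
    (fun φ => hS (testToDL n q.conjExponent φ)) (fun φ => hT (testToBDot n φ)) fun φ => ?_
  refine (hS (DPrimeLOne.transferDL one_le_conjExponent (conjExponent_ne_top hq) T
    (testToDL n q.conjExponent φ))).trans ?_
  change rep m f _ = _
  beta_reduce
  rw [DPrimeLOne.coe_transferDL, DPrimeLOne.transfer_eq T hT]
  rfl

theorem norm_corr_le {p q : ℝ≥0∞} [p.HolderConjugate q] {ψ G : Rn n → ℂ}
    (hψ : MemLp ψ q volume) (hψ1 : eLpNorm ψ q volume ≤ 1) (hG : MemLp G p volume) (y : Rn n) :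
    ‖corr ψ G y‖ ≤ (eLpNorm G p volume).toReal := by
  refine (norm_integral_mul_le (memLp_comp_add_right hG y) hψ).trans ?_
  rw [eLpNorm_comp_add_right hG.1]
  refine mul_le_of_le_one_right ENNReal.toReal_nonneg ?_
  simpa using ENNReal.toReal_mono ENNReal.one_ne_top hψ1

theorem DL.isVonNBounded_of_eLpNorm_le {p : ℝ≥0∞} [Fact (1 ≤ p)] (c : ℕ → ℝ) (hc : ∀ j, 0 < c j) :
    Bornology.IsVonNBounded ℂ {h : DL n p | ∀ α : Fin n → ℕ,
      eLpNorm (pderiv α h) p volume ≤ ENNReal.ofReal (c (∑ i, α i))} := by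
  refine DL.isVonNBounded_iff.2 fun m => ?_
  have hpos : 0 ≤ ∑ α ∈ multiIdx n m, c (∑ i, α i) := Finset.sum_nonneg fun α _ => (hc _).le
  refine ⟨∑ α ∈ multiIdx n m, c (∑ i, α i) + 1, by positivity, fun h hh => ?_⟩
  refine (DL.seminorms_le' hpos fun α hα => (hh α).trans (ENNReal.ofReal_le_ofReal ?_)).trans_lt
    (lt_add_one _)
  exact Finset.single_le_sum (f := fun α : Fin n → ℕ => c (∑ i, α i)) (fun α _ => (hc _).le) hα

theorem norm_inv_smul_bound {c : ℝ} (hc : 0 < c) {V : Type*} [AddCommGroup V] [Module ℂ V]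
    {f : V → ℂ} (hf : ∀ (a : ℂ) v, f (a • v) = a * f v) {v : V}
    (h : ‖f (((c : ℂ)⁻¹) • v)‖ ≤ 1) : ‖f v‖ ≤ c := by
  rwa [hf, norm_mul, norm_inv, Complex.norm_of_nonneg hc.le, inv_mul_le_iff₀ hc, mul_one] at h

/-- The polar argument with L^p norms. Since these are suprema of pairings with unit vectors ψ of
L^q, B₂ consists of scaled averages of ∂^α g against such ψ, taken integrable so that T can be moved
through the average. -/
theorem DPrimeL.continuous_conv (hq : 1 < q) :
    Continuous fun z : DPrimeL n q × DPrimeLOne n => DPrimeL.conv n hq z.1 z.2 := by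
  have hpt := conjExponent_ne_top hq
  have hp : 1 ≤ q.conjExponent := one_le_conjExponent
  refine continuous_bilin_of_polars (E := DPrimeL n q) (F := DPrimeLOne n)
    (V := DL n q.conjExponent) (W := BDot n) (DPrimeL n q).subtype Topology.IsInducing.subtypeVal
    (DPrimeLOne n).subtype Topology.IsInducing.subtypeVal (DPrimeL.conv n hq) fun B hB => ?_
  obtain ⟨c, hc, hcB⟩ := exists_scaling (fun m (g : DL n q.conjExponent) =>
    DL.seminorms n q.conjExponent m g) (DL.isVonNBounded_iff.1 hB)
    fun m m' g h => DL.seminorms_mono h g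
  refine ⟨{h | ∀ α : Fin n → ℕ,
      eLpNorm (pderiv α h) q.conjExponent volume ≤ ENNReal.ofReal (c (∑ i, α i))},
    {e | ∃ g ∈ B, ∃ (α : Fin n → ℕ) (ψ : Rn n → ℂ) (hψ : Integrable ψ), MemLp ψ q volume ∧
      eLpNorm ψ q volume ≤ 1 ∧
        e = ((c (∑ i, α i) : ℂ)⁻¹) • BDot.corr ψ hψ (BDot.deriv α (g.toBDot hp hpt))},
    DL.isVonNBounded_of_eLpNorm_le c hc, ?_, ?_⟩
  -- By Hölder's inequality, ∂^β of an average of ∂^α g is at most ‖∂^{α+β} g‖_p in supremum norm;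
  -- the choice of c absorbs the growth in |α|.
  · refine BDot.isVonNBounded_iff.2 fun m => ?_
    obtain ⟨r, hr, hrB⟩ := hcB m
    refine ⟨r, hr, ?_⟩
    rintro _ ⟨g, hg, α, ψ, hψ, hψq, hψ1, rfl⟩
    refine lt_of_le_of_lt ?_ (hrB (∑ i, α i) g hg)
    have hcp := hc (∑ i, α i)
    rw [Submodule.coe_smul, map_smul_eq_mul, norm_inv, Complex.norm_of_nonneg hcp.le]
    refine mul_le_mul_of_nonneg_left ?_ (inv_nonneg.2 hcp.le)
    refine DL.seminorms_top_le (apply_nonneg _ _) fun β hβ x => ?_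
    rw [BDot.corr, BDot.coe_mk, pderiv_corr hψ (BDot.contDiff _) (BDot.translatesBounded ψ _)]
    change ‖corr ψ (pderiv β (pderiv α g)) x‖ ≤ _
    rw [← pderiv_add_index _ _ g.contDiff]
    refine (norm_corr_le (p := q.conjExponent) hψq hψ1 (g.memLp _) x).trans ?_
    rw [add_comm]
    exact DL.toReal_eLpNorm_le (add_mem_multiIdx (self_mem_multiIdx α) hβ) g
  · intro S T hS hT g hg
    -- It remains to see that the transfer of g lies in B₁; duality reduces this to values of T on
    -- B₂.
    refine hS (DPrimeLOne.transferDL hp hpt T g) fun α => ?_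
    rw [DPrimeLOne.coe_transferDL, DPrimeLOne.pderiv_transfer]
    refine eLpNorm_le_of_forall_integral (q := q) hpt (DPrimeLOne.contDiff_transfer T _).continuous
      fun ψ hψ hψq hψ1 => ?_
    rw [DPrimeLOne.integral_transfer_mul T _ hψ]
    exact norm_inv_smul_bound (hc _) (f := fun v => (T : StrongDual ℂ (BDot n)) v)
      (fun a v => map_smul _ a v) (hT _ ⟨g, hg, α, ψ, hψ, hψq, hψ1, rfl⟩)

end ConvolutionDPrimeL

/-! ### The convolution algebra 𝒟'_{L^1}. -/

section ConvolutionDPrimeLOne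

variable {n : ℕ}

namespace DPrimeLOne

theorem exists_conv_rep (S T : DPrimeLOne n) :
    ∃ (m : ℕ) (F : (Fin n → ℕ) → Rn n → ℂ), (∀ α, MemLp (F α) 1 volume) ∧
      ∀ g : BDot n, (S : StrongDual ℂ (BDot n)) (transferBDot T g) = rep m F (g : DL n ⊤) := by
  obtain ⟨m, f, hf, hS⟩ := S.2
  obtain ⟨m', k, hk, hT⟩ := exists_rep T
  refine ⟨m + m', convCoeff m m' f k, memLp_convCoeff le_rfl hf hk, fun g => ?_⟩
  rw [← rep_repCorr (p := ⊤) hf hk (BDot.contDiff g) (fun α => BDot.translatesBounded _ g)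
    (BDot.memLp g)]
  refine (hS _).trans ?_
  change rep m f _ = _
  beta_reduce
  rw [coe_transferBDot, transfer_eq T hT]

/-- The convolution of two elements of `𝒟'_{L^1}`. -/
noncomputable def convElem (S T : DPrimeLOne n) : DPrimeLOne n :=
  ⟨⟨(S : StrongDual ℂ (BDot n)).toLinearMap.comp (transferBDot T), by
    obtain ⟨m, F, hF, h⟩ := exists_conv_rep S T
    obtain ⟨C, hC⟩ := DL.exists_norm_rep_le (p := ⊤) (m := m) hF
    exact continuous_of_norm_le_seminorm _ ((BDot.withSeminorms n).continuous_seminorm m) (C := C)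
      fun g => (congrArg norm (h g)).trans_le (hC g)⟩,
    exists_conv_rep S T⟩

/-- The convolution `𝒟'_{L^1} × 𝒟'_{L^1} → 𝒟'_{L^1}`. -/
noncomputable def conv (n : ℕ) : DPrimeLOne n →ₗ[ℂ] DPrimeLOne n →ₗ[ℂ] DPrimeLOne n :=
  LinearMap.mk₂ ℂ convElem
    (fun _ _ _ => rfl) (fun _ _ _ => rfl)
    (fun S T T' => Subtype.ext (ContinuousLinearMap.ext fun g =>
      map_add (S : StrongDual ℂ (BDot n)) (transferBDot T g) (transferBDot T' g)))
    (fun c S T => Subtype.ext (ContinuousLinearMap.ext fun g =>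
      map_smul (S : StrongDual ℂ (BDot n)) c (transferBDot T g)))

theorem isConvolution_conv (S T : DPrimeLOne n) :
    IsConvolution (toDistr S) (toDistr T) (toDistr (conv n S T)) := by
  obtain ⟨m, f, hf, hS⟩ := S.2
  obtain ⟨m', k, hk, hT⟩ := exists_rep T
  refine isConvolution_of_rep (p := ⊤) (m := m) (m' := m') hf hk
    (fun φ => hS (testToBDot n φ)) (fun φ => hT (testToBDot n φ)) fun φ => ?_
  refine (hS (transferBDot T (testToBDot n φ))).trans ?_
  change rep m f _ = _
  beta_reduce
  rw [coe_transferBDot, transfer_eq T hT]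
  rfl

/-- The transfer by T commutes with translations, because w + (z + y) = (w + z) + y; hence the
transfer by S ∗ T is the composite of the two transfers. -/
theorem conv_assoc (R S T : DPrimeLOne n) :
    conv n (conv n R S) T = conv n R (conv n S T) := by
  refine Subtype.ext (ContinuousLinearMap.ext fun g => ?_)
  change (R : StrongDual ℂ (BDot n)) (transferBDot S (transferBDot T g)) =
    (R : StrongDual ℂ (BDot n)) (transferBDot (convElem S T) g)
  congr 1
  refine BDot.ext fun y => ?_
  change (S : StrongDual ℂ (BDot n)) (BDot.translate (transferBDot T g) y) =
    (S : StrongDual ℂ (BDot n)) (transferBDot T (BDot.translate g y))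
  congr 1
  refine BDot.ext fun z => ?_
  change (T : StrongDual ℂ (BDot n)) (BDot.translate g (z + y)) =
    (T : StrongDual ℂ (BDot n)) (BDot.translate (BDot.translate g y) z)
  congr 1
  refine BDot.ext fun w => ?_
  change (g : DL n ⊤) (w + (z + y)) = (g : DL n ⊤) (w + z + y)
  rw [add_assoc]

/-- As for q > 1, but supremum norms are tested by point evaluations, so plain translates of the
scaled derivatives replace the averages. -/
theorem continuous_conv (n : ℕ) :
    Continuous fun z : DPrimeLOne n × DPrimeLOne n => conv n z.1 z.2 := by
  refine continuous_bilin_of_polars (E := DPrimeLOne n) (F := DPrimeLOne n)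
    (V := BDot n) (W := BDot n) (DPrimeLOne n).subtype Topology.IsInducing.subtypeVal
    (DPrimeLOne n).subtype Topology.IsInducing.subtypeVal (conv n) fun B hB => ?_
  obtain ⟨c, hc, hcB⟩ := exists_scaling (fun m (g : BDot n) =>
    DL.seminorms n ⊤ m (g : DL n ⊤)) (BDot.isVonNBounded_iff.1 hB)
    fun m m' g h => DL.seminorms_mono h _
  refine ⟨{h | ∀ (α : Fin n → ℕ) x, ‖pderiv α (h : DL n ⊤) x‖ ≤ c (∑ i, α i)},
    {e | ∃ g ∈ B, ∃ (α : Fin n → ℕ) (y : Rn n),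
      e = ((c (∑ i, α i) : ℂ)⁻¹) • BDot.translate (BDot.deriv α g) y}, ?_, ?_, ?_⟩
  · refine BDot.isVonNBounded_iff.2 fun m => ?_
    obtain ⟨r, hr, h⟩ := DL.isVonNBounded_iff.1
      (DL.isVonNBounded_of_eLpNorm_le (n := n) (p := ⊤) c hc) m
    exact ⟨r, hr, fun g hg => h g fun α => eLpNorm_top_le_of_norm_le (hg α)⟩
  · refine BDot.isVonNBounded_iff.2 fun m => ?_
    obtain ⟨r, hr, hrB⟩ := hcB m
    refine ⟨r, hr, ?_⟩
    rintro _ ⟨g, hg, α, y, rfl⟩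
    refine lt_of_le_of_lt ?_ (hrB (∑ i, α i) g hg)
    have hcp := hc (∑ i, α i)
    rw [Submodule.coe_smul, map_smul_eq_mul, norm_inv, Complex.norm_of_nonneg hcp.le]
    refine mul_le_mul_of_nonneg_left ?_ (inv_nonneg.2 hcp.le)
    refine DL.seminorms_top_le (apply_nonneg _ _) fun β hβ x => ?_
    rw [BDot.translate, BDot.coe_mk, pderiv_comp_add]
    change ‖pderiv β (pderiv α (g : DL n ⊤)) (x + y)‖ ≤ _
    rw [← pderiv_add_index _ _ (BDot.contDiff g), add_comm β]
    exact DL.norm_pderiv_le (add_mem_multiIdx (self_mem_multiIdx α) hβ) _ _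
  · intro S T hS hT g hg
    refine hS (transferBDot T g) fun α y => ?_
    rw [coe_transferBDot, pderiv_transfer]
    exact norm_inv_smul_bound (hc _) (f := fun v => (T : StrongDual ℂ (BDot n)) v)
      (fun a v => map_smul _ a v) (hT _ ⟨g, hg, α, y, rfl⟩)

end DPrimeLOne

end ConvolutionDPrimeLOne

/-! ### The structure theorem for ℰ' and its convolution algebra. -/

section CompactSupport

variable {n : ℕ}

/-- The closed ball with centre `0` as a compact set. -/
def ballCompacts (n : ℕ) (R : ℝ) : Compacts (Rn n) :=
  ⟨Metric.closedBall 0 R, isCompact_closedBall 0 R⟩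

theorem mem_ballCompacts {R : ℝ} {x : Rn n} : x ∈ ballCompacts n R ↔ ‖x‖ ≤ R :=
  mem_closedBall_zero_iff

theorem exists_le_ballCompacts (m : ℕ) (K : Compacts (Rn n)) :
    ∃ N : ℕ, m ≤ N ∧ K ≤ ballCompacts n N := by
  obtain ⟨r, hr⟩ := K.isCompact.isBounded.exists_norm_le
  obtain ⟨k, hk⟩ := exists_nat_ge r
  refine ⟨max m k, le_max_left _ _, fun x hx => mem_ballCompacts.2 ?_⟩
  exact (hr x hx).trans (hk.trans (by exact_mod_cast le_max_right m k))

namespace SmoothFn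

/-- The translate `x ↦ g(x + y)`. -/
noncomputable def translate (g : SmoothFn n) (y : Rn n) : SmoothFn n :=
  (⟨fun x => g (x + y), g.contDiff.comp (contDiff_id.add contDiff_const)⟩ : smoothSubmodule n)

/-- The derivative `∂^α g`. -/
noncomputable def deriv (α : Fin n → ℕ) (g : SmoothFn n) : SmoothFn n :=
  (⟨pderiv α g, contDiff_pderiv α g.contDiff⟩ : smoothSubmodule n)

theorem seminorms_translate_deriv_le {m m' : ℕ} {R R' : ℝ} {α : Fin n → ℕ}
    (hα : α ∈ multiIdx n m') {y : Rn n} (hy : ‖y‖ ≤ R') (g : SmoothFn n) :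
    seminorms n (m, ballCompacts n R) (translate (deriv α g) y) ≤
      seminorms n (m' + m, ballCompacts n (R' + R)) g := by
  refine seminorms_le (apply_nonneg _ _) fun β hβ x hx => ?_
  change ‖pderiv β (fun x => pderiv α g (x + y)) x‖ ≤ _
  rw [pderiv_comp_add, ← pderiv_add_index _ _ g.contDiff, add_comm β]
  refine norm_pderiv_le (add_mem_multiIdx hα hβ) g (mem_ballCompacts.2 ?_)
  rw [add_comm R']
  exact (norm_add_le _ _).trans (add_le_add (mem_ballCompacts.1 hx) hy)

/-- Sobolev's inequality costs n derivatives and enlarges the ball by 1; Hölder's inequality passes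
from L¹ to L². The aim is a Hilbert norm dominating the seminorms. -/
theorem exists_seminorms_le_eLpNorm (m : ℕ) (R : ℝ) : ∃ C : ℝ, 0 ≤ C ∧ ∀ (g : SmoothFn n) (r : ℝ),
    0 ≤ r → (∀ γ ∈ multiIdx n (n + m), eLpNorm (pderiv γ g) 2
      (volume.restrict (Metric.closedBall (0 : Rn n) (R + 1))) ≤ ENNReal.ofReal r) →
    seminorms n (m, ballCompacts n R) g ≤ C * r := by
  obtain ⟨C, hC, hS⟩ := exists_sobolev n
  set μ := volume.restrict (Metric.closedBall (0 : Rn n) (R + 1))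
  have hμ : μ Set.univ ≠ ⊤ := by
    rw [Measure.restrict_apply_univ]
    exact (isCompact_closedBall _ _).measure_lt_top.ne
  set D : ℝ≥0∞ := μ Set.univ ^ (1 / (1 : ℝ≥0∞).toReal - 1 / (2 : ℝ≥0∞).toReal)
  have hD : D ≠ ⊤ := ENNReal.rpow_ne_top_of_nonneg (by norm_num) hμ
  set A : ℝ≥0∞ := C * ((multiIdx n n).card * D)
  have hA : A ≠ ⊤ := ENNReal.mul_ne_top hC (ENNReal.mul_ne_top (ENNReal.natCast_ne_top _) hD)
  refine ⟨A.toReal, ENNReal.toReal_nonneg, fun g r hr h => ?_⟩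
  refine seminorms_le (by positivity) fun α hα x hx => ?_
  have key : ‖pderiv α g x‖ₑ ≤ A * ENNReal.ofReal r := by
    refine (hS _ (contDiff_pderiv α g.contDiff) x).trans ?_
    have : ∀ β ∈ multiIdx n n, ∫⁻ z in Metric.closedBall x 1, ‖pderiv β (pderiv α g) z‖ₑ ≤
        ENNReal.ofReal r * D := by
      intro β hβ
      rw [← pderiv_add_index _ _ g.contDiff]
      have hcont := continuous_pderiv (β + α) g.contDiff
      calc ∫⁻ z in Metric.closedBall x 1, ‖pderiv (β + α) g z‖ₑ
          ≤ ∫⁻ z, ‖pderiv (β + α) g z‖ₑ ∂μ := by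
            refine lintegral_mono_set (Metric.closedBall_subset_closedBall' ?_)
            rw [dist_zero_right]
            linarith [mem_ballCompacts.1 hx]
        _ = eLpNorm (pderiv (β + α) g) 1 μ := eLpNorm_one_eq_lintegral_enorm.symm
        _ ≤ eLpNorm (pderiv (β + α) g) 2 μ * D :=
            eLpNorm_le_eLpNorm_mul_rpow_measure_univ (by norm_num) hcont.aestronglyMeasurable
        _ ≤ ENNReal.ofReal r * D := by gcongr; exact h _ (add_mem_multiIdx hβ hα)
    refine (mul_le_mul_right (Finset.sum_le_sum this) C).trans (le_of_eq ?_)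
    rw [Finset.sum_const, nsmul_eq_mul]
    ring
  have := ENNReal.toReal_mono (ENNReal.mul_ne_top hA ENNReal.ofReal_ne_top) key
  rwa [toReal_enorm, ENNReal.toReal_mul, ENNReal.toReal_ofReal hr] at this

theorem memLp_two_restrict (g : SmoothFn n) (α : Fin n → ℕ) (R : ℝ) :
    MemLp (pderiv α g) 2 (volume.restrict (Metric.closedBall (0 : Rn n) R)) := by
  obtain ⟨_, hC⟩ := (isCompact_closedBall (0 : Rn n) R).exists_bound_of_continuousOn
    (continuous_pderiv α g.contDiff).continuousOn
  have : IsFiniteMeasure (volume.restrict (Metric.closedBall (0 : Rn n) R)) :=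
    ⟨by rw [Measure.restrict_apply_univ]; exact (isCompact_closedBall _ _).measure_lt_top⟩
  exact MemLp.of_bound (continuous_pderiv α g.contDiff).aestronglyMeasurable _
    (ae_restrict_of_forall_mem Metric.isClosed_closedBall.measurableSet hC)

/-- The derivatives of order at most `M` as elements of `L²` of a ball. -/
noncomputable def jet (M : ℕ) (R : ℝ) : SmoothFn n →ₗ[ℂ]
    PiLp 2 fun _ : multiIdx n M => Lp ℂ 2 (volume.restrict (Metric.closedBall (0 : Rn n) R)) where
  toFun g := WithLp.toLp 2 fun α => (memLp_two_restrict g α R).toLp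
  map_add' f g := by
    ext1 α
    change (memLp_two_restrict (f + g) α R).toLp =
      (memLp_two_restrict f α R).toLp + (memLp_two_restrict g α R).toLp
    rw [← MemLp.toLp_add]
    exact MemLp.toLp_congr _ _ (by rw [coe_add, pderiv_add α.1 f.contDiff g.contDiff])
  map_smul' c g := by
    ext1 α
    change (memLp_two_restrict (c • g) α R).toLp = c • (memLp_two_restrict g α R).toLp
    rw [← MemLp.toLp_const_smul]
    exact MemLp.toLp_congr _ _ (by rw [coe_smul, pderiv_smul α.1 c g.contDiff])

theorem coeFn_jet (M : ℕ) (R : ℝ) (g : SmoothFn n) (α : multiIdx n M) :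
    jet M R g α =ᵐ[volume.restrict (Metric.closedBall (0 : Rn n) R)] pderiv α g :=
  (memLp_two_restrict g α R).coeFn_toLp

end SmoothFn

/-- A functional that is bounded by a Hilbert space norm is represented by a vector. -/
theorem exists_inner_eq_of_norm_le {V H : Type*} [AddCommGroup V] [Module ℂ V]
    [NormedAddCommGroup H] [InnerProductSpace ℂ H] [CompleteSpace H] (J : V →ₗ[ℂ] H)
    (T : V →ₗ[ℂ] ℂ) {C : ℝ} (h : ∀ v, ‖T v‖ ≤ C * ‖J v‖) : ∃ w : H, ∀ v, T v = inner ℂ w (J v) := by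
  -- A linear section of J turns T into a bounded functional on the range of J, which Hahn–Banach
  -- extends to H and Riesz represents.
  obtain ⟨s, hs⟩ := LinearMap.exists_rightInverse_of_surjective J.rangeRestrict
    J.range_rangeRestrict
  have hJs : ∀ z, J (s z) = z := fun z => congrArg Subtype.val (LinearMap.congr_fun hs z)
  obtain ⟨g, hg, -⟩ := exists_extension_norm_eq (LinearMap.range J)
    ((T.comp s).mkContinuous C fun z => by
      have := h (s z)
      rwa [hJs] at this)
  refine ⟨(InnerProductSpace.toDual ℂ H).symm g, fun v => ?_⟩
  rw [InnerProductSpace.toDual_symm_apply]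
  have h1 := hg (J.rangeRestrict v)
  -- By the bound, T vanishes on the kernel of J, so the choice of section is immaterial.
  have h0 : J (s (J.rangeRestrict v) - v) = 0 := by
    rw [map_sub, hJs]
    exact sub_self _
  have h2 := h (s (J.rangeRestrict v) - v)
  rw [h0, norm_zero, mul_zero, norm_le_zero_iff, map_sub, sub_eq_zero] at h2
  exact h2.symm.trans h1.symm

namespace EPrime

theorem exists_bound (T : EPrime n) : ∃ (m : ℕ) (C : ℝ), 0 ≤ C ∧
    ∀ g, ‖T g‖ ≤ C * SmoothFn.seminorms n (m, ballCompacts n m) g := by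
  obtain ⟨s, C, -, h⟩ := Seminorm.bound_of_continuous (SmoothFn.withSeminorms n)
    ((normSeminorm ℂ ℂ).comp T.toLinearMap) T.continuous.norm
  obtain ⟨N, h1, h2⟩ := exists_le_ballCompacts (n := n) (s.sup Prod.fst) (s.sup Prod.snd)
  refine ⟨N, C, C.2, fun g => (h g).trans ?_⟩
  refine mul_le_mul_of_nonneg_left ?_ C.2
  refine Seminorm.finset_sup_apply_le (apply_nonneg _ _) fun i hi => ?_
  exact SmoothFn.seminorms_mono ((Finset.le_sup (f := Prod.fst) hi).trans h1)
    ((Finset.le_sup (f := Prod.snd) hi).trans h2) g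

/-- Every distribution with compact support is a finite sum of derivatives of integrable functions
with compact support. -/
theorem exists_rep (T : EPrime n) : ∃ (m : ℕ) (k : (Fin n → ℕ) → Rn n → ℂ) (R : ℝ),
    (∀ α, Integrable (k α)) ∧ (∀ α x, k α x ≠ 0 → ‖x‖ ≤ R) ∧ ∀ g : SmoothFn n, T g = rep m k g := by
  classical
  obtain ⟨m, C, hC, hT⟩ := exists_bound T
  obtain ⟨C', hC', h⟩ := SmoothFn.exists_seminorms_le_eLpNorm (n := n) m m
  set R : ℝ := m + 1
  set M : ℕ := n + m
  set μ := volume.restrict (Metric.closedBall (0 : Rn n) R) with hμ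
  have : IsFiniteMeasure μ :=
    ⟨by rw [Measure.restrict_apply_univ]; exact (isCompact_closedBall _ _).measure_lt_top⟩
  obtain ⟨w, hw⟩ := exists_inner_eq_of_norm_le (SmoothFn.jet M R) T.toLinearMap (C := C * C')
    fun g => by
      rw [mul_assoc]
      refine (hT g).trans (mul_le_mul_of_nonneg_left (h g _ (norm_nonneg _) fun γ hγ => ?_) hC)
      rw [← eLpNorm_congr_ae (SmoothFn.coeFn_jet M R g ⟨γ, hγ⟩), ← Lp.enorm_def,
        ← ofReal_norm]
      exact ENNReal.ofReal_le_ofReal (PiLp.norm_apply_le _ _)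
  -- The sign cancels the one in `rep`, and the conjugate cancels that of the inner product.
  let k : (Fin n → ℕ) → Rn n → ℂ := fun α => (Metric.closedBall (0 : Rn n) R).indicator
    fun x => if hα : α ∈ multiIdx n M then
      (-1) ^ (∑ i, α i) * (starRingEnd ℂ) (w ⟨α, hα⟩ x) else 0
  refine ⟨M, k, R, fun α => ?_, fun α x hx => ?_, fun g => ?_⟩
  · refine (integrable_indicator_iff Metric.isClosed_closedBall.measurableSet).2 ?_
    by_cases hα : α ∈ multiIdx n M
    · simp only [hα, dif_pos]
      have : Integrable (w ⟨α, hα⟩) μ := (Lp.memLp (w ⟨α, hα⟩)).integrable (by norm_num)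
      exact (Complex.conjLIE.integrable_comp_iff.2 this).const_mul _
    · simp [hα]
  · by_contra hR
    exact hx (Set.indicator_of_notMem (by simpa using hR) _)
  · refine (hw g).trans ?_
    rw [PiLp.inner_apply, rep, ← Finset.sum_coe_sort (multiIdx n M)]
    refine Finset.sum_congr rfl fun α _ => ?_
    have e : (fun x => pderiv α g x * k α x) = (Metric.closedBall (0 : Rn n) R).indicator
        fun x => (-1) ^ (∑ i, α.1 i) * inner ℂ (w α x) (pderiv α g x) := by
      funext x
      simp only [k, α.2, dif_pos, Set.indicator_apply, RCLike.inner_apply]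
      split_ifs <;> ring
    rw [e, integral_indicator Metric.isClosed_closedBall.measurableSet, integral_const_mul,
      ← mul_assoc, ← mul_pow, neg_one_mul, neg_neg, one_pow, one_mul, L2.inner_def]
    refine integral_congr_ae ?_
    filter_upwards [SmoothFn.coeFn_jet M R g α] with x hx
    rw [hx]

/-- `g ↦ (y ↦ ⟨g(· + y), T⟩)` as an endomorphism of `ℰ`. -/
noncomputable def transfer (T : EPrime n) : SmoothFn n →ₗ[ℂ] SmoothFn n where
  toFun g := (⟨fun y => T (SmoothFn.translate g y), by
    obtain ⟨m, k, R, hk, hR, h⟩ := exists_rep T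
    simp only [h]
    exact contDiff_repCorr hk g.contDiff fun α => translatesBounded_of_support g.contDiff (hR α)⟩ :
    smoothSubmodule n)
  map_add' f g := SmoothFn.ext fun y =>
    map_add T (SmoothFn.translate f y) (SmoothFn.translate g y)
  map_smul' c g := SmoothFn.ext fun y => map_smul T c (SmoothFn.translate g y)

theorem coe_transfer (T : EPrime n) {m : ℕ} {k : (Fin n → ℕ) → Rn n → ℂ}
    (h : ∀ g : SmoothFn n, T g = rep m k g) (g : SmoothFn n) : ⇑(transfer T g) = repCorr m k g :=
  funext fun _ => h _

theorem pderiv_transfer (T : EPrime n) (g : SmoothFn n) (α : Fin n → ℕ) :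
    pderiv α (transfer T g) = transfer T (SmoothFn.deriv α g) := by
  obtain ⟨m, k, R, hk, hR, h⟩ := exists_rep T
  rw [coe_transfer T h, coe_transfer T h,
    pderiv_repCorr hk g.contDiff fun α => translatesBounded_of_support g.contDiff (hR α)]
  rfl

/-- If T is bounded by the seminorm of order m on the ball of radius m, then derivatives of order up
to N of the transfer on the ball of radius N are bounded by the seminorm with N + m in both places.
-/
theorem continuous_transfer (T : EPrime n) : Continuous (transfer T) := by
  obtain ⟨m, C, hC, h⟩ := exists_bound T
  refine WithSeminorms.continuous_of_isBounded (SmoothFn.withSeminorms n)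
    (SmoothFn.withSeminorms n) _
    fun i => ?_
  obtain ⟨N, h1, h2⟩ := exists_le_ballCompacts i.1 i.2
  refine ⟨{(N + m, ballCompacts n (N + m))}, ⟨C, hC⟩, fun g => ?_⟩
  rw [Finset.sup_singleton]
  refine SmoothFn.seminorms_le (mul_nonneg hC (apply_nonneg _ _)) fun α hα y hy => ?_
  rw [pderiv_transfer]
  refine (h _).trans (mul_le_mul_of_nonneg_left ?_ hC)
  exact SmoothFn.seminorms_translate_deriv_le
    (mem_multiIdx.2 ((mem_multiIdx.1 hα).trans h1)) (mem_ballCompacts.1 (h2 hy)) g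

/-- The convolution `ℰ' × ℰ' → ℰ'`. -/
noncomputable def conv (n : ℕ) : EPrime n →ₗ[ℂ] EPrime n →ₗ[ℂ] EPrime n :=
  LinearMap.mk₂ ℂ (fun S T => S.comp ⟨transfer T, continuous_transfer T⟩)
    (fun _ _ _ => rfl) (fun _ _ _ => rfl)
    (fun S T T' => ContinuousLinearMap.ext fun g => map_add S (transfer T g) (transfer T' g))
    (fun c S T => ContinuousLinearMap.ext fun g => map_smul S c (transfer T g))

theorem isConvolution_conv (S T : EPrime n) :
    IsConvolution (toDistr S) (toDistr T) (toDistr (conv n S T)) := by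
  -- The supports can be forgotten here: the identity concerns test functions only, and integrable
  -- coefficients suffice.
  obtain ⟨m, f, -, hf, -, hS⟩ := exists_rep S
  obtain ⟨m', k, -, hk, -, hT⟩ := exists_rep T
  refine isConvolution_of_rep (p := ⊤) (q := 1) (m := m) (m' := m')
    (fun α => memLp_one_iff_integrable.2 (hf α)) hk
    (fun φ => hS (testToSmooth n φ)) (fun φ => hT (testToSmooth n φ)) fun φ => ?_
  refine (hS (transfer T (testToSmooth n φ))).trans ?_
  rw [coe_transfer T hT]
  rfl

theorem conv_assoc (R S T : EPrime n) : conv n (conv n R S) T = conv n R (conv n S T) := by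
  refine ContinuousLinearMap.ext fun g => ?_
  change R (transfer S (transfer T g)) = R (transfer (conv n S T) g)
  congr 1
  refine SmoothFn.ext fun y => ?_
  change S (SmoothFn.translate (transfer T g) y) = S (transfer T (SmoothFn.translate g y))
  congr 1
  refine SmoothFn.ext fun z => ?_
  change T (SmoothFn.translate g (z + y)) = T (SmoothFn.translate (SmoothFn.translate g y) z)
  congr 1
  refine SmoothFn.ext fun w => ?_
  change g (w + (z + y)) = g (w + z + y)
  rw [add_assoc]

/-- The polar argument with the seminorms of order j over the ball of radius j. One index governs
both the number of derivatives and the size of the translation, and both add under transfer as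
`exists_scaling` requires. -/
theorem continuous_conv (n : ℕ) : Continuous fun z : EPrime n × EPrime n => conv n z.1 z.2 := by
  refine continuous_bilin_of_polars (E := EPrime n) (F := EPrime n) (V := SmoothFn n)
    (W := SmoothFn n) LinearMap.id Topology.IsInducing.id LinearMap.id Topology.IsInducing.id
    (conv n) fun B hB => ?_
  obtain ⟨c, hc, hcB⟩ := exists_scaling (fun m (g : SmoothFn n) =>
    SmoothFn.seminorms n (m, ballCompacts n m) g)
    (fun m => SmoothFn.isVonNBounded_iff.1 hB (m, ballCompacts n m))
    fun m m' g h => SmoothFn.seminorms_mono h (fun x hx => mem_ballCompacts.2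
      ((mem_ballCompacts.1 hx).trans (by exact_mod_cast h))) g
  refine ⟨{h | ∀ (j : ℕ), ∀ α ∈ multiIdx n j, ∀ y : Rn n, ‖y‖ ≤ j → ‖pderiv α h y‖ ≤ c j},
    {e | ∃ g ∈ B, ∃ (j : ℕ), ∃ α ∈ multiIdx n j, ∃ y : Rn n, ‖y‖ ≤ j ∧
      e = ((c j : ℂ)⁻¹) • SmoothFn.translate (SmoothFn.deriv α g) y}, ?_, ?_, ?_⟩
  · refine SmoothFn.isVonNBounded_iff.2 fun i => ?_
    obtain ⟨N, h1, h2⟩ := exists_le_ballCompacts i.1 i.2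
    refine ⟨c N + 1, by linarith [hc N], fun h hh => lt_of_le_of_lt ?_ (lt_add_one _)⟩
    exact SmoothFn.seminorms_le (hc N).le fun α hα y hy =>
      hh N α (mem_multiIdx.2 ((mem_multiIdx.1 hα).trans h1)) y (mem_ballCompacts.1 (h2 hy))
  · refine SmoothFn.isVonNBounded_iff.2 fun i => ?_
    obtain ⟨N, h1, h2⟩ := exists_le_ballCompacts i.1 i.2
    obtain ⟨r, hr, hrB⟩ := hcB N
    refine ⟨r, hr, ?_⟩
    rintro _ ⟨g, hg, j, α, hα, y, hy, rfl⟩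
    refine lt_of_le_of_lt ?_ (hrB j g hg)
    rw [map_smul_eq_mul, norm_inv, Complex.norm_of_nonneg (hc j).le]
    refine mul_le_mul_of_nonneg_left ?_ (inv_nonneg.2 (hc j).le)
    refine (SmoothFn.seminorms_mono h1 h2 _).trans ?_
    rw [Nat.cast_add]
    exact SmoothFn.seminorms_translate_deriv_le hα hy g
  · intro S T hS hT g hg
    refine hS (transfer T g) fun j α hα y hy => ?_
    rw [pderiv_transfer]
    exact norm_inv_smul_bound (hc j) (f := T) (fun a v => map_smul T a v)
      (hT _ ⟨g, hg, j, α, hα, y, hy, rfl⟩)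

end EPrime

end CompactSupport

end DistSpaces

/-! ### Assembly of the theorem. -/

theorem proposition3 (n : ℕ) :
    -- multiplications
    (∀ (p : ℝ≥0∞) [Fact (1 ≤ p)], ∃ m : DL n p →ₗ[ℂ] DL n ⊤ →ₗ[ℂ] DL n p,
      (∀ f g x, m f g x = f x * g x) ∧ Continuous fun z : DL n p × DL n ⊤ => m z.1 z.2) ∧
    (∃ m : BDot n →ₗ[ℂ] DL n ⊤ →ₗ[ℂ] BDot n,
      (∀ f g x, (m f g : DL n ⊤) x = (f : DL n ⊤) x * g x) ∧
        Continuous fun z : BDot n × DL n ⊤ => m z.1 z.2) ∧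
    (∃ m : SmoothFn n →ₗ[ℂ] SmoothFn n →ₗ[ℂ] SmoothFn n,
      (∀ f g x, m f g x = f x * g x) ∧
        (Continuous fun z : SmoothFn n × SmoothFn n => m z.1 z.2) ∧ IsTopologicalAlgebra m) ∧
    (∃ m : DL n ⊤ →ₗ[ℂ] DL n ⊤ →ₗ[ℂ] DL n ⊤,
      (∀ f g x, m f g x = f x * g x) ∧ IsTopologicalAlgebra m) ∧
    -- convolutions
    (∀ (q : ℝ≥0∞) [Fact (1 ≤ q)], 1 < q → ∃ c : DPrimeL n q →ₗ[ℂ] DPrimeLOne n →ₗ[ℂ] DPrimeL n q,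
      (∀ S T, IsConvolution (DPrimeL.toDistr S) (DPrimeLOne.toDistr T) (DPrimeL.toDistr (c S T))) ∧
        Continuous fun z : DPrimeL n q × DPrimeLOne n => c z.1 z.2) ∧
    (∃ c : DPrimeLOne n →ₗ[ℂ] DPrimeLOne n →ₗ[ℂ] DPrimeLOne n,
      (∀ S T, IsConvolution (DPrimeLOne.toDistr S) (DPrimeLOne.toDistr T)
        (DPrimeLOne.toDistr (c S T))) ∧
        (Continuous fun z : DPrimeLOne n × DPrimeLOne n => c z.1 z.2) ∧
        IsTopologicalAlgebra (A := DPrimeLOne n) c) ∧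
    (∃ c : EPrime n →ₗ[ℂ] EPrime n →ₗ[ℂ] EPrime n,
      (∀ S T, IsConvolution (EPrime.toDistr S) (EPrime.toDistr T) (EPrime.toDistr (c S T))) ∧
        (Continuous fun z : EPrime n × EPrime n => c z.1 z.2) ∧ IsTopologicalAlgebra c) := by
  refine ⟨fun p _ => ⟨DL.mul n p, fun _ _ _ => rfl, DL.continuous_mul n p⟩,
    ⟨BDot.mul n, fun _ _ _ => rfl, BDot.continuous_mul n⟩,
    ⟨SmoothFn.mul n, fun _ _ _ => rfl, SmoothFn.continuous_mul n, ?_, inferInstance, inferInstance,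
      SmoothFn.continuous_mul n⟩,
    ⟨DL.mul n ⊤, fun _ _ _ => rfl, ?_, inferInstance, inferInstance, DL.continuous_mul n ⊤⟩,
    fun q _ hq => ⟨DPrimeL.conv n hq, DPrimeL.isConvolution_conv hq, DPrimeL.continuous_conv hq⟩,
    ⟨DPrimeLOne.conv n, DPrimeLOne.isConvolution_conv, DPrimeLOne.continuous_conv n,
      DPrimeLOne.conv_assoc, inferInstance, inferInstance, DPrimeLOne.continuous_conv n⟩,
    ⟨EPrime.conv n, EPrime.isConvolution_conv, EPrime.continuous_conv n, EPrime.conv_assoc,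
      inferInstance, inferInstance, EPrime.continuous_conv n⟩⟩
  · exact fun f g h => SmoothFn.ext fun x => mul_assoc (f x) (g x) (h x)
  · exact fun f g h => DL.ext fun x => mul_assoc (f x) (g x) (h x)
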